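/- Setting. Let $d\ge 1$, let $(\Omega,\mathbb P)$ be a probability space with an ergodic group $\{\tau_a\}_{a\in\mathbb Z^d}$ of measure preserving transformations, and let $\mathcal H=\ell^2(\mathbb Z^d)$ or $\mathcal H=L^2(\mathbb R^d)$, with $\mathcal H_c\subset\mathcal H$ the functions of compact support and $\chi_a$ multiplication by the characteristic function of the unit cube centered at $a$. Let $U$ be a unitary projective representation of $\mathbb Z^d$ on $\mathcal H$ with $U(a)\chi_bU(a)^*=\chi_{b+a}$, and let $\omega\mapsto H_\omega$ be a measurable map into the self-adjoint operators on $\mathcal H$ such that, for each $a$, $U(a)H_\omega U(a)^*=H_{\tau_a\omega}$ for $\mathbb P$-a.e. $\omega$. Assume that $H_\omega$ is a magnetic Schrödinger operator for $\mathbb P$-a.e. $\omega$: * if $\mathcal H=\ell^2(\mathbb Z^d)$, then $(H_\omega\varphi)(x)=\sum_{|y-x|=1}e^{-i\vartheta_\omega(x,y)}\varphi(y)+V_\omega(x)\varphi(x)$ for $\varphi\in\mathcal H_c$, where $\vartheta_\omega(x,y)=-\vartheta_\omega(y,x)\in\mathbb R$ on bonds, $\vartheta$ and $V$ are measurable in $\omega$,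 and $V_\omega$ is real and almost surely bounded from below; * if $\mathcal H=L^2(\mathbb R^d)$, then $H_\omega=(-i\nabla-\mathbf A_\omega)^2+V_\omega$ with jointly measurable real potentials, $|\mathbf A_\omega|^2$ and $V_\omega$ locally integrable, where the expression (in the sense of distributions) maps $C_c^\infty(\mathbb R^d)$ into $L^2$ and is essentially self-adjoint there with closure $H_\omega$, and $H_\omega+\gamma\ge 1$ almost surely for some $\gamma\ge 0$. Let $\mathcal K_2$ be the Hilbert space of ($\mathbb P$-a.e. classes of) measurable, covariant, locally bounded maps $A:\Omega\to\mathrm{Lin}(\mathcal H_c,\mathcal H)$ with $\mathbb E\,\mathrm{tr}(\chi_0A_\omega^*A_\omega\chi_0)<\infty$, with inner product $\langle\langle A,B\rangle\rangle=\mathbb E\,\mathrm{tr}(\chi_0A_\omega^*B_\omega\chi_0)$. Write $A^\ddagger_\omega=A_\omega^*|_{\mathcal H_c}$, $(B\odot_LA)_\omega=B_\omega A_\omega$ and $(A\odot_RB)_\omega=A_\omega^{\ddagger *}B_\omega$. Define commuting self-adjoint operators $\mathcal H_L,\mathcal H_R,\mathcal L$ on $\mathcal K_2$ by Stone's theorem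 from the unitary groups $$e^{-it\mathcal H_L}A=e^{-itH}\odot_LA,\qquad e^{-it\mathcal H_R}A=A\odot_Re^{-itH},\qquad e^{-it\mathcal L}A=e^{-itH}\odot_LA\odot_Re^{itH}.$$ Let $E_F\in\mathbb R$, $P_{E_F}=\chi_{]-\infty,E_F]}(H)$, and assume that $Y_{E_F}:=i[X_1,P_{E_F}]\in\mathcal K_2$, where $X_1$ is multiplication by the first coordinate. Put $\mathcal P_{E_F}=\chi_{]-\infty,E_F]}(\mathcal H_L)-\chi_{]-\infty,E_F]}(\mathcal H_R)$. The conductivity measure is $$\Sigma_{E_F}(B)=\pi\,\langle\langle Y_{E_F},\chi_B(\mathcal L)(-\mathcal L\,\mathcal P_{E_F})Y_{E_F}\rangle\rangle\in[0,\infty]\qquad(B\subset\mathbb R\text{ Borel}),$$ where, the operator $-\mathcal L\mathcal P_{E_F}$ being positive and possibly unbounded, the right-hand side means the increasing limit as $n\to\infty$ of the same expression with $\mathcal P_{E_F}Y_{E_F}$ replaced by $\chi_{[-n,n]}(\mathcal L)\mathcal P_{E_F}Y_{E_F}$. Let $\Psi_{E_F}$ be the finite Borel measure on $\mathbb R^2$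 given by $$\Psi_{E_F}(C)=\langle\langle Y_{E_F},\chi_C(\mathcal H_L,\mathcal H_R)Y_{E_F}\rangle\rangle .$$ Proposition. For all Borel sets $B\subset\mathbb R$, $$\Sigma_{E_F}(B)=\pi\int_{\mathbb R^2}\Psi_{E_F}(d\lambda_1d\lambda_2)\,|\lambda_1-\lambda_2|\,\chi_B(\lambda_1-\lambda_2)$$ as an identity in $[0,\infty]$. Whenever $\mathcal P_{E_F}Y_{E_F}$ lies in the domain of $\mathcal L$, the function $|\lambda_1-\lambda_2|$ is $\Psi_{E_F}$-integrable and the inner product $\pi\langle\langle Y_{E_F},\chi_B(\mathcal L)(-\mathcal L\,\mathcal P_{E_F}Y_{E_F})\rangle\rangle$, taken literally, is equal to the right-hand side. Moreover $\Psi_{E_F}$ is supported by $$\mathbb S_{E_F}=\bigl(]-\infty,E_F]\times]E_F,\infty[\bigr)\cup\bigl(]E_F,\infty[\times]-\infty,E_F]\bigr),$$ that is, $\Psi_{E_F}(\mathbb R^2\setminus\mathbb S_{E_F})=0$. -/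

import Mathlib

open MeasureTheory Filter Topology
open scoped ENNReal InnerProductSpace

noncomputable section

namespace MagneticKubo

/-! ## Projection-valued measures, spectral measures, Stone generators -/

/-- A projection-valued measure on `α` acting on `K`: a strongly countably additive, multiplicative
family of orthogonal projections with total mass `1` (by convention `0` on nonmeasurable sets). -/
structure PVM (α : Type*) [MeasurableSpace α] (K : Type*) [NormedAddCommGroup K]
    [InnerProductSpace ℂ K] where
  proj : Set α → K →L[ℂ] K
  not_measurable : ∀ B, ¬ MeasurableSet B → proj B = 0
  symm : ∀ B x y, ⟪proj B x, y⟫_ℂ = ⟪x, proj B y⟫_ℂ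
  univ : proj Set.univ = 1
  inter : ∀ B C, MeasurableSet B → MeasurableSet C → proj (B ∩ C) = proj B * proj C
  iUnion : ∀ f : ℕ → Set α, (∀ n, MeasurableSet (f n)) → Pairwise (Function.onFun Disjoint f) →
    ∀ x, HasSum (fun n => proj (f n) x) (proj (⋃ n, f n) x)

namespace PVM

variable {α β : Type*} [MeasurableSpace α] [MeasurableSpace β] {K : Type*} [NormedAddCommGroup K]
  [InnerProductSpace ℂ K]

theorem proj_empty (E : PVM α K) : E.proj ∅ = 0 := by
  ext x
  have h := E.iUnion (fun _ => ∅) (fun _ => MeasurableSet.empty) (fun _ _ _ => by simp) x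
  have h2 := h.summable.tendsto_atTop_zero
  simpa using tendsto_nhds_unique tendsto_const_nhds h2

theorem inner_proj_self (E : PVM α K) {B : Set α} (hB : MeasurableSet B) (x : K) :
    ⟪x, E.proj B x⟫_ℂ = ((‖E.proj B x‖ ^ 2 : ℝ) : ℂ) := by
  have h : E.proj B x = E.proj B (E.proj B x) := by
    conv_lhs => rw [← Set.inter_self B, E.inter B B hB hB]
    rfl
  rw [h, ← E.symm, inner_self_eq_norm_sq_to_K, ← h]
  norm_cast

/-- The scalar spectral measure `B ↦ ⟪x, E(B) x⟫`. -/
def measure (E : PVM α K) (x : K) : Measure α :=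
  Measure.ofMeasurable (fun B _ => ENNReal.ofReal (⟪x, E.proj B x⟫_ℂ).re)
    (by simp [proj_empty])
    (by
      intro f hf hd
      have h := (E.iUnion f hf hd x).mapL (innerSL ℂ x)
      have h' := Complex.hasSum_re h
      simp only [innerSL_apply_apply] at h'
      rw [← h'.tsum_eq, ENNReal.ofReal_tsum_of_nonneg _ h'.summable]
      intro n
      rw [E.inner_proj_self (hf n), Complex.ofReal_re]
      positivity)

/-- The image of a projection-valued measure under a measurable map. -/
def map (E : PVM α K) (f : α → β) (hf : Measurable f) : PVM β K where
  proj B := by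
    classical
    exact if MeasurableSet B then E.proj (f ⁻¹' B) else 0
  not_measurable B hB := by simp [hB]
  symm B x y := by
    by_cases hB : MeasurableSet B
    · simp [hB, E.symm]
    · simp [hB]
  univ := by simp [E.univ]
  inter B C hB hC := by
    simp [hB, hC, hB.inter hC, E.inter _ _ (hf hB) (hf hC)]
  iUnion g hg hd x := by
    have h := E.iUnion (fun n => f ⁻¹' g n) (fun n => hf (hg n))
      (fun i j hij => (hd hij).preimage f) x
    simpa [hg, MeasurableSet.iUnion hg] using h

/-- The point mass of a projection-valued measure; it only serves to show that there is one. -/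
def dirac (a : α) : PVM α K where
  proj B := by
    classical
    exact if MeasurableSet B ∧ a ∈ B then 1 else 0
  not_measurable B hB := by simp [hB]
  symm B x y := by split_ifs <;> simp
  univ := by simp
  inter B C hB hC := by
    by_cases h1 : a ∈ B <;> by_cases h2 : a ∈ C <;> simp [hB, hC, h1, h2, hB.inter hC]
  iUnion g hg hd x := by
    classical
    by_cases h : ∃ n, a ∈ g n
    · obtain ⟨n, hn⟩ := h
      have h1 : a ∈ ⋃ n, g n := Set.mem_iUnion.2 ⟨n, hn⟩
      have : ∀ m, m ≠ n → a ∉ g m := fun m hm hm' =>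
        Set.disjoint_left.1 (hd hm) hm' hn
      have h2 := hasSum_single (f := fun m => (if MeasurableSet (g m) ∧ a ∈ g m then
        (1 : K →L[ℂ] K) else 0) x) n (fun m hm => by simp [this m hm])
      simpa [hg, MeasurableSet.iUnion hg, h1, hn] using h2
    · push Not at h
      have h1 : a ∉ ⋃ n, g n := by simpa using h
      simp [h, h1]

instance [Inhabited α] : Nonempty (PVM α K) := ⟨dirac default⟩

/-- The operator `∫ f dE` for a bounded Borel function `f`: the bounded operator `T` with
`⟪x, T x⟫ = ∫ f d⟪x, E x⟫` for all `x`. -/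
def integral (E : PVM α K) (f : α → ℂ) : K →L[ℂ] K :=
  Classical.epsilon fun T : K →L[ℂ] K => ∀ x, ⟪x, T x⟫_ℂ = ∫ a, f a ∂(E.measure x)

end PVM

section Operators

variable {K : Type*} [NormedAddCommGroup K] [InnerProductSpace ℂ K]

/-- `E` is the spectral measure of the (unbounded) operator `T`, i.e. `T = ∫ l dE(l)`, with domain
the vectors whose scalar spectral measure has a finite second moment. -/
def IsSpectralMeasure (E : PVM ℝ K) (T : K →ₗ.[ℂ] K) : Prop :=
  (∀ x, x ∈ T.domain ↔ ∫⁻ l, ‖l‖ₑ ^ 2 ∂(E.measure x) < ∞) ∧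
    ∀ x : T.domain, ⟪(x : K), T x⟫_ℂ = ∫ l, (l : ℂ) ∂(E.measure x)

/-- The spectral measure `B ↦ χ_B(T)` of a self-adjoint operator `T`. -/
def spectralMeasure (T : K →ₗ.[ℂ] K) : PVM ℝ K :=
  Classical.epsilon fun E => IsSpectralMeasure E T

/-- The joint spectral measure `C ↦ χ_C(S, T)` on the plane of two commuting self-adjoint operators:
its marginals are the spectral measures of `S` and of `T`, so that
`χ_{B₁ × B₂}(S, T) = χ_{B₁}(S) χ_{B₂}(T)`. -/
def jointSpectralMeasure (S T : K →ₗ.[ℂ] K) : PVM (ℝ × ℝ) K :=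
  Classical.epsilon fun E =>
    IsSpectralMeasure (E.map Prod.fst measurable_fst) S ∧
      IsSpectralMeasure (E.map Prod.snd measurable_snd) T

/-- The Stone generator `T` of a unitary group `U t = exp(-i t T)`:
`T x = i (d/dt) U t x` at `t = 0`, on all `x` for which the derivative exists. -/
def stoneGenerator (U : ℝ → K →L[ℂ] K) : K →ₗ.[ℂ] K where
  domain :=
    { carrier := {x | DifferentiableAt ℝ (fun t => U t x) 0}
      add_mem' := fun {x y} hx hy => by
        simpa using DifferentiableAt.fun_add hx hy
      zero_mem' := by simp
      smul_mem' := fun c x hx => by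
        simpa using DifferentiableAt.fun_const_smul hx c }
  toFun :=
    { toFun := fun x => Complex.I • deriv (fun t => U t (x : K)) 0
      map_add' := fun x y => by
        have h := deriv_fun_add x.2 y.2
        simp only [Submodule.coe_add, map_add, h, smul_add]
      map_smul' := fun c x => by
        have h := deriv_fun_const_smul c x.2
        simp only [Submodule.coe_smul, map_smul, h, RingHom.id_apply]
        rw [smul_comm] }

/-- `T x` for `x` in the domain of `T` (and `0` otherwise). -/
def applyOp (T : K →ₗ.[ℂ] K) (x : K) : K := by
  classical
  exact if h : x ∈ T.domain then T ⟨x, h⟩ else 0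

end Operators

/-! ## The one-particle Hilbert space, on the lattice and in the continuum -/

/-- A measure space of positions with coordinate functions; only `lattice d` and `continuum d`
below are used. -/
structure ConfigSpace (d : ℕ) where
  Pt : Type
  [meas : MeasurableSpace Pt]
  vol : Measure Pt
  pos : Pt → Fin d → ℝ
  measurable_pos : Measurable pos
  separable : IsSeparable vol

attribute [instance] ConfigSpace.meas ConfigSpace.separable

/-- The lattice `ℤ^d` with the counting measure. -/
abbrev lattice (d : ℕ) : ConfigSpace d where
  Pt := Fin d → ℤ
  vol := Measure.count
  pos x j := x j
  measurable_pos := measurable_of_countable _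
  separable := inferInstance

/-- The space `ℝ^d` with Lebesgue measure. -/
abbrev continuum (d : ℕ) : ConfigSpace d where
  Pt := EuclideanSpace ℝ (Fin d)
  vol := volume
  pos x j := x j
  measurable_pos := by fun_prop
  separable := inferInstance

namespace ConfigSpace

variable {d : ℕ} (C : ConfigSpace d)

/-- The Hilbert space `ℓ²(ℤ^d)`, resp. `L²(ℝ^d)`. -/
abbrev Hil : Type := Lp ℂ 2 C.vol

/-- Multiplication by the characteristic function of a measurable set. -/
def restrict (s : Set C.Pt) (hs : MeasurableSet s) : C.Hil →ₗ[ℂ] C.Hil where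
  toFun f := ((Lp.memLp f).indicator hs).toLp
  map_add' f g := by
    rw [← MemLp.toLp_add]
    refine MemLp.toLp_congr _ _ ?_
    filter_upwards [Lp.coeFn_add f g] with x h
    by_cases hx : x ∈ s
    · simpa only [Set.indicator_of_mem hx, Pi.add_apply] using h
    · simp [hx]
  map_smul' c f := by
    rw [RingHom.id_apply, ← MemLp.toLp_const_smul]
    refine MemLp.toLp_congr _ _ ?_
    filter_upwards [Lp.coeFn_smul c f] with x h
    by_cases hx : x ∈ s
    · simpa only [Set.indicator_of_mem hx, Pi.smul_apply] using h
    · simp [hx]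

theorem coeFn_restrict (s : Set C.Pt) (hs : MeasurableSet s) (f : C.Hil) :
    C.restrict s hs f =ᵐ[C.vol] s.indicator f := by
  have hm : MemLp (s.indicator f) 2 C.vol := (Lp.memLp f).indicator hs
  exact hm.coeFn_toLp

/-- The functions of compact support: those vanishing almost everywhere outside a bounded set. -/
def Hc : Submodule ℂ C.Hil where
  carrier := {f | ∃ R : ℝ, ∀ᵐ x ∂C.vol, R < ‖C.pos x‖ → f x = 0}
  add_mem' := by
    rintro f g ⟨R, hR⟩ ⟨S, hS⟩
    refine ⟨max R S, ?_⟩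
    filter_upwards [hR, hS, Lp.coeFn_add f g] with x h1 h2 h3 hx
    rw [h3, Pi.add_apply, h1 ((le_max_left _ _).trans_lt hx), h2 ((le_max_right _ _).trans_lt hx),
      add_zero]
  zero_mem' := ⟨0, by
    filter_upwards [Lp.coeFn_zero ℂ 2 C.vol] with x hx _
    exact hx⟩
  smul_mem' := by
    rintro c f ⟨R, hR⟩
    refine ⟨R, ?_⟩
    filter_upwards [hR, Lp.coeFn_smul c f] with x h1 h2 hx
    rw [h2, Pi.smul_apply, h1 hx, smul_zero]

theorem measurableSet_ball (R : ℝ) : MeasurableSet {x | ‖C.pos x‖ ≤ R} :=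
  measurableSet_le C.measurable_pos.norm measurable_const

theorem hc_orthogonal : C.Hcᗮ = ⊥ := by
  rw [Submodule.eq_bot_iff]
  intro f hf
  rw [Submodule.mem_orthogonal] at hf
  have key : ∀ n : ℕ, ∀ᵐ x ∂C.vol, ‖C.pos x‖ ≤ n → f x = 0 := by
    intro n
    set s := {x | ‖C.pos x‖ ≤ (n : ℝ)} with hs
    have hms : MeasurableSet s := C.measurableSet_ball n
    set g := C.restrict s hms f with hg
    have hgf : g =ᵐ[C.vol] s.indicator f := C.coeFn_restrict s hms f
    have hgH : g ∈ C.Hc := ⟨n, by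
      filter_upwards [hgf] with x hx hlt
      rw [hx, Set.indicator_of_notMem]
      simpa [hs] using hlt⟩
    have h0 := hf g hgH
    have h1 : ⟪g, f⟫_ℂ = ⟪g, g⟫_ℂ := by
      rw [L2.inner_def, L2.inner_def]
      refine integral_congr_ae ?_
      filter_upwards [hgf] with x hx
      rw [hx]
      by_cases hxs : x ∈ s <;> simp [hxs]
    rw [h1, inner_self_eq_zero] at h0
    rw [h0] at hgf
    filter_upwards [hgf, Lp.coeFn_zero ℂ 2 C.vol] with x hx hz hle
    rw [hz, Set.indicator_of_mem (show x ∈ s from hle)] at hx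
    exact hx.symm
  refine Lp.ext ?_
  filter_upwards [ae_all_iff.2 key, Lp.coeFn_zero ℂ 2 C.vol] with x hx hz
  obtain ⟨n, hn⟩ := exists_nat_ge ‖C.pos x‖
  rw [hz, hx n hn]
  rfl

theorem dense_hc : Dense (C.Hc : Set C.Hil) := by
  rw [Submodule.dense_iff_topologicalClosure_eq_top, Submodule.topologicalClosure_eq_top_iff]
  exact C.hc_orthogonal

/-- The unit cube centered at `a`. -/
def cell (a : Fin d → ℤ) : Set C.Pt :=
  {x | ∀ j, (a j : ℝ) - 1 / 2 ≤ C.pos x j ∧ C.pos x j < a j + 1 / 2}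

theorem measurableSet_cell (a : Fin d → ℤ) : MeasurableSet (C.cell a) := by
  have h : ∀ j, Measurable fun x => C.pos x j := fun j => (measurable_pi_apply j).comp C.measurable_pos
  have : C.cell a = ⋂ j, {x | (a j : ℝ) - 1 / 2 ≤ C.pos x j} ∩ {x | C.pos x j < a j + 1 / 2} := by
    ext x
    simp [cell]
  rw [this]
  exact MeasurableSet.iInter fun j =>
    (measurableSet_le measurable_const (h j)).inter (measurableSet_lt (h j) measurable_const)

/-- `χ_a`, multiplication by the characteristic function of the unit cube centered at `a`. -/
def chi (a : Fin d → ℤ) : C.Hil →ₗ[ℂ] C.Hil := C.restrict (C.cell a) (C.measurableSet_cell a)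

theorem chi_mem (a : Fin d → ℤ) (f : C.Hil) : C.chi a f ∈ C.Hc := by
  refine ⟨∑ j, (|(a j : ℝ)| + 1 / 2), ?_⟩
  filter_upwards [C.coeFn_restrict (C.cell a) (C.measurableSet_cell a) f] with x hx hlt
  rw [chi, hx, Set.indicator_of_notMem]
  intro hmem
  refine absurd hlt (not_lt.2 ?_)
  refine (pi_norm_le_iff_of_nonneg (Finset.sum_nonneg fun j _ => by positivity)).2 fun j => ?_
  have h1 : ‖C.pos x j‖ ≤ |(a j : ℝ)| + 1 / 2 := by
    have := hmem j
    rw [Real.norm_eq_abs, abs_le]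
    constructor
    · linarith [neg_abs_le (a j : ℝ)]
    · linarith [le_abs_self (a j : ℝ)]
  exact h1.trans (Finset.single_le_sum (f := fun j => |(a j : ℝ)| + 1 / 2)
    (fun i _ => by positivity) (Finset.mem_univ j))

/-- `χ_a` as a map into the functions of compact support. -/
def chiHc (a : Fin d → ℤ) : C.Hil →ₗ[ℂ] C.Hc := (C.chi a).codRestrict C.Hc (C.chi_mem a)

/-- The index set of an orthonormal basis of the Hilbert space. -/
def basisSet : Set C.Hil := (exists_hilbertBasis ℂ C.Hil).choose

/-- An orthonormal basis of the Hilbert space. -/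
def basis : HilbertBasis C.basisSet ℂ C.Hil := (exists_hilbertBasis ℂ C.Hil).choose_spec.choose

instance : SecondCountableTopology C.Hil :=
  haveI : Fact ((2 : ℝ≥0∞) ≠ ∞) := ⟨by norm_num⟩
  Lp.SecondCountableTopology

instance : Countable C.basisSet := by
  have ho := C.basis.orthonormal
  have hd : ∀ i j : C.basisSet, i ≠ j → 1 < dist (C.basis i) (C.basis j) := by
    intro i j hij
    have h1 : ‖C.basis i - C.basis j‖ ^ 2 = 2 := by
      have h := @norm_sub_sq ℂ _ _ _ _ (C.basis i) (C.basis j)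
      rw [ho.2 hij, ho.1 i, ho.1 j] at h
      rw [h]
      norm_num
    rw [dist_eq_norm]
    nlinarith [norm_nonneg (C.basis i - C.basis j)]
  refine Pairwise.countable_of_isOpen_disjoint (s := fun i => Metric.ball (C.basis i) (1 / 2))
    ?_ (fun _ => Metric.isOpen_ball) (fun i => ⟨_, Metric.mem_ball_self (by norm_num)⟩)
  intro i j hij
  refine Metric.ball_disjoint_ball ?_
  linarith [hd i j hij]

end ConfigSpace

/-! ## Square summable families of random vectors -/

section Families

variable {Ω : Type*} [MeasurableSpace Ω] {P : Measure Ω} {ι : Type*} {F : Type*}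
  [NormedAddCommGroup F]

theorem ae_summable [Countable ι] {f : Ω → ι → F} (hf : ∀ i, AEStronglyMeasurable (fun ω => f ω i) P)
    (hf2 : ∫⁻ ω, ∑' i, ‖f ω i‖ₑ ^ 2 ∂P < ∞) : ∀ᵐ ω ∂P, ∑' i, ‖f ω i‖ₑ ^ 2 < ∞ :=
  ae_lt_top' (AEMeasurable.tsum fun i => (hf i).enorm.pow_const 2) hf2.ne

theorem lintegral_add_lt_top [Countable ι] {f g : Ω → ι → F}
    (hf : ∀ i, AEStronglyMeasurable (fun ω => f ω i) P) (hf2 : ∫⁻ ω, ∑' i, ‖f ω i‖ₑ ^ 2 ∂P < ∞)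
    (hg2 : ∫⁻ ω, ∑' i, ‖g ω i‖ₑ ^ 2 ∂P < ∞) :
    ∫⁻ ω, ∑' i, ‖f ω i + g ω i‖ₑ ^ 2 ∂P < ∞ := by
  have hm : AEMeasurable (fun ω => 2 * ∑' i, ‖f ω i‖ₑ ^ 2) P :=
    (AEMeasurable.tsum fun i => (hf i).enorm.pow_const 2).const_mul 2
  refine lt_of_le_of_lt (lintegral_mono (g := fun ω =>
    2 * ∑' i, ‖f ω i‖ₑ ^ 2 + 2 * ∑' i, ‖g ω i‖ₑ ^ 2) fun ω => ?_) ?_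
  · beta_reduce
    rw [← ENNReal.tsum_mul_left, ← ENNReal.tsum_mul_left, ← ENNReal.tsum_add]
    refine ENNReal.tsum_le_tsum fun i => ?_
    have h : ‖f ω i + g ω i‖ ^ 2 ≤ 2 * ‖f ω i‖ ^ 2 + 2 * ‖g ω i‖ ^ 2 := by
      nlinarith [norm_add_le (f ω i) (g ω i), norm_nonneg (f ω i + g ω i),
        sq_nonneg (‖f ω i‖ - ‖g ω i‖)]
    have h2 := ENNReal.ofReal_le_ofReal h
    rw [ENNReal.ofReal_add (by positivity) (by positivity),
      ENNReal.ofReal_mul (by norm_num), ENNReal.ofReal_mul (by norm_num),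
      ENNReal.ofReal_pow (norm_nonneg _), ENNReal.ofReal_pow (norm_nonneg _),
      ENNReal.ofReal_pow (norm_nonneg _)] at h2
    simpa [ofReal_norm] using h2
  · rw [lintegral_add_left' hm, lintegral_const_mul' _ _ (by norm_num),
      lintegral_const_mul' _ _ (by norm_num)]
    exact ENNReal.add_lt_top.2
      ⟨ENNReal.mul_lt_top (by norm_num) hf2, ENNReal.mul_lt_top (by norm_num) hg2⟩

variable [InnerProductSpace ℂ F]

theorem enorm_inner_le (x y : F) : ‖⟪x, y⟫_ℂ‖ₑ ≤ ‖x‖ₑ ^ 2 + ‖y‖ₑ ^ 2 := by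
  have h : ‖⟪x, y⟫_ℂ‖ ≤ ‖x‖ ^ 2 + ‖y‖ ^ 2 :=
    (norm_inner_le_norm x y).trans (by nlinarith [sq_nonneg (‖x‖ - ‖y‖), sq_nonneg (‖x‖ + ‖y‖)])
  rw [← ofReal_norm, ← ofReal_norm, ← ofReal_norm,
    ← ENNReal.ofReal_pow (norm_nonneg _), ← ENNReal.ofReal_pow (norm_nonneg _),
    ← ENNReal.ofReal_add (by positivity) (by positivity)]
  exact ENNReal.ofReal_le_ofReal h

theorem summable_inner {x y : ι → F} (hx : ∑' i, ‖x i‖ₑ ^ 2 < ∞) (hy : ∑' i, ‖y i‖ₑ ^ 2 < ∞) :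
    Summable fun i => ⟪x i, y i⟫_ℂ := by
  refine Summable.of_norm ?_
  have h : ∑' i, ‖⟪x i, y i⟫_ℂ‖ₑ < ∞ := by
    refine (ENNReal.tsum_le_tsum fun i => enorm_inner_le (x i) (y i)).trans_lt ?_
    rw [ENNReal.tsum_add]
    exact ENNReal.add_lt_top.2 ⟨hx, hy⟩
  have h2 := ENNReal.summable_toReal h.ne
  simpa using h2

theorem integrable_tsum_inner [Countable ι] {f g : Ω → ι → F}
    (hf : ∀ i, AEStronglyMeasurable (fun ω => f ω i) P) (hf2 : ∫⁻ ω, ∑' i, ‖f ω i‖ₑ ^ 2 ∂P < ∞)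
    (hg : ∀ i, AEStronglyMeasurable (fun ω => g ω i) P)
    (hg2 : ∫⁻ ω, ∑' i, ‖g ω i‖ₑ ^ 2 ∂P < ∞) :
    Integrable (fun ω => ∑' i, ⟪f ω i, g ω i⟫_ℂ) P := by
  constructor
  · refine aestronglyMeasurable_of_tendsto_ae atTop
      (f := fun (s : Finset ι) ω => ∑ i ∈ s, ⟪f ω i, g ω i⟫_ℂ) ?_ ?_
    · intro s
      exact Finset.aestronglyMeasurable_fun_sum s fun i _ => (hf i).inner (hg i)
    · filter_upwards [ae_summable hf hf2, ae_summable hg hg2] with ω h1 h2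
      exact (summable_inner h1 h2).hasSum
  · have hm : AEMeasurable (fun ω => ∑' i, ‖f ω i‖ₑ ^ 2) P :=
      AEMeasurable.tsum fun i => (hf i).enorm.pow_const 2
    refine lt_of_le_of_lt (lintegral_mono_ae ?_)
      (lt_of_eq_of_lt (lintegral_add_left' hm fun ω => ∑' i, ‖g ω i‖ₑ ^ 2)
        (ENNReal.add_lt_top.2 ⟨hf2, hg2⟩))
    refine Eventually.of_forall fun ω => ?_
    refine (enorm_tsum_le_tsum_enorm).trans ?_
    rw [← ENNReal.tsum_add]
    exact ENNReal.tsum_le_tsum fun i => enorm_inner_le _ _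

end Families

/-! ## Ergodic operators and measurable covariant operators -/

/-- A random self-adjoint operator `H` on the Hilbert space over a configuration space, measurable
(its spectral projections are weakly measurable) and covariant with respect to a unitary projective
representation `U` of `ℤ^d` that shifts the unit cubes. -/
structure ErgodicOperator {d : ℕ} (C : ConfigSpace d) (Ω : Type*) [MeasurableSpace Ω]
    [AddAction (Fin d → ℤ) Ω] (P : Measure Ω) where
  U : (Fin d → ℤ) → C.Hil ≃ₗᵢ[ℂ] C.Hil
  U_add : ∀ a b, ∃ c : ℂ, ‖c‖ = 1 ∧ ∀ f, U (a + b) f = c • U a (U b f)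
  U_chi : ∀ a b f, U a (C.chi b f) = C.chi (b + a) (U a f)
  H : Ω → C.Hil →ₗ.[ℂ] C.Hil
  selfAdjoint : ∀ ω, IsSelfAdjoint (H ω)
  measurable : ∀ B, MeasurableSet B → ∀ f,
    Measurable fun ω => ⟪f, (spectralMeasure (H ω)).proj B f⟫_ℂ
  covariant : ∀ a, ∀ᵐ ω ∂P, ∀ f g,
    (f, g) ∈ (H ω).graph ↔ (U a f, U a g) ∈ (H (a +ᵥ ω)).graph

namespace ErgodicOperator

variable {d : ℕ} {C : ConfigSpace d} {Ω : Type*} [MeasurableSpace Ω] [AddAction (Fin d → ℤ) Ω]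
  {P : Measure Ω} (S : ErgodicOperator C Ω P)

/-- Weak measurability of an operator-valued map. -/
def IsMeasurableOp (_S : ErgodicOperator C Ω P) (A : Ω → C.Hc →ₗ[ℂ] C.Hil) : Prop :=
  ∀ f : C.Hc, AEMeasurable (fun ω => ⟪(f : C.Hil), A ω f⟫_ℂ) P

/-- Covariance `U(a) A_ω U(a)* = A_{τ_a ω}` on functions of compact support. -/
def IsCovariantOp (A : Ω → C.Hc →ₗ[ℂ] C.Hil) : Prop :=
  ∀ a, ∀ᵐ ω ∂P, ∀ f g : C.Hc, (g : C.Hil) = S.U a f → A (a +ᵥ ω) g = S.U a (A ω f)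

/-- Local boundedness: `A_ω χ_a` and `χ_a A_ω` are bounded for all `a`. -/
def IsLocallyBoundedOp (_S : ErgodicOperator C Ω P) (A : Ω → C.Hc →ₗ[ℂ] C.Hil) : Prop :=
  ∀ᵐ ω ∂P, ∀ a, (∃ M : ℝ, ∀ f : C.Hil, ‖A ω (C.chiHc a f)‖ ≤ M * ‖f‖) ∧
    ∃ M : ℝ, ∀ f : C.Hc, ‖C.chi a (A ω f)‖ ≤ M * ‖f‖

/-- `E tr (χ_0 A* A χ_0)`, the square of the Hilbert-Schmidt norm per unit volume. -/
def hsNormSq (_S : ErgodicOperator C Ω P) (A : Ω → C.Hc →ₗ[ℂ] C.Hil) : ℝ≥0∞ :=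
  ∫⁻ ω, ∑' i : C.basisSet, ‖A ω (C.chiHc 0 (C.basis i))‖ₑ ^ 2 ∂P

variable {S}

theorem IsMeasurableOp.aestronglyMeasurable {A : Ω → C.Hc →ₗ[ℂ] C.Hil} (hA : S.IsMeasurableOp A)
    (f : C.Hc) : AEStronglyMeasurable (fun ω => A ω f) P := by
  have h1 : ∀ g : C.Hc, AEMeasurable (fun ω => ⟪(g : C.Hil), A ω f⟫_ℂ) P := by
    intro g
    have e : (fun ω => ⟪(g : C.Hil), A ω f⟫_ℂ) = fun ω =>
        (⟪((g + f : C.Hc) : C.Hil), A ω (g + f)⟫_ℂ - ⟪((g - f : C.Hc) : C.Hil), A ω (g - f)⟫_ℂ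
          - Complex.I * ⟪((g + Complex.I • f : C.Hc) : C.Hil), A ω (g + Complex.I • f)⟫_ℂ
          + Complex.I * ⟪((g - Complex.I • f : C.Hc) : C.Hil), A ω (g - Complex.I • f)⟫_ℂ) / 4 := by
      funext ω
      simp only [map_add, map_sub, map_smul, Submodule.coe_add, Submodule.coe_sub,
        Submodule.coe_smul, inner_add_left, inner_add_right, inner_sub_left, inner_sub_right,
        inner_smul_left, inner_smul_right, Complex.conj_I]
      ring_nf
      simp only [Complex.I_sq]
      ring
    rw [e]
    exact ((((hA _).sub (hA _)).sub ((hA _).const_mul _)).add ((hA _).const_mul _)).div_const 4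
  have h2 : ∀ g : C.Hil, AEMeasurable (fun ω => ⟪g, A ω f⟫_ℂ) P := by
    intro g
    obtain ⟨u, hu, hlim⟩ := mem_closure_iff_seq_limit.1 (C.dense_hc g)
    refine aemeasurable_of_tendsto_metrizable_ae atTop
      (f := fun n ω => ⟪u n, A ω f⟫_ℂ) (fun n => h1 ⟨u n, hu n⟩) ?_
    exact Eventually.of_forall fun ω => hlim.inner tendsto_const_nhds
  refine aestronglyMeasurable_of_tendsto_ae atTop
    (f := fun (s : Finset C.basisSet) ω => ∑ i ∈ s, ⟪C.basis i, A ω f⟫_ℂ • C.basis i) ?_ ?_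
  · intro s
    exact Finset.aestronglyMeasurable_fun_sum s fun i _ =>
      (h2 (C.basis i)).aestronglyMeasurable.smul_const _
  · refine Eventually.of_forall fun ω => ?_
    have := C.basis.hasSum_repr (A ω f)
    simp only [HilbertBasis.repr_apply_apply] at this
    exact this

variable (S)

/-- The measurable covariant locally bounded operators with finite `hsNormSq`. -/
def K2pre : Submodule ℂ (Ω → C.Hc →ₗ[ℂ] C.Hil) where
  carrier := {A | S.IsMeasurableOp A ∧ S.IsCovariantOp A ∧ S.IsLocallyBoundedOp A ∧
    S.hsNormSq A < ∞}
  add_mem' := by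
    rintro A B ⟨hA1, hA2, hA3, hA4⟩ ⟨hB1, hB2, hB3, hB4⟩
    refine ⟨fun f => ?_, fun a => ?_, ?_, ?_⟩
    · simpa [inner_add_right] using (hA1 f).fun_add (hB1 f)
    · filter_upwards [hA2 a, hB2 a] with ω h1 h2 f g hfg
      simp [h1 f g hfg, h2 f g hfg]
    · filter_upwards [hA3, hB3] with ω h1 h2 a
      obtain ⟨⟨M1, hM1⟩, M2, hM2⟩ := h1 a
      obtain ⟨⟨N1, hN1⟩, N2, hN2⟩ := h2 a
      refine ⟨⟨M1 + N1, fun f => ?_⟩, M2 + N2, fun f => ?_⟩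
      · rw [Pi.add_apply, LinearMap.add_apply, add_mul]
        exact (norm_add_le _ _).trans (add_le_add (hM1 f) (hN1 f))
      · rw [Pi.add_apply, LinearMap.add_apply, map_add, add_mul]
        exact (norm_add_le _ _).trans (add_le_add (hM2 f) (hN2 f))
    · exact lintegral_add_lt_top (fun i => hA1.aestronglyMeasurable _) hA4 hB4
  zero_mem' := by
    refine ⟨fun f => ?_, fun a => ?_, ?_, ?_⟩
    · simp
    · simp
    · exact Eventually.of_forall fun ω a => ⟨⟨0, by simp⟩, 0, by simp⟩
    · simp [hsNormSq]
  smul_mem' := by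
    rintro c A ⟨hA1, hA2, hA3, hA4⟩
    refine ⟨fun f => ?_, fun a => ?_, ?_, ?_⟩
    · simpa [inner_smul_right] using (hA1 f).const_mul c
    · filter_upwards [hA2 a] with ω h1 f g hfg
      simp [h1 f g hfg]
    · filter_upwards [hA3] with ω h1 a
      obtain ⟨⟨M1, hM1⟩, M2, hM2⟩ := h1 a
      refine ⟨⟨‖c‖ * M1, fun f => ?_⟩, ‖c‖ * M2, fun f => ?_⟩
      · rw [Pi.smul_apply, LinearMap.smul_apply, norm_smul, mul_assoc]
        exact mul_le_mul_of_nonneg_left (hM1 f) (norm_nonneg c)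
      · rw [Pi.smul_apply, LinearMap.smul_apply, map_smul, norm_smul, mul_assoc]
        exact mul_le_mul_of_nonneg_left (hM2 f) (norm_nonneg c)
    · have : S.hsNormSq (c • A) = ‖c‖ₑ ^ 2 * S.hsNormSq A := by
        unfold hsNormSq
        rw [← lintegral_const_mul' _ _ (by simp)]
        refine lintegral_congr fun ω => ?_
        rw [← ENNReal.tsum_mul_left]
        simp [enorm_smul, mul_pow]
      rw [this]
      exact ENNReal.mul_lt_top (by simp) hA4

/-- The scalar product `⟪⟪A, B⟫⟫ = E tr (χ_0 A* B χ_0)`. -/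
def hsInner (_S : ErgodicOperator C Ω P) (A B : Ω → C.Hc →ₗ[ℂ] C.Hil) : ℂ :=
  ∫ ω, ∑' i : C.basisSet,
    ⟪A ω (C.chiHc 0 (C.basis i)), B ω (C.chiHc 0 (C.basis i))⟫_ℂ ∂P

/-- The axioms of a (semidefinite) scalar product. -/
abbrev k2Core : PreInnerProductSpace.Core ℂ S.K2pre where
  inner A B := S.hsInner A B
  conj_inner_symm A B := by
    simp only [hsInner, ← integral_conj, Complex.conj_tsum, inner_conj_symm]
  re_inner_nonneg A := by
    have h : S.hsInner A A = ((∫ ω, ∑' i : C.basisSet,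
        ‖(A : Ω → C.Hc →ₗ[ℂ] C.Hil) ω (C.chiHc 0 (C.basis i))‖ ^ 2 ∂P : ℝ) : ℂ) := by
      rw [hsInner, ← integral_complex_ofReal]
      refine integral_congr_ae (Eventually.of_forall fun ω => ?_)
      simp only [inner_self_eq_norm_sq_to_K, Complex.ofReal_tsum]
      norm_cast
    rw [h]
    simp only [RCLike.re_to_complex, Complex.ofReal_re]
    exact integral_nonneg fun ω => tsum_nonneg fun i => by positivity
  add_left A B D := by
    have hA := fun i => A.2.1.aestronglyMeasurable (C.chiHc 0 (C.basis i))
    have hB := fun i => B.2.1.aestronglyMeasurable (C.chiHc 0 (C.basis i))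
    have hD := fun i => D.2.1.aestronglyMeasurable (C.chiHc 0 (C.basis i))
    simp only [hsInner]
    rw [← integral_add (integrable_tsum_inner hA A.2.2.2.2 hD D.2.2.2.2)
      (integrable_tsum_inner hB B.2.2.2.2 hD D.2.2.2.2)]
    refine integral_congr_ae ?_
    filter_upwards [ae_summable hA A.2.2.2.2, ae_summable hB B.2.2.2.2,
      ae_summable hD D.2.2.2.2] with ω h1 h2 h3
    rw [← (summable_inner h1 h3).tsum_add (summable_inner h2 h3)]
    simp [inner_add_left]
  smul_left A B c := by
    simp only [hsInner]
    rw [← integral_const_mul]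
    refine integral_congr_ae (Eventually.of_forall fun ω => ?_)
    simp only
    rw [← tsum_mul_left]
    simp [inner_smul_left]

instance : SeminormedAddCommGroup S.K2pre :=
  @InnerProductSpace.Core.toSeminormedAddCommGroup ℂ _ _ _ _ S.k2Core

instance : InnerProductSpace ℂ S.K2pre := InnerProductSpace.ofCore S.k2Core

/-- The Hilbert space `𝒦₂`: operators in `K2pre`, two of them being identified when their difference
has norm zero, i.e. (by covariance) when they agree almost surely. -/
abbrev K2 : Type _ := SeparationQuotient S.K2pre

/-- The class in `𝒦₂` of a measurable covariant operator. -/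
abbrev toK2 (A : S.K2pre) : S.K2 := SeparationQuotient.mk A

/-! ### Left and right multiplication, and the operators `ℋ_L`, `ℋ_R`, `ℒ` -/

/-- Left multiplication `(B ⊙_L A)_ω = B_ω A_ω` by a bounded measurable covariant `B`: the bounded
operator on `𝒦₂` given by this formula. -/
def leftMul (B : Ω → C.Hil →L[ℂ] C.Hil) : S.K2 →L[ℂ] S.K2 :=
  Classical.epsilon fun T : S.K2 →L[ℂ] S.K2 => ∀ A : S.K2pre, ∃ D : S.K2pre,
    T (S.toK2 A) = S.toK2 D ∧ ∀ᵐ ω ∂P, ∀ f : C.Hc, D.1 ω f = B ω (A.1 ω f)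

/-- The operator `A‡* = (A‡)*`, where `A‡` is the restriction of the adjoint `A*` to the functions
of compact support. -/
def ddaggerAdjoint (_C : ConfigSpace d) (A : _C.Hc →ₗ[ℂ] _C.Hil) : _C.Hil →ₗ.[ℂ] _C.Hil :=
  ((LinearPMap.adjoint ⟨_C.Hc, A⟩).domRestrict _C.Hc).adjoint

/-- Right multiplication `(A ⊙_R B)_ω = A_ω‡* B_ω` by a bounded measurable covariant `B`: the
bounded operator on `𝒦₂` given by this formula. -/
def rightMul (B : Ω → C.Hil →L[ℂ] C.Hil) : S.K2 →L[ℂ] S.K2 :=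
  Classical.epsilon fun T : S.K2 →L[ℂ] S.K2 => ∀ A : S.K2pre, ∃ D : S.K2pre,
    T (S.toK2 A) = S.toK2 D ∧
      ∀ᵐ ω ∂P, ∀ f : C.Hc, (B ω f, D.1 ω f) ∈ (ddaggerAdjoint C (A.1 ω)).graph

/-- The one-particle evolution `exp(-i t H_ω)`. -/
def evolution (t : ℝ) (ω : Ω) : C.Hil →L[ℂ] C.Hil :=
  (spectralMeasure (S.H ω)).integral fun l => Complex.exp (-Complex.I * t * l)

/-- `𝒰_L(t) A = exp(-i t H) ⊙_L A`. -/
def evolutionL (t : ℝ) : S.K2 →L[ℂ] S.K2 := S.leftMul (S.evolution t)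

/-- `𝒰_R(t) A = A ⊙_R exp(-i t H)`. -/
def evolutionR (t : ℝ) : S.K2 →L[ℂ] S.K2 := S.rightMul (S.evolution t)

/-- `ℋ_L`, with `exp(-i t ℋ_L) = 𝒰_L(t)`. -/
def HL : S.K2 →ₗ.[ℂ] S.K2 := stoneGenerator S.evolutionL

/-- `ℋ_R`, with `exp(-i t ℋ_R) = 𝒰_R(t)`. -/
def HR : S.K2 →ₗ.[ℂ] S.K2 := stoneGenerator S.evolutionR

/-- The Liouvillian `ℒ`, with `exp(-i t ℒ) A = exp(-i t H) ⊙_L A ⊙_R exp(i t H)`. -/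
def liouvillian : S.K2 →ₗ.[ℂ] S.K2 :=
  stoneGenerator fun t => (S.evolutionL t).comp (S.evolutionR (-t))

/-- The Fermi projection `P_E = χ_{]-∞, E]}(H_ω)`. -/
def fermiProj (E : ℝ) (ω : Ω) : C.Hil →L[ℂ] C.Hil :=
  (spectralMeasure (S.H ω)).proj (Set.Iic E)

/-- `Y = i [X₁, P_E]` on functions of compact support, almost surely (in particular `P_E` maps such
functions into the domain of the multiplication operator `X₁`). -/
def IsFermiCommutator [NeZero d] (E : ℝ) (Y : Ω → C.Hc →ₗ[ℂ] C.Hil) : Prop :=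
  ∀ᵐ ω ∂P, ∀ f : C.Hc, ∃ g h : C.Hil,
    (g =ᵐ[C.vol] fun x => (C.pos x 0 : ℂ) * S.fermiProj E ω f x) ∧
    (h =ᵐ[C.vol] fun x => (C.pos x 0 : ℂ) * (f : C.Hil) x) ∧
    Y ω f = Complex.I • (g - S.fermiProj E ω h)

/-- `𝒫_E = χ_{]-∞, E]}(ℋ_L) - χ_{]-∞, E]}(ℋ_R)`. -/
def fermiDiff (E : ℝ) : S.K2 →L[ℂ] S.K2 :=
  (spectralMeasure S.HL).proj (Set.Iic E) - (spectralMeasure S.HR).proj (Set.Iic E)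

/-- The correlation measure `Υ_A(C) = ⟪⟪A, χ_C(ℋ_L, ℋ_R) A⟫⟫` on the plane. -/
def correlationMeasure (A : S.K2) : Measure (ℝ × ℝ) :=
  (jointSpectralMeasure S.HL S.HR).measure A

/-- The conductivity measure `B ↦ π ⟪⟪Y, χ_B(ℒ) (-ℒ 𝒫_E) Y⟫⟫`, with values in `[0, ∞]`. Since
`-ℒ 𝒫_E` is an unbounded positive operator, it is evaluated on the spectral cutoffs
`χ_{[-n, n]}(ℒ) 𝒫_E Y`, which lie in the domain of `ℒ`; the values increase with `n`. -/
def conductivityMeasure (E : ℝ) (Y : S.K2) (B : Set ℝ) : ℝ≥0∞ :=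
  ⨆ n : ℕ, ENNReal.ofReal (Real.pi * (⟪Y, (spectralMeasure S.liouvillian).proj B
    (-applyOp S.liouvillian
      ((spectralMeasure S.liouvillian).proj (Set.Icc (-n) n) (S.fermiDiff E Y)))⟫_ℂ).re)

/-! ### Magnetic Schrödinger operators -/

/-- The lattice magnetic Schrödinger operator: on functions of finite support,
`(H_ω f)(x) = ∑_{|y - x| = 1} exp(-i θ_ω(x, y)) f(y) + V_ω(x) f(x)`, with a random magnetic
potential `θ` on oriented bonds and a random potential `V` bounded from below. -/
structure IsLatticeSchrodinger (S : ErgodicOperator (lattice d) Ω P)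
    (θ : Ω → (Fin d → ℤ) → (Fin d → ℤ) → ℝ) (V : Ω → (Fin d → ℤ) → ℝ) : Prop where
  measurable_magnetic : ∀ x y, Measurable fun ω => θ ω x y
  antisymm : ∀ ω x y, ∑ j, |x j - y j| = 1 → θ ω x y = -θ ω y x
  measurable_potential : ∀ x, Measurable fun ω => V ω x
  bddBelow : ∀ᵐ ω ∂P, BddBelow (Set.range (V ω))
  action : ∀ᵐ ω ∂P, ∀ f ∈ (lattice d).Hc, ∃ h : f ∈ (S.H ω).domain, ∀ x,
    S.H ω ⟨f, h⟩ x = ∑ j, (Complex.exp (-Complex.I * θ ω x (x + Pi.single j 1)) *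
        f (x + Pi.single j 1) +
      Complex.exp (-Complex.I * θ ω x (x - Pi.single j 1)) * f (x - Pi.single j 1)) + V ω x * f x

/-- The `j`-th component of `(-i ∇ - A) u`. -/
def covDeriv (A : EuclideanSpace ℝ (Fin d) → EuclideanSpace ℝ (Fin d))
    (u : EuclideanSpace ℝ (Fin d) → ℂ) (j : Fin d) (x : EuclideanSpace ℝ (Fin d)) : ℂ :=
  -Complex.I * fderiv ℝ u x (EuclideanSpace.single j 1) - A x j * u x

/-- The graph of `(-i ∇ - A)² + V` on the smooth functions `u` of compact support for which the
expression, in the sense of distributions, is a square integrable function. -/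
def magneticGraph (A : EuclideanSpace ℝ (Fin d) → EuclideanSpace ℝ (Fin d))
    (V : EuclideanSpace ℝ (Fin d) → ℝ) : Set ((continuum d).Hil × (continuum d).Hil) :=
  {p | ∃ u : EuclideanSpace ℝ (Fin d) → ℂ, ContDiff ℝ (⊤ : ℕ∞) u ∧ HasCompactSupport u ∧
    p.1 =ᵐ[volume] u ∧
    ∀ v : EuclideanSpace ℝ (Fin d) → ℂ, ContDiff ℝ (⊤ : ℕ∞) v → HasCompactSupport v →
      ∫ x, star (v x) * p.2 x = (∑ j, ∫ x, star (covDeriv A v j x) * covDeriv A u j x) +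
        ∫ x, star (v x) * (V x * u x)}

/-- The magnetic Schrödinger operator `(-i ∇ - A_ω)² + V_ω` in the continuum, for random potentials
such that it is well defined and essentially self-adjoint on the smooth functions of compact support
(so that `H_ω` is its closure) and bounded from below uniformly in `ω`. -/
structure IsContinuumSchrodinger (S : ErgodicOperator (continuum d) Ω P)
    (A : Ω → EuclideanSpace ℝ (Fin d) → EuclideanSpace ℝ (Fin d))
    (V : Ω → EuclideanSpace ℝ (Fin d) → ℝ) : Prop where
  measurable_magnetic : Measurable fun p : Ω × EuclideanSpace ℝ (Fin d) => A p.1 p.2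
  measurable_potential : Measurable fun p : Ω × EuclideanSpace ℝ (Fin d) => V p.1 p.2
  locallyIntegrable_magnetic : ∀ᵐ ω ∂P, LocallyIntegrable fun x => ‖A ω x‖ ^ 2
  locallyIntegrable_potential : ∀ᵐ ω ∂P, LocallyIntegrable (V ω)
  defined : ∀ᵐ ω ∂P, ∀ u : EuclideanSpace ℝ (Fin d) → ℂ, ContDiff ℝ (⊤ : ℕ∞) u →
    HasCompactSupport u → ∃ p ∈ magneticGraph (A ω) (V ω), p.1 =ᵐ[volume] u
  closure_eq : ∀ᵐ ω ∂P, closure (magneticGraph (A ω) (V ω)) = ((S.H ω).graph : Set _)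
  lower_bound : ∃ γ : ℝ, 0 ≤ γ ∧ ∀ᵐ ω ∂P, ∀ f : (S.H ω).domain,
    ‖(f : (continuum d).Hil)‖ ^ 2 ≤
      (⟪(f : (continuum d).Hil), S.H ω f⟫_ℂ).re + γ * ‖(f : (continuum d).Hil)‖ ^ 2

/-- Magnetic Schrödinger operators, either on the lattice or in the continuum. -/
inductive IsMagneticSchrodinger : (C : ConfigSpace d) → ErgodicOperator C Ω P → Prop
  | discrete (S : ErgodicOperator (lattice d) Ω P) (θ : Ω → (Fin d → ℤ) → (Fin d → ℤ) → ℝ)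
      (V : Ω → (Fin d → ℤ) → ℝ) (h : IsLatticeSchrodinger S θ V) :
      IsMagneticSchrodinger (lattice d) S
  | continuous (S : ErgodicOperator (continuum d) Ω P)
      (A : Ω → EuclideanSpace ℝ (Fin d) → EuclideanSpace ℝ (Fin d))
      (V : Ω → EuclideanSpace ℝ (Fin d) → ℝ) (h : IsContinuumSchrodinger S A V) :
      IsMagneticSchrodinger (continuum d) S

end ErgodicOperator

/-- The pairs `(l₁, l₂)` lying on opposite sides of `E`. -/
def oppositeSides (E : ℝ) : Set (ℝ × ℝ) :=
  (Set.Iic E ×ˢ Set.Ioi E) ∪ (Set.Ioi E ×ˢ Set.Iic E)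

end MagneticKubo

end

noncomputable section

namespace MagneticKubo

/-! ## Bounded measurable functions -/

/-! Left and right multiplication by the spectral projections of `H` are commuting projection-valued
measures on 𝒦₂, hence the marginals of one projection-valued measure `G` on the plane. In this
representation ℋ_L and ℋ_R are the coordinates λ₁, λ₂. Since exp(-itℋ_L) exp(itℋ_R) = ∫ exp(-it(λ₁ -
λ₂)) dG, the Liouvillian is the function λ₁ - λ₂, and 𝒫_E is `fermiSign`, the difference of the two
indicators of ]-∞, E].

For the projection P = P_E and Y = i[X₁, P], the identity P² = P gives PYP = 0 and (1-P)Y(1-P) = 0.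
So the measure of Y under `G` does not charge the two quadrants in which both coordinates lie on the
same side of E. On the opposite sides, -(λ₁ - λ₂) `fermiSign` = |λ₁ - λ₂|. The formula in [0, ∞]
then follows by monotone convergence in the cutoff (`PVM.iSup_cutoff`), and the literal formula by
dominated convergence of difference quotients, with majorant |λ₁ - λ₂| (`PVM.inner_proj_generator`).

Spectral measures, generators and multiplications are selected by choice from a characterization, so
each needs existence and uniqueness. Existence comes from the spectral theorem: bounded normal
operators through the continuous functional calculus and Riesz-Markov, self-adjoint ones through the
resolvent (`exists_isSpectralMeasure`), commuting pairs through a normal operator built from bounded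
transforms (`exists_joint_pvm`). Uniqueness comes from unitary groups (`IsSpectralMeasure.unique`).

On the side of 𝒦₂, covariance exchanges rows and columns (`lintegral_row`), so A ↦ A‡ is an
antiunitary involution that turns right multiplication into left multiplication. Completeness of 𝒦₂
follows by rebuilding a covariant operator from its column at the origin. Left and right
multiplications commute on bounded operators, and these are total (`eq_zero_of_inner_bounded`). -/

/-- Bounded measurable complex functions. -/
structure IsBddMeas {α : Type*} [MeasurableSpace α] (f : α → ℂ) : Prop where
  measurable : Measurable f
  bdd : ∃ M : ℝ, ∀ a, ‖f a‖ ≤ M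

namespace IsBddMeas

variable {α β : Type*} [MeasurableSpace α] [MeasurableSpace β] {f g : α → ℂ}

theorem const (c : ℂ) : IsBddMeas fun _ : α => c := ⟨measurable_const, ‖c‖, fun _ => le_rfl⟩

theorem one : IsBddMeas (1 : α → ℂ) := const 1

theorem add (hf : IsBddMeas f) (hg : IsBddMeas g) : IsBddMeas (f + g) := by
  obtain ⟨M, hM⟩ := hf.bdd
  obtain ⟨N, hN⟩ := hg.bdd
  exact ⟨hf.measurable.add hg.measurable, M + N, fun a =>
    (norm_add_le _ _).trans (add_le_add (hM a) (hN a))⟩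

theorem mul (hf : IsBddMeas f) (hg : IsBddMeas g) : IsBddMeas (f * g) := by
  obtain ⟨M, hM⟩ := hf.bdd
  obtain ⟨N, hN⟩ := hg.bdd
  exact ⟨hf.measurable.mul hg.measurable, M * N, fun a => by
    rw [Pi.mul_apply, norm_mul]
    exact mul_le_mul (hM a) (hN a) (norm_nonneg _) ((norm_nonneg _).trans (hM a))⟩

theorem smul (c : ℂ) (hf : IsBddMeas f) : IsBddMeas (c • f) := (const c).mul hf

theorem neg (hf : IsBddMeas f) : IsBddMeas (-f) := by simpa using hf.smul (-1)

theorem sub (hf : IsBddMeas f) (hg : IsBddMeas g) : IsBddMeas (f - g) := by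
  simpa [sub_eq_add_neg] using hf.add hg.neg

theorem conj (hf : IsBddMeas f) : IsBddMeas fun a => starRingEnd ℂ (f a) := by
  obtain ⟨M, hM⟩ := hf.bdd
  exact ⟨Complex.continuous_conj.measurable.comp hf.measurable, M, by simpa using hM⟩

theorem indicator {B : Set α} (hB : MeasurableSet B) (hf : IsBddMeas f) :
    IsBddMeas (B.indicator f) := by
  obtain ⟨M, hM⟩ := hf.bdd
  exact ⟨hf.measurable.indicator hB, M, fun a => (norm_indicator_le_norm_self _ _).trans (hM a)⟩

theorem indicator_one {B : Set α} (hB : MeasurableSet B) : IsBddMeas (B.indicator (1 : α → ℂ)) :=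
  (const 1).indicator hB

theorem comp (hf : IsBddMeas f) {φ : β → α} (hφ : Measurable φ) : IsBddMeas fun b => f (φ b) := by
  obtain ⟨M, hM⟩ := hf.bdd
  exact ⟨hf.measurable.comp hφ, M, fun b => hM _⟩

theorem integrable (hf : IsBddMeas f) (μ : Measure α) [IsFiniteMeasure μ] : Integrable f μ := by
  obtain ⟨M, hM⟩ := hf.bdd
  exact Integrable.of_bound hf.measurable.aestronglyMeasurable M (Eventually.of_forall hM)

/-- Induction principle for bounded measurable functions. -/
theorem induction {p : (α → ℂ) → Prop} (hind : ∀ B, MeasurableSet B → p (B.indicator 1))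
    (hadd : ∀ f g, IsBddMeas f → IsBddMeas g → p f → p g → p (f + g))
    (hsmul : ∀ (c : ℂ) f, IsBddMeas f → p f → p (c • f))
    (hlim : ∀ (f : ℕ → α → ℂ) (g : α → ℂ) (M : ℝ), (∀ n, Measurable (f n)) →
      (∀ n a, ‖f n a‖ ≤ M) → (∀ a, Tendsto (fun n => f n a) atTop (𝓝 (g a))) →
      (∀ n, p (f n)) → p g) (hf : IsBddMeas f) : p f := by
  have hs : ∀ s : SimpleFunc α ℂ, p s ∧ IsBddMeas (s : α → ℂ) := by
    intro s
    induction s using SimpleFunc.induction with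
    | const c hs =>
      rename_i s
      have e : ((SimpleFunc.piecewise s hs (SimpleFunc.const α c) (SimpleFunc.const α 0) :
          SimpleFunc α ℂ) : α → ℂ) = c • s.indicator 1 := by
        ext a
        by_cases ha : a ∈ s <;> simp [ha]
      rw [e]
      exact ⟨hsmul _ _ (indicator_one hs) (hind s hs), (indicator_one hs).smul c⟩
    | add h hf hg =>
      rw [SimpleFunc.coe_add]
      exact ⟨hadd _ _ hf.2 hg.2 hf.1 hg.1, hf.2.add hg.2⟩
  obtain ⟨M, hM⟩ := hf.bdd
  -- The bound `M` is known to be nonnegative only if there is a point to evaluate at. On an empty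
  -- type every function is the indicator of the empty set.
  by_cases hα : Nonempty α
  · have hM0 : 0 ≤ M := (norm_nonneg _).trans (hM hα.some)
    have hm := hf.measurable.stronglyMeasurable
    exact hlim (fun n => hm.approxBounded M n) f M (fun n => SimpleFunc.measurable _)
      (fun n a => hm.norm_approxBounded_le hM0 n a)
      (fun a => StronglyMeasurable.tendsto_approxBounded_of_norm_le hm (hM a)) (fun n => (hs _).1)
  · have : f = (∅ : Set α).indicator 1 := by
      ext a
      exact absurd ⟨a⟩ hα
    rw [this]
    exact hind _ MeasurableSet.empty

/-- Induction principle for bounded measurable functions, starting from continuous functions. -/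
theorem induction_continuous {X : Type*} [PseudoEMetricSpace X] [MeasurableSpace X] [BorelSpace X]
    {f : X → ℂ} {p : (X → ℂ) → Prop} (hc : ∀ f, Continuous f → IsBddMeas f → p f)
    (hadd : ∀ f g, IsBddMeas f → IsBddMeas g → p f → p g → p (f + g))
    (hsmul : ∀ (c : ℂ) f, IsBddMeas f → p f → p (c • f))
    (hlim : ∀ (f : ℕ → X → ℂ) (g : X → ℂ) (M : ℝ), (∀ n, Measurable (f n)) →
      (∀ n a, ‖f n a‖ ≤ M) → (∀ a, Tendsto (fun n => f n a) atTop (𝓝 (g a))) →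
      (∀ n, p (f n)) → p g) (hf : IsBddMeas f) : p f := by
  refine IsBddMeas.induction (fun B hB => ?_) hadd hsmul hlim hf
  have h1 : p 1 := hc 1 continuous_const (const 1)
  -- A π-λ argument starting from closed sets, whose indicators are pointwise limits of continuous
  -- thickened indicators with shrinking radius.
  refine MeasurableSpace.induction_on_inter (C := fun B _ => p (B.indicator 1))
    (borel_eq_generateFrom_isClosed (α := X) ▸ BorelSpace.measurable_eq) isPiSystem_isClosed
    ?_ ?_ ?_ ?_ B hB
  · have h0 := hsmul 0 1 (const 1) h1
    rw [zero_smul] at h0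
    rwa [Set.indicator_empty']
  · intro F hF
    have hF : IsClosed F := hF
    have hδ : ∀ n : ℕ, (0 : ℝ) < 1 / ((n : ℝ) + 1) := fun n => by positivity
    let u : ℕ → X → ℂ := fun n x => ((thickenedIndicator (hδ n) F x : NNReal) : ℂ)
    have hcu : ∀ n, Continuous (u n) := fun n => by
      have := (thickenedIndicator (hδ n) F).continuous
      fun_prop
    have hbu : ∀ n x, ‖u n x‖ ≤ 1 := fun n x => by
      have := thickenedIndicator_le_one (hδ n) F x
      simpa [u] using this
    refine hlim u _ 1 (fun n => (hcu n).measurable) hbu ?_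
      (fun n => hc _ (hcu n) ⟨(hcu n).measurable, 1, hbu n⟩)
    intro x
    have h := thickenedIndicator_tendsto_indicator_closure hδ
      tendsto_one_div_add_atTop_nhds_zero_nat F
    rw [tendsto_pi_nhds] at h
    have h2 := h x
    rw [hF.closure_eq] at h2
    have h3 : Continuous fun r : NNReal => (r : ℂ) := by fun_prop
    have h4 := (h3.tendsto _).comp h2
    have e : ((F.indicator (fun _ => (1 : NNReal)) x : NNReal) : ℂ) = F.indicator 1 x := by
      by_cases hx : x ∈ F <;> simp [hx]
    rw [e] at h4
    exact h4
  · intro B hB h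
    have e : Bᶜ.indicator (1 : X → ℂ) = 1 + (-1 : ℂ) • B.indicator 1 := by
      ext x
      by_cases hx : x ∈ B <;> simp [hx]
    rw [e]
    exact hadd _ _ (const 1) ((indicator_one hB).smul _) h1 (hsmul _ _ (indicator_one hB) h)
  · intro s hd hs h
    -- Additivity only reaches finite unions; the countable union is the bounded pointwise limit of
    -- its partial unions.
    have key : ∀ n, p ((⋃ i ∈ Finset.range n, s i).indicator 1) := by
      intro n
      induction n with
      | zero =>
        have h0 := hsmul 0 1 (const 1) h1
        rw [zero_smul] at h0
        simpa only [Finset.range_zero, Finset.notMem_empty, Set.iUnion_of_empty, Set.iUnion_empty,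
          Set.indicator_empty'] using h0
      | succ n ih =>
        have e : (⋃ i ∈ Finset.range (n + 1), s i).indicator (1 : X → ℂ) =
            (s n).indicator 1 + (⋃ i ∈ Finset.range n, s i).indicator 1 := by
          have hdis : Disjoint (s n) (⋃ i ∈ Finset.range n, s i) := by
            rw [Set.disjoint_iUnion₂_right]
            intro i hi
            exact hd (Finset.mem_range.1 hi).ne'
          rw [Finset.range_add_one, Finset.set_biUnion_insert]
          exact Set.indicator_union_of_disjoint hdis 1
        rw [e]
        exact hadd _ _ (indicator_one (hs n))
          (indicator_one (Finset.measurableSet_biUnion _ fun i _ => hs i)) (h n) ih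
    refine hlim _ _ 1
      (fun n => (indicator_one (Finset.measurableSet_biUnion _ fun i _ => hs i)).measurable)
      (fun n a => ?_) ?_ key
    · refine (norm_indicator_le_norm_self _ _).trans (by simp)
    · intro a
      by_cases ha : a ∈ ⋃ i, s i
      · obtain ⟨i, hi⟩ := Set.mem_iUnion.1 ha
        refine tendsto_const_nhds.congr' ?_
        filter_upwards [eventually_gt_atTop i] with n hn
        rw [Set.indicator_of_mem ha, Set.indicator_of_mem]
        exact Set.mem_biUnion (Finset.mem_coe.2 (Finset.mem_range.2 hn)) hi
      · refine tendsto_const_nhds.congr fun n => ?_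
        rw [Set.indicator_of_notMem ha, Set.indicator_of_notMem]
        exact fun h => ha (Set.iUnion₂_subset_iUnion _ _ h)

end IsBddMeas

theorem integral_indicator_one_complex {α : Type*} [MeasurableSpace α] (μ : Measure α) {B : Set α}
    (hB : MeasurableSet B) : ∫ a, B.indicator (1 : α → ℂ) a ∂μ = (μ.real B : ℂ) := by
  simp [integral_indicator hB]

theorem indicator_one_mul_indicator_one {α : Type*} (B C : Set α) :
    (B.indicator (1 : α → ℂ)) * C.indicator 1 = (B ∩ C).indicator 1 :=
  Set.inter_indicator_one.symm

/-! ## Quadratic forms of bounded operators -/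

section Quadratic

variable {K : Type*} [NormedAddCommGroup K] [InnerProductSpace ℂ K]

theorem inner_self_eq_ofReal (x : K) : ⟪x, x⟫_ℂ = ((‖x‖ ^ 2 : ℝ) : ℂ) := by
  rw [inner_self_eq_norm_sq_to_K]
  norm_cast

/-- Polarization of a complex-valued function. -/
def polar {V : Type*} [AddCommGroup V] [Module ℂ V] (Q : V → ℂ) (x y : V) : ℂ :=
  (Q (x + y) - Q (x - y) - Complex.I * Q (x + Complex.I • y)
    + Complex.I * Q (x - Complex.I • y)) / 4

/-- The vectors run over a separate space `V`, mapped into `K` by `ι`, so that polarization also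
applies to operators defined only on a domain. -/
theorem inner_eq_polar_linearMap {V : Type*} [AddCommGroup V] [Module ℂ V] (ι T : V →ₗ[ℂ] K)
    (x y : V) : ⟪ι x, T y⟫_ℂ = polar (fun z => ⟪ι z, T z⟫_ℂ) x y := by
  simp only [polar, map_add, map_sub, map_smul, inner_add_left, inner_add_right, inner_sub_left,
    inner_sub_right, inner_smul_left, inner_smul_right, Complex.conj_I]
  ring_nf
  simp only [Complex.I_sq]
  ring

theorem inner_eq_polar (T : K →L[ℂ] K) (x y : K) : ⟪x, T y⟫_ℂ = polar (fun z => ⟪z, T z⟫_ℂ) x y :=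
  inner_eq_polar_linearMap LinearMap.id (T : K →ₗ[ℂ] K) x y

/-- By complex polarization. This is what allows operators to be compared through their scalar
spectral measures. -/
theorem clm_ext_quadratic {S T : K →L[ℂ] K} (h : ∀ x, ⟪x, S x⟫_ℂ = ⟪x, T x⟫_ℂ) : S = T := by
  ext y
  refine ext_inner_left ℂ fun x => ?_
  have e1 := inner_eq_polar S x y
  have e2 := inner_eq_polar T x y
  rw [e1, e2, funext h]

/-- Polarize at `x` and at the multiple of `T x` that has the norm of `x`. The four vectors have
norm at most 2‖x‖, so each form is at most 4M‖x‖², and the final division by 4 leaves this bound.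
The constant is not sharp; only its existence matters. -/
theorem norm_le_of_quadratic {T : K →L[ℂ] K} {M : ℝ} (hM : 0 ≤ M)
    (h : ∀ x, ‖⟪x, T x⟫_ℂ‖ ≤ M * ‖x‖ ^ 2) : ‖T‖ ≤ 4 * M := by
  refine T.opNorm_le_bound (by positivity) fun x => ?_
  by_cases hx : x = 0
  · simp [hx]
  by_cases hT : T x = 0
  · simp only [hT, norm_zero]; positivity
  have hx' : 0 < ‖x‖ := norm_pos_iff.2 hx
  have hT' : 0 < ‖T x‖ := norm_pos_iff.2 hT
  set r : ℝ := ‖x‖ / ‖T x‖ with hr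
  set z : K := (r : ℂ) • T x with hz
  have hzn : ‖z‖ = ‖x‖ := by
    rw [hz, norm_smul, Complex.norm_real, Real.norm_of_nonneg (by positivity), hr]
    field_simp
  have e1 := inner_eq_polar T z x
  have e2 : ‖⟪z, T x⟫_ℂ‖ = ‖x‖ * ‖T x‖ := by
    rw [hz, inner_smul_left, inner_self_eq_norm_sq_to_K, norm_mul]
    simp only [Complex.conj_ofReal, Complex.norm_real, norm_pow, Real.norm_eq_abs, abs_norm,
      Complex.coe_algebraMap]
    rw [abs_of_nonneg (by positivity), hr]
    field_simp
  have hb : ∀ w : K, ‖w‖ ≤ 2 * ‖x‖ → ‖⟪w, T w⟫_ℂ‖ ≤ 4 * M * ‖x‖ ^ 2 := fun w hw =>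
    (h w).trans (by nlinarith [mul_le_mul_of_nonneg_left (pow_le_pow_left₀ (norm_nonneg w) hw 2) hM])
  have hI : ‖Complex.I • x‖ = ‖x‖ := by simp [norm_smul]
  have b1 := hb (z + x) ((norm_add_le _ _).trans (by linarith))
  have b2 := hb (z - x) ((norm_sub_le _ _).trans (by linarith))
  have b3 := hb (z + Complex.I • x) ((norm_add_le _ _).trans (by linarith))
  have b4 := hb (z - Complex.I • x) ((norm_sub_le _ _).trans (by linarith))
  have b : ‖⟪z, T x⟫_ℂ‖ ≤ 4 * M * ‖x‖ ^ 2 := by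
    rw [e1, polar, norm_div]
    have := norm_add_le (⟪z + x, T (z + x)⟫_ℂ - ⟪z - x, T (z - x)⟫_ℂ -
      Complex.I * ⟪z + Complex.I • x, T (z + Complex.I • x)⟫_ℂ)
      (Complex.I * ⟪z - Complex.I • x, T (z - Complex.I • x)⟫_ℂ)
    have h2 := norm_sub_le (⟪z + x, T (z + x)⟫_ℂ - ⟪z - x, T (z - x)⟫_ℂ)
      (Complex.I * ⟪z + Complex.I • x, T (z + Complex.I • x)⟫_ℂ)
    have h3 := norm_sub_le ⟪z + x, T (z + x)⟫_ℂ ⟪z - x, T (z - x)⟫_ℂ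
    rw [norm_mul Complex.I, Complex.norm_I, one_mul] at this h2
    rw [div_le_iff₀ (by norm_num)]
    have h4 : ‖(4 : ℂ)‖ = 4 := by norm_num
    rw [h4]
    linarith
  rw [e2] at b
  have : ‖x‖ * ‖T x‖ ≤ ‖x‖ * (4 * M * ‖x‖) := by linarith
  exact le_of_mul_le_mul_left this hx'

theorem tendsto_polar {T : ℕ → K →L[ℂ] K} {Q : K → ℂ}
    (h : ∀ x, Tendsto (fun n => ⟪x, T n x⟫_ℂ) atTop (𝓝 (Q x))) (x y : K) :
    Tendsto (fun n => ⟪x, T n y⟫_ℂ) atTop (𝓝 (polar Q x y)) := by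
  have e : ∀ n, ⟪x, T n y⟫_ℂ = polar (fun z => ⟪z, T n z⟫_ℂ) x y :=
    fun n => inner_eq_polar (T n) x y
  simp only [e, polar]
  exact ((((h _).sub (h _)).sub ((h _).const_mul _)).add ((h _).const_mul _)).div_const 4

/-- Weak sequential limits of bounded operators whose quadratic forms converge. -/
theorem exists_clm_of_tendsto_quadratic [CompleteSpace K] {T : ℕ → K →L[ℂ] K} {C : ℝ}
    (hC : ∀ n, ‖T n‖ ≤ C) {Q : K → ℂ}
    (h : ∀ x, Tendsto (fun n => ⟪x, T n x⟫_ℂ) atTop (𝓝 (Q x))) :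
    ∃ S : K →L[ℂ] K, ∀ x y, Tendsto (fun n => ⟪x, T n y⟫_ℂ) atTop (𝓝 ⟪x, S y⟫_ℂ) := by
  have ht := tendsto_polar h
  -- The polarized limit form inherits sesquilinearity and the bound `C` from the approximating
  -- operators, and the Riesz representation turns it into an operator.
  let B : K →L⋆[ℂ] K →L[ℂ] ℂ := LinearMap.mkContinuous₂
    (LinearMap.mk₂'ₛₗ (starRingEnd ℂ) (RingHom.id ℂ) (polar Q)
      (fun x x' y => tendsto_nhds_unique (ht _ _) (by
        simpa only [inner_add_left] using (ht x y).add (ht x' y)))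
      (fun c x y => tendsto_nhds_unique (ht _ _) (by
        simpa only [inner_smul_left, smul_eq_mul] using (ht x y).const_mul (starRingEnd ℂ c)))
      (fun x y y' => tendsto_nhds_unique (ht _ _) (by
        simpa only [map_add, inner_add_right] using (ht x y).add (ht x y')))
      (fun c x y => tendsto_nhds_unique (ht _ _) (by
        simpa only [map_smul, inner_smul_right, RingHom.id_apply, smul_eq_mul] using (ht x y).const_mul c))) C
    (fun x y => by
      refine le_of_tendsto (ht x y).norm (Eventually.of_forall fun n => ?_)
      refine (norm_inner_le_norm _ _).trans ?_
      have := (T n).le_of_opNorm_le (hC n) y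
      nlinarith [norm_nonneg x, mul_le_mul_of_nonneg_left this (norm_nonneg x)])
  refine ⟨(InnerProductSpace.continuousLinearMapOfBilin B).adjoint, fun x y => ?_⟩
  rw [ContinuousLinearMap.adjoint_inner_right, InnerProductSpace.continuousLinearMapOfBilin_apply]
  exact ht x y

end Quadratic

/-! ## Operators represented by families of measures -/

section Represents

variable {α β : Type*} [MeasurableSpace α] [MeasurableSpace β] {K : Type*} [NormedAddCommGroup K]
  [InnerProductSpace ℂ K]

/-- The operator `T` has the quadratic form `x ↦ ∫ f dμ_x`. -/
def Represents (μ : K → Measure α) (f : α → ℂ) (T : K →L[ℂ] K) : Prop :=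
  ∀ x, ⟪x, T x⟫_ℂ = ∫ a, f a ∂(μ x)

/-- A family of measures with `μ_x` of total mass `‖x‖²`. -/
def IsMassFamily (μ : K → Measure α) : Prop := ∀ x, μ x Set.univ = ‖x‖ₑ ^ 2

variable {μ : K → Measure α} {f g : α → ℂ} {S T : K →L[ℂ] K}

theorem IsMassFamily.isFiniteMeasure (hμ : IsMassFamily μ) (x : K) : IsFiniteMeasure (μ x) :=
  ⟨by rw [hμ x]; exact ENNReal.pow_lt_top enorm_lt_top⟩

theorem IsMassFamily.real_univ (hμ : IsMassFamily μ) (x : K) : (μ x).real Set.univ = ‖x‖ ^ 2 := by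
  rw [Measure.real, hμ x]
  simp

theorem IsMassFamily.tendsto_integral (hμ : IsMassFamily μ) {u : ℕ → α → ℂ} {M : ℝ}
    (hm : ∀ n, Measurable (u n)) (hM : ∀ n a, ‖u n a‖ ≤ M)
    (h : ∀ a, Tendsto (fun n => u n a) atTop (𝓝 (f a))) (x : K) :
    Tendsto (fun n => ∫ a, u n a ∂(μ x)) atTop (𝓝 (∫ a, f a ∂(μ x))) := by
  have := hμ.isFiniteMeasure x
  exact tendsto_integral_of_dominated_convergence (fun _ => M)
    (fun n => (hm n).aestronglyMeasurable) (integrable_const M)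
    (fun n => Eventually.of_forall (hM n)) (Eventually.of_forall h)

theorem IsMassFamily.norm_integral_le (hμ : IsMassFamily μ) {M : ℝ} (hM : ∀ a, ‖f a‖ ≤ M) (x : K) :
    ‖∫ a, f a ∂(μ x)‖ ≤ M * ‖x‖ ^ 2 := by
  have := hμ.isFiniteMeasure x
  rw [← hμ.real_univ x]
  exact norm_integral_le_of_norm_le_const (Eventually.of_forall hM)

theorem Represents.unique (hS : Represents μ f S) (hT : Represents μ f T) : S = T :=
  clm_ext_quadratic fun x => (hS x).trans (hT x).symm

theorem Represents.one (hμ : IsMassFamily μ) : Represents μ 1 1 := by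
  intro x
  simp only [one_apply_eq_self, inner_self_eq_norm_sq_to_K, Pi.one_apply,
    integral_const, hμ.real_univ]
  simp

theorem Represents.add (hμ : IsMassFamily μ) (hf : IsBddMeas f) (hg : IsBddMeas g)
    (hS : Represents μ f S) (hT : Represents μ g T) : Represents μ (f + g) (S + T) := by
  intro x
  have := hμ.isFiniteMeasure x
  simp only [Pi.add_apply]
  rw [integral_add (hf.integrable _) (hg.integrable _), add_apply,
    inner_add_right, hS x, hT x]

theorem Represents.smul (c : ℂ) (hS : Represents μ f S) : Represents μ (c • f) (c • S) := by
  intro x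
  simp only [Pi.smul_apply, smul_apply, inner_smul_right, hS x, smul_eq_mul, integral_const_mul]

theorem Represents.norm_le (hμ : IsMassFamily μ) {M : ℝ} (hM0 : 0 ≤ M) (hM : ∀ a, ‖f a‖ ≤ M)
    (hT : Represents μ f T) : ‖T‖ ≤ 4 * M :=
  norm_le_of_quadratic hM0 fun x => by
    rw [hT x]
    exact hμ.norm_integral_le hM x

/-- Bounded pointwise limits of representable functions are representable. -/
theorem Represents.exists_of_tendsto [CompleteSpace K] (hμ : IsMassFamily μ) {u : ℕ → α → ℂ} {M : ℝ}
    (hm : ∀ n, Measurable (u n)) (hM : ∀ n a, ‖u n a‖ ≤ M)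
    (h : ∀ a, Tendsto (fun n => u n a) atTop (𝓝 (f a))) {V : ℕ → K →L[ℂ] K}
    (hV : ∀ n, Represents μ (u n) (V n)) : ∃ T, Represents μ f T := by
  -- Nothing forces `M` to be nonnegative when the underlying type is empty.
  have hM' : ∀ n a, ‖u n a‖ ≤ |M| := fun n a => (hM n a).trans (le_abs_self M)
  have hq : ∀ x, Tendsto (fun n => ⟪x, V n x⟫_ℂ) atTop (𝓝 (∫ a, f a ∂(μ x))) := fun x => by
    simp only [fun n => hV n x]
    exact hμ.tendsto_integral hm hM h x
  obtain ⟨T, hT⟩ := exists_clm_of_tendsto_quadratic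
    (fun n => (hV n).norm_le hμ (abs_nonneg M) (hM' n)) hq
  exact ⟨T, fun x => tendsto_nhds_unique (hT x x) (hq x)⟩

theorem Represents.tendsto_inner (hμ : IsMassFamily μ) {u : ℕ → α → ℂ} {M : ℝ}
    (hm : ∀ n, Measurable (u n)) (hM : ∀ n a, ‖u n a‖ ≤ M)
    (h : ∀ a, Tendsto (fun n => u n a) atTop (𝓝 (f a))) {V : ℕ → K →L[ℂ] K}
    (hV : ∀ n, Represents μ (u n) (V n)) (hT : Represents μ f T) (x y : K) :
    Tendsto (fun n => ⟪x, V n y⟫_ℂ) atTop (𝓝 ⟪x, T y⟫_ℂ) := by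
  have hq : ∀ x, Tendsto (fun n => ⟪x, V n x⟫_ℂ) atTop (𝓝 ⟪x, T x⟫_ℂ) := fun x => by
    rw [hT x]
    simp only [fun n => hV n x]
    exact hμ.tendsto_integral hm hM h x
  have := tendsto_polar hq x y
  rwa [← inner_eq_polar T x y] at this

/-- Multiplicativity passes from a generating class to all bounded measurable functions; this is the
limit step. -/
theorem Represents.mul_of_tendsto (hμ : IsMassFamily μ) {u : ℕ → α → ℂ} {M : ℝ}
    (hm : ∀ n, Measurable (u n)) (hM : ∀ n a, ‖u n a‖ ≤ M)
    (h : ∀ a, Tendsto (fun n => u n a) atTop (𝓝 (f a))) {V : ℕ → K →L[ℂ] K}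
    (hV : ∀ n, Represents μ (u n) (V n)) (hT : Represents μ f T) (hg : IsBddMeas g)
    (hmul : ∀ n, Represents μ (u n * g) (V n * S)) : Represents μ (f * g) (T * S) := by
  intro x
  obtain ⟨N, hN⟩ := hg.bdd
  have h1 := Represents.tendsto_inner hμ hm hM h hV hT x (S x)
  refine tendsto_nhds_unique h1 ?_
  have h2 := hμ.tendsto_integral (u := fun n => u n * g) (f := f * g) (M := M * N)
    (fun n => (hm n).mul hg.measurable) (fun n a => by
      rw [Pi.mul_apply, norm_mul]
      exact mul_le_mul (hM n a) (hN a) (norm_nonneg _) ((norm_nonneg _).trans (hM n a)))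
    (fun a => (h a).mul_const (g a)) x
  refine h2.congr fun n => ?_
  exact (hmul n x).symm

theorem Represents.adjoint [CompleteSpace K] (hT : Represents μ f T) :
    Represents μ (fun a => starRingEnd ℂ (f a)) T.adjoint := by
  intro x
  rw [ContinuousLinearMap.adjoint_inner_right, ← inner_conj_symm, hT x, integral_conj]

end Represents

/-! ## Calculus of projection-valued measures -/

/-- The convergence available is only weak, so the fixed left factor is moved to the other side of
the scalar product as an adjoint. -/
theorem Represents.mul_of_tendsto_right {α : Type*} [MeasurableSpace α] {K : Type*}
    [NormedAddCommGroup K] [InnerProductSpace ℂ K] [CompleteSpace K] {μ : K → Measure α}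
    (hμ : IsMassFamily μ) {f g : α → ℂ} {S T : K →L[ℂ] K} {u : ℕ → α → ℂ} {M : ℝ}
    (hm : ∀ n, Measurable (u n)) (hM : ∀ n a, ‖u n a‖ ≤ M)
    (h : ∀ a, Tendsto (fun n => u n a) atTop (𝓝 (f a))) {V : ℕ → K →L[ℂ] K}
    (hV : ∀ n, Represents μ (u n) (V n)) (hT : Represents μ f T) (hg : IsBddMeas g)
    (hmul : ∀ n, Represents μ (g * u n) (S * V n)) : Represents μ (g * f) (S * T) := by
  intro x
  obtain ⟨N, hN⟩ := hg.bdd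
  have h1 := Represents.tendsto_inner hμ hm hM h hV hT (S.adjoint x) x
  simp only [ContinuousLinearMap.adjoint_inner_left] at h1
  refine tendsto_nhds_unique h1 ?_
  have h2 := hμ.tendsto_integral (u := fun n => g * u n) (f := g * f) (M := N * M)
    (fun n => hg.measurable.mul (hm n)) (fun n a => by
      rw [Pi.mul_apply, norm_mul]
      exact mul_le_mul (hN a) (hM n a) (norm_nonneg _) ((norm_nonneg _).trans (hN a)))
    (fun a => (h a).const_mul (g a)) x
  exact h2.congr fun n => (hmul n x).symm

namespace PVM

variable {α β : Type*} [MeasurableSpace α] [MeasurableSpace β] {K : Type*} [NormedAddCommGroup K]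
  [InnerProductSpace ℂ K]

/-- Construction of a projection-valued measure from the countable additivity of `‖p B x‖²`. -/
def ofNormSq (p : Set α → K →L[ℂ] K) (h0 : ∀ B, ¬ MeasurableSet B → p B = 0)
    (hsymm : ∀ B x y, ⟪p B x, y⟫_ℂ = ⟪x, p B y⟫_ℂ) (huniv : p Set.univ = 1)
    (hinter : ∀ B C, MeasurableSet B → MeasurableSet C → p (B ∩ C) = p B * p C)
    (hsum : ∀ f : ℕ → Set α, (∀ n, MeasurableSet (f n)) → Pairwise (Function.onFun Disjoint f) →
      ∀ x, ‖p (⋃ n, f n) x‖ₑ ^ 2 = ∑' n, ‖p (f n) x‖ₑ ^ 2) : PVM α K where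
  proj := p
  not_measurable := h0
  symm := hsymm
  univ := huniv
  inter := hinter
  iUnion f hf hd x := by
    -- The empty set is a disjoint union of infinitely many copies of itself, and a nonzero constant
    -- series would have infinite sum.
    have hempty : ∀ y, p ∅ y = 0 := fun y => by
      have h := hsum (fun _ => ∅) (fun _ => MeasurableSet.empty) (fun _ _ _ => by simp) y
      by_contra hne
      have hne' : ‖p ∅ y‖ₑ ^ 2 ≠ 0 := by simpa using hne
      rw [ENNReal.tsum_const_eq_top_of_ne_zero hne'] at h
      simp at h
    have hU : MeasurableSet (⋃ n, f n) := MeasurableSet.iUnion hf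
    set v := p (⋃ n, f n) x with hv
    have hpv : ∀ n, p (f n) v = p (f n) x := fun n => by
      have := hinter (f n) (⋃ n, f n) (hf n) hU
      rw [Set.inter_eq_left.2 (Set.subset_iUnion f n)] at this
      rw [hv]
      conv_rhs => rw [this]
      rfl
    have hidem : ∀ n y, p (f n) (p (f n) y) = p (f n) y := fun n y => by
      have := hinter (f n) (f n) (hf n) (hf n)
      rw [Set.inter_self] at this
      conv_rhs => rw [this]
      rfl
    have horth : ∀ n m, n ≠ m → ⟪p (f n) x, p (f m) x⟫_ℂ = 0 := fun n m hnm => by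
      have := hinter (f n) (f m) (hf n) (hf m)
      rw [Set.disjoint_iff_inter_eq_empty.1 (hd hnm)] at this
      rw [hsymm]
      have h2 : p (f n) (p (f m) x) = p ∅ x := by rw [this]; rfl
      rw [h2, hempty, inner_zero_right]
    have hself : ∀ n, ⟪p (f n) x, v⟫_ℂ = ((‖p (f n) x‖ ^ 2 : ℝ) : ℂ) := fun n => by
      rw [← hidem n x, hsymm, hpv, hidem, inner_self_eq_ofReal]
    -- Pythagoras: the summands are mutually orthogonal projections of `v`, so convergence of the
    -- squared norms is already convergence of the vectors.
    have hdist : ∀ s : Finset ℕ, ‖∑ n ∈ s, p (f n) x - v‖ ^ 2 =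
        ‖v‖ ^ 2 - ∑ n ∈ s, ‖p (f n) x‖ ^ 2 := fun s => by
      have h1 : ⟪∑ n ∈ s, p (f n) x, v⟫_ℂ = ((∑ n ∈ s, ‖p (f n) x‖ ^ 2 : ℝ) : ℂ) := by
        rw [sum_inner, Complex.ofReal_sum]
        exact Finset.sum_congr rfl fun n _ => hself n
      have h2 : ‖∑ n ∈ s, p (f n) x‖ ^ 2 = ∑ n ∈ s, ‖p (f n) x‖ ^ 2 := by
        have : ⟪∑ n ∈ s, p (f n) x, ∑ n ∈ s, p (f n) x⟫_ℂ =
            ((∑ n ∈ s, ‖p (f n) x‖ ^ 2 : ℝ) : ℂ) := by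
          rw [sum_inner, Complex.ofReal_sum]
          refine Finset.sum_congr rfl fun n hn => ?_
          rw [inner_sum, Finset.sum_eq_single n (fun m _ hm => horth n m hm.symm)
            (fun h => absurd hn h), inner_self_eq_ofReal]
        rw [inner_self_eq_ofReal] at this
        exact Complex.ofReal_injective this
      rw [@norm_sub_sq ℂ, h1, h2]
      simp only [RCLike.re_to_complex, Complex.ofReal_re]
      ring
    have hreal : HasSum (fun n => ‖p (f n) x‖ ^ 2) (‖v‖ ^ 2) := by
      have h := hsum f hf hd x
      have hfin : ∑' n, ‖p (f n) x‖ₑ ^ 2 ≠ ∞ := by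
        rw [← h]
        exact (ENNReal.pow_lt_top enorm_lt_top).ne
      have h1 := ENNReal.hasSum_toReal hfin
      rw [← ENNReal.tsum_toReal_eq (fun n => (ENNReal.pow_lt_top enorm_lt_top).ne), ← h] at h1
      simpa using h1
    rw [HasSum, SummationFilter.unconditional_filter, tendsto_iff_norm_sub_tendsto_zero]
    have h2 : Tendsto (fun s : Finset ℕ => ‖v‖ ^ 2 - ∑ n ∈ s, ‖p (f n) x‖ ^ 2) atTop
        (𝓝 (‖v‖ ^ 2 - ‖v‖ ^ 2)) := tendsto_const_nhds.sub hreal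
    rw [sub_self] at h2
    have h3 := (Real.continuous_sqrt.tendsto 0).comp h2
    rw [Real.sqrt_zero] at h3
    refine h3.congr fun s => ?_
    rw [Function.comp_apply, ← hdist, Real.sqrt_sq (norm_nonneg _)]

variable (E F : PVM α K)

variable {E F} in
theorem ext_of_proj (h : ∀ B, MeasurableSet B → E.proj B = F.proj B) : E = F := by
  have : E.proj = F.proj := by
    funext B
    by_cases hB : MeasurableSet B
    · exact h B hB
    · rw [E.not_measurable B hB, F.not_measurable B hB]
  cases E
  cases F
  congr

theorem measure_apply {B : Set α} (hB : MeasurableSet B) (x : K) :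
    E.measure x B = ‖E.proj B x‖ₑ ^ 2 := by
  rw [measure, Measure.ofMeasurable_apply _ hB, E.inner_proj_self hB, Complex.ofReal_re,
    ENNReal.ofReal_pow (norm_nonneg _), ofReal_norm]

theorem isMassFamily : IsMassFamily E.measure := fun x => by
  rw [E.measure_apply MeasurableSet.univ, E.univ]
  rfl

instance (x : K) : IsFiniteMeasure (E.measure x) := E.isMassFamily.isFiniteMeasure x

theorem inner_proj_eq_real {B : Set α} (hB : MeasurableSet B) (x : K) :
    ⟪x, E.proj B x⟫_ℂ = ((E.measure x).real B : ℂ) := by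
  rw [E.inner_proj_self hB, Measure.real, E.measure_apply hB]
  simp

theorem represents_indicator {B : Set α} (hB : MeasurableSet B) :
    Represents E.measure (B.indicator 1) (E.proj B) := fun x => by
  rw [E.inner_proj_eq_real hB, integral_indicator_one_complex _ hB]

variable {E F} in
theorem ext_of_measure (h : ∀ x, E.measure x = F.measure x) : E = F :=
  ext_of_proj fun B hB => clm_ext_quadratic fun x => by
    rw [E.inner_proj_eq_real hB, F.inner_proj_eq_real hB, h x]

theorem measure_map {φ : α → β} (hφ : Measurable φ) (x : K) :
    (E.map φ hφ).measure x = (E.measure x).map φ := by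
  ext B hB
  rw [measure_apply _ hB, Measure.map_apply hφ hB, measure_apply _ (hφ hB)]
  simp [map, hB]

theorem map_proj {φ : α → β} (hφ : Measurable φ) {B : Set β} (hB : MeasurableSet B) :
    (E.map φ hφ).proj B = E.proj (φ ⁻¹' B) := by
  simp [map, hB]

theorem map_map {γ : Type*} [MeasurableSpace γ] {φ : α → β} (hφ : Measurable φ) {ψ : β → γ}
    (hψ : Measurable ψ) : (E.map φ hφ).map ψ hψ = E.map (fun a => ψ (φ a)) (hψ.comp hφ) :=
  ext_of_proj fun B hB => by
    rw [map_proj _ _ hB, map_proj _ _ (hψ hB), map_proj _ _ hB]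
    rfl

theorem map_id' {φ : α → α} (hφ : Measurable φ) (h : ∀ a, φ a = a) : E.map φ hφ = E :=
  ext_of_proj fun B hB => by
    rw [map_proj _ _ hB]
    congr
    ext a
    simp [h]

section Complete

variable [CompleteSpace K] {f g : α → ℂ}

/-- The integral is defined by choice, so existence is the point: representable functions contain
the indicators and are closed under sums, multiples and bounded pointwise limits. -/
theorem represents_integral (hf : IsBddMeas f) : Represents E.measure f (E.integral f) := by
  refine Classical.epsilon_spec (p := fun T : K →L[ℂ] K => ∀ x, ⟪x, T x⟫_ℂ =
    ∫ a, f a ∂(E.measure x)) ?_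
  refine hf.induction (p := fun f => ∃ T, Represents E.measure f T)
    (fun B hB => ⟨_, E.represents_indicator hB⟩) ?_ ?_ ?_
  · rintro f g hf hg ⟨S, hS⟩ ⟨T, hT⟩
    exact ⟨_, hS.add E.isMassFamily hf hg hT⟩
  · rintro c f - ⟨T, hT⟩
    exact ⟨_, hT.smul c⟩
  · intro u f M hm hM h hV
    choose V hV using hV
    exact Represents.exists_of_tendsto E.isMassFamily hm hM h hV

variable {E} in
theorem integral_eq (hf : IsBddMeas f) {T : K →L[ℂ] K} (hT : Represents E.measure f T) :
    E.integral f = T := (E.represents_integral hf).unique hT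

theorem inner_integral (hf : IsBddMeas f) (x : K) :
    ⟪x, E.integral f x⟫_ℂ = ∫ a, f a ∂(E.measure x) := E.represents_integral hf x

theorem integral_indicator {B : Set α} (hB : MeasurableSet B) :
    E.integral (B.indicator 1) = E.proj B :=
  integral_eq (IsBddMeas.indicator_one hB) (E.represents_indicator hB)

theorem integral_one : E.integral 1 = 1 :=
  integral_eq (IsBddMeas.const 1) (Represents.one E.isMassFamily)

theorem integral_add (hf : IsBddMeas f) (hg : IsBddMeas g) :
    E.integral (f + g) = E.integral f + E.integral g :=
  integral_eq (hf.add hg)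
    ((E.represents_integral hf).add E.isMassFamily hf hg (E.represents_integral hg))

theorem integral_smul (c : ℂ) (hf : IsBddMeas f) : E.integral (c • f) = c • E.integral f :=
  integral_eq (hf.smul c) ((E.represents_integral hf).smul c)

theorem integral_neg (hf : IsBddMeas f) : E.integral (-f) = -E.integral f := by
  simpa using E.integral_smul (-1) hf

theorem integral_sub (hf : IsBddMeas f) (hg : IsBddMeas g) :
    E.integral (f - g) = E.integral f - E.integral g := by
  rw [sub_eq_add_neg, E.integral_add hf hg.neg, E.integral_neg hg, sub_eq_add_neg]

theorem adjoint_integral (hf : IsBddMeas f) :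
    (E.integral f).adjoint = E.integral fun a => starRingEnd ℂ (f a) :=
  (integral_eq hf.conj (E.represents_integral hf).adjoint).symm

/-- Two monotone class arguments, one per factor, starting from the multiplicativity of projections
on intersections. The induction predicates carry boundedness as a premise because the limit clause
of the induction does not supply it for the limit function. -/
theorem integral_mul (hf : IsBddMeas f) (hg : IsBddMeas g) :
    E.integral (f * g) = E.integral f * E.integral g := by
  have step1 : ∀ B, MeasurableSet B → ∀ f, IsBddMeas f →
      Represents E.measure (f * B.indicator 1) (E.integral f * E.proj B) := by
    intro B hB f hf
    have hB' : IsBddMeas (B.indicator (1 : α → ℂ)) := IsBddMeas.indicator_one hB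
    refine hf.induction (p := fun f => IsBddMeas f →
      Represents E.measure (f * B.indicator 1) (E.integral f * E.proj B)) ?_ ?_ ?_ ?_ hf
    · intro C hC _
      rw [E.integral_indicator hC, ← E.inter C B hC hB, indicator_one_mul_indicator_one]
      exact E.represents_indicator (hC.inter hB)
    · intro f g hf hg h1 h2 _
      rw [add_mul, E.integral_add hf hg, add_mul]
      exact (h1 hf).add E.isMassFamily (hf.mul hB') (hg.mul hB') (h2 hg)
    · intro c f hf h _
      rw [smul_mul_assoc, E.integral_smul c hf, smul_mul_assoc]
      exact (h hf).smul c
    · intro u f M hm hM h hu hf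
      exact Represents.mul_of_tendsto E.isMassFamily hm hM h
        (fun n => E.represents_integral ⟨hm n, M, hM n⟩) (E.represents_integral hf) hB'
        fun n => hu n ⟨hm n, M, hM n⟩
  refine integral_eq (hf.mul hg) ?_
  refine hg.induction (p := fun g => IsBddMeas g →
      Represents E.measure (f * g) (E.integral f * E.integral g)) ?_ ?_ ?_ ?_ hg
  · intro B hB _
    rw [E.integral_indicator hB]
    exact step1 B hB f hf
  · intro g k hg hk h1 h2 _
    rw [mul_add, E.integral_add hg hk, mul_add]
    exact (h1 hg).add E.isMassFamily (hf.mul hg) (hf.mul hk) (h2 hk)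
  · intro c g hg h _
    rw [mul_smul_comm, E.integral_smul c hg, mul_smul_comm]
    exact (h hg).smul c
  · intro u g M hm hM h hu hg
    exact Represents.mul_of_tendsto_right E.isMassFamily hm hM h
      (fun n => E.represents_integral ⟨hm n, M, hM n⟩) (E.represents_integral hg) hf
      fun n => hu n ⟨hm n, M, hM n⟩

theorem integral_mul_apply (hf : IsBddMeas f) (hg : IsBddMeas g) (x : K) :
    E.integral (f * g) x = E.integral f (E.integral g x) := by
  rw [E.integral_mul hf hg]
  rfl

theorem inner_integral_integral (hf : IsBddMeas f) (hg : IsBddMeas g) (x : K) :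
    ⟪E.integral f x, E.integral g x⟫_ℂ = ∫ a, starRingEnd ℂ (f a) * g a ∂(E.measure x) := by
  rw [← ContinuousLinearMap.adjoint_inner_right, E.adjoint_integral hf,
    ← E.integral_mul_apply hf.conj hg, E.inner_integral (hf.conj.mul hg)]
  rfl

theorem norm_integral_sq (hf : IsBddMeas f) (x : K) :
    ‖E.integral f x‖ ^ 2 = ∫ a, ‖f a‖ ^ 2 ∂(E.measure x) := by
  have h := E.inner_integral_integral hf hf x
  rw [inner_self_eq_ofReal] at h
  have e : ∀ a, starRingEnd ℂ (f a) * f a = ((‖f a‖ ^ 2 : ℝ) : ℂ) := fun a => by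
    rw [mul_comm, Complex.mul_conj, Complex.normSq_eq_norm_sq]
  simp only [e] at h
  rw [integral_complex_ofReal] at h
  exact Complex.ofReal_injective h

theorem enorm_integral_sq (hf : IsBddMeas f) (x : K) :
    ‖E.integral f x‖ₑ ^ 2 = ∫⁻ a, ‖f a‖ₑ ^ 2 ∂(E.measure x) := by
  rw [← ofReal_norm, ← ENNReal.ofReal_pow (norm_nonneg _), E.norm_integral_sq hf,
    ofReal_integral_eq_lintegral_ofReal]
  · refine lintegral_congr fun a => ?_
    rw [ENNReal.ofReal_pow (norm_nonneg _), ofReal_norm]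
  · obtain ⟨M, hM⟩ := hf.bdd
    refine Integrable.of_bound (hf.measurable.norm.pow_const 2).aestronglyMeasurable (M ^ 2)
      (Eventually.of_forall fun a => ?_)
    rw [norm_pow, norm_norm]
    exact pow_le_pow_left₀ (norm_nonneg _) (hM a) 2
  · exact Eventually.of_forall fun a => by positivity

/-- Used to decide whether images such as `E.integral f x` lie in the domain of an unbounded
operator. -/
theorem measure_integral (hf : IsBddMeas f) (x : K) :
    E.measure (E.integral f x) = (E.measure x).withDensity fun a => ‖f a‖ₑ ^ 2 := by
  ext B hB
  rw [E.measure_apply hB, withDensity_apply _ hB, ← E.integral_indicator hB,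
    ← E.integral_mul_apply (IsBddMeas.indicator_one hB) hf,
    E.enorm_integral_sq ((IsBddMeas.indicator_one hB).mul hf), ← lintegral_indicator hB]
  refine lintegral_congr fun a => ?_
  by_cases ha : a ∈ B <;> simp [ha]

theorem norm_integral_le (hf : IsBddMeas f) {M : ℝ} (hM : ∀ a, ‖f a‖ ≤ M) (x : K) :
    ‖E.integral f x‖ ≤ M * ‖x‖ := by
  by_cases hα : Nonempty α
  · have hM0 : 0 ≤ M := (norm_nonneg _).trans (hM hα.some)
    refine le_of_sq_le_sq ?_ (by positivity)
    rw [E.norm_integral_sq hf, mul_pow, ← E.isMassFamily.real_univ x]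
    have := norm_integral_le_of_norm_le_const (μ := E.measure x) (f := fun a => ‖f a‖ ^ 2)
      (C := M ^ 2) (Eventually.of_forall fun a => by
        rw [norm_pow, norm_norm]
        exact pow_le_pow_left₀ (norm_nonneg _) (hM a) 2)
    exact (Real.le_norm_self _).trans this
  -- Over an empty type the identity is the projection of the empty set, so the Hilbert space is
  -- trivial.
  · have h1 : E.proj Set.univ = 0 := by
      rw [Set.univ_eq_empty_iff.2 (not_nonempty_iff.1 hα), E.proj_empty]
    rw [E.univ] at h1
    have hx : x = 0 := by simpa using congrArg (fun T : K →L[ℂ] K => T x) h1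
    simp [hx]

theorem integral_map {φ : α → β} (hφ : Measurable φ) {f : β → ℂ} (hf : IsBddMeas f) :
    (E.map φ hφ).integral f = E.integral fun a => f (φ a) :=
  integral_eq hf fun x => by
    rw [E.inner_integral (hf.comp hφ), measure_map,
      MeasureTheory.integral_map hφ.aemeasurable hf.measurable.aestronglyMeasurable]

theorem integral_congr_of_ae (hf : IsBddMeas f) (hg : IsBddMeas g) {x : K}
    (h : f =ᵐ[E.measure x] g) : E.integral f x = E.integral g x := by
  rw [← sub_eq_zero, ← sub_apply, ← E.integral_sub hf hg, ← norm_eq_zero,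
    ← sq_eq_zero_iff, E.norm_integral_sq (hf.sub hg)]
  refine integral_eq_zero_of_ae ?_
  filter_upwards [h] with a ha
  simp [ha]

/-- Bounded pointwise convergence of functions implies strong convergence of operators. -/
theorem tendsto_integral {ι : Type*} {l : Filter ι} [l.IsCountablyGenerated] {u : ι → α → ℂ} {M : ℝ}
    (hu : ∀ n, IsBddMeas (u n)) (hM : ∀ n a, ‖u n a‖ ≤ M) (hf : IsBddMeas f)
    (h : ∀ a, Tendsto (fun n => u n a) l (𝓝 (f a))) (x : K) :
    Tendsto (fun n => E.integral (u n) x) l (𝓝 (E.integral f x)) := by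
  obtain ⟨N, hN⟩ := hf.bdd
  have h1 : Tendsto (fun n => ∫ a, ‖u n a - f a‖ ^ 2 ∂(E.measure x)) l
      (𝓝 (∫ _, (0 : ℝ) ∂(E.measure x))) := by
    refine tendsto_integral_filter_of_dominated_convergence (fun _ => (M + N) ^ 2)
      (Eventually.of_forall fun n =>
        (((hu n).sub hf).measurable.norm.pow_const 2).aestronglyMeasurable)
      (Eventually.of_forall fun n => Eventually.of_forall fun a => ?_) (integrable_const _)
      (Eventually.of_forall fun a => ?_)
    · rw [norm_pow, norm_norm]
      exact pow_le_pow_left₀ (norm_nonneg _)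
        ((norm_sub_le _ _).trans (add_le_add (hM n a) (hN a))) 2
    · have := ((h a).sub_const (f a)).norm.pow 2
      simpa using this
  rw [integral_zero] at h1
  rw [tendsto_iff_norm_sub_tendsto_zero]
  have h3 := (Real.continuous_sqrt.tendsto 0).comp h1
  rw [Real.sqrt_zero] at h3
  refine h3.congr fun n => ?_
  have e := E.norm_integral_sq ((hu n).sub hf) x
  simp only [Pi.sub_apply] at e
  rw [Function.comp_apply, ← e, Real.sqrt_sq (norm_nonneg _), E.integral_sub (hu n) hf,
    sub_apply]

end Complete

end PVM

/-! ## Construction from a multiplicative functional calculus -/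

section Construction

variable {K : Type*} [NormedAddCommGroup K] [InnerProductSpace ℂ K] [CompleteSpace K]
  {X : Type*} [PseudoEMetricSpace X] [MeasurableSpace X] [BorelSpace X]

/-- A multiplicative continuous functional calculus given by a family of measures extends to a
projection-valued measure. -/
theorem exists_pvm_of_continuous {μ : K → Measure X} (hμ : IsMassFamily μ)
    {Φ : (X → ℂ) → K →L[ℂ] K}
    (hΦ : ∀ f, Continuous f → IsBddMeas f → Represents μ f (Φ f))
    (hmul : ∀ f g, Continuous f → Continuous g → IsBddMeas f → IsBddMeas g →
      Φ (f * g) = Φ f * Φ g) : ∃ E : PVM X K, ∀ x, E.measure x = μ x := by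
  classical
  have hex : ∀ f, IsBddMeas f → ∃ T, Represents μ f T := by
    intro f hf
    refine hf.induction_continuous (p := fun f => ∃ T, Represents μ f T)
      (fun f hc hf => ⟨_, hΦ f hc hf⟩) ?_ ?_ ?_
    · rintro f g hf hg ⟨S, hS⟩ ⟨T, hT⟩
      exact ⟨_, hS.add hμ hf hg hT⟩
    · rintro c f - ⟨T, hT⟩
      exact ⟨_, hT.smul c⟩
    · intro u f M hm hM h hV
      choose V hV using hV
      exact Represents.exists_of_tendsto hμ hm hM h hV
  choose! T hT using hex
  have hTadd : ∀ f g, IsBddMeas f → IsBddMeas g → T (f + g) = T f + T g := fun f g hf hg =>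
    (hT _ (hf.add hg)).unique ((hT f hf).add hμ hf hg (hT g hg))
  have hTsmul : ∀ (c : ℂ) f, IsBddMeas f → T (c • f) = c • T f := fun c f hf =>
    (hT _ (hf.smul c)).unique ((hT f hf).smul c)
  -- Multiplicativity is extended one factor at a time: here the first factor becomes arbitrary
  -- while the second stays continuous.
  have step1 : ∀ g, Continuous g → IsBddMeas g → ∀ f, IsBddMeas f →
      Represents μ (f * g) (T f * T g) := by
    intro g hgc hg f hf
    refine hf.induction_continuous (p := fun f => IsBddMeas f →
      Represents μ (f * g) (T f * T g)) ?_ ?_ ?_ ?_ hf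
    · intro f hfc hf _
      rw [(hT f hf).unique (hΦ f hfc hf), (hT g hg).unique (hΦ g hgc hg),
        ← hmul f g hfc hgc hf hg]
      exact hΦ _ (hfc.mul hgc) (hf.mul hg)
    · intro f k hf hk h1 h2 _
      rw [add_mul, hTadd f k hf hk, add_mul]
      exact (h1 hf).add hμ (hf.mul hg) (hk.mul hg) (h2 hk)
    · intro c f hf h _
      rw [smul_mul_assoc, hTsmul c f hf, smul_mul_assoc]
      exact (h hf).smul c
    · intro u f M hm hM h hu hf
      exact Represents.mul_of_tendsto hμ hm hM h (fun n => hT _ ⟨hm n, M, hM n⟩) (hT f hf) hg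
        fun n => hu n ⟨hm n, M, hM n⟩
  have step2 : ∀ f, IsBddMeas f → ∀ g, IsBddMeas g → T (f * g) = T f * T g := by
    intro f hf g hg
    refine (hT _ (hf.mul hg)).unique ?_
    refine hg.induction_continuous (p := fun g => IsBddMeas g →
      Represents μ (f * g) (T f * T g)) ?_ ?_ ?_ ?_ hg
    · intro g hgc hg _
      exact step1 g hgc hg f hf
    · intro g k hg hk h1 h2 _
      rw [mul_add, hTadd g k hg hk, mul_add]
      exact (h1 hg).add hμ (hf.mul hg) (hf.mul hk) (h2 hk)
    · intro c g hg h _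
      rw [mul_smul_comm, hTsmul c g hg, mul_smul_comm]
      exact (h hg).smul c
    · intro u g M hm hM h hu hg
      exact Represents.mul_of_tendsto_right hμ hm hM h (fun n => hT _ ⟨hm n, M, hM n⟩) (hT g hg) hf
        fun n => hu n ⟨hm n, M, hM n⟩
  have hind : ∀ B : Set X, MeasurableSet B → IsBddMeas (B.indicator (1 : X → ℂ)) := fun B hB =>
    IsBddMeas.indicator_one hB
  -- An indicator is its own complex conjugate, so the representing operator and its adjoint
  -- coincide by uniqueness.
  have hsa : ∀ B : Set X, MeasurableSet B → ∀ x y,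
      ⟪T (B.indicator 1) x, y⟫_ℂ = ⟪x, T (B.indicator 1) y⟫_ℂ := by
    intro B hB x y
    have h := (hT _ (hind B hB)).adjoint
    have e : (fun a => starRingEnd ℂ (B.indicator (1 : X → ℂ) a)) = B.indicator 1 := by
      ext a
      by_cases ha : a ∈ B <;> simp [ha]
    rw [e] at h
    rw [← ContinuousLinearMap.adjoint_inner_right, h.unique (hT _ (hind B hB))]
  have hmulB : ∀ B C : Set X, MeasurableSet B → MeasurableSet C →
      T ((B ∩ C).indicator 1) = T (B.indicator 1) * T (C.indicator 1) := by
    intro B C hB hC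
    rw [← step2 _ (hind B hB) _ (hind C hC), indicator_one_mul_indicator_one]
  have hnorm : ∀ B : Set X, MeasurableSet B → ∀ x, ‖T (B.indicator 1) x‖ₑ ^ 2 = μ x B := by
    intro B hB x
    have := hμ.isFiniteMeasure x
    have h1 : ⟪x, T (B.indicator 1) x⟫_ℂ = ((‖T (B.indicator 1) x‖ ^ 2 : ℝ) : ℂ) := by
      have h2 := hmulB B B hB hB
      rw [Set.inter_self] at h2
      have h3 : T (B.indicator 1) x = T (B.indicator 1) (T (B.indicator 1) x) := by
        conv_lhs => rw [h2]
        rfl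
      rw [h3, ← hsa B hB, ← h3, inner_self_eq_ofReal]
    rw [hT _ (hind B hB) x, integral_indicator_one_complex _ hB] at h1
    have h4 : (μ x).real B = ‖T (B.indicator 1) x‖ ^ 2 := by exact_mod_cast h1
    rw [← ofReal_norm, ← ENNReal.ofReal_pow (norm_nonneg _), ← h4, ofReal_measureReal]
  let p : Set X → K →L[ℂ] K := fun B => if MeasurableSet B then T (B.indicator 1) else 0
  have hp : ∀ B, MeasurableSet B → p B = T (B.indicator 1) := fun B hB => if_pos hB
  let E : PVM X K := PVM.ofNormSq p (fun B hB => if_neg hB)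
    (fun B x y => by
      by_cases hB : MeasurableSet B
      · rw [hp B hB, hsa B hB]
      · simp [p, hB])
    (by
      rw [hp _ MeasurableSet.univ, Set.indicator_univ]
      exact (hT 1 (IsBddMeas.const 1)).unique (Represents.one hμ))
    (fun B C hB hC => by rw [hp _ (hB.inter hC), hp B hB, hp C hC, hmulB B C hB hC])
    (fun f hf hd x => by
      rw [hp _ (MeasurableSet.iUnion hf), hnorm _ (MeasurableSet.iUnion hf),
        measure_iUnion hd hf]
      refine tsum_congr fun n => ?_
      rw [hp _ (hf n), hnorm _ (hf n)])
  refine ⟨E, fun x => ?_⟩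
  ext B hB
  rw [E.measure_apply hB, ← hnorm B hB, ← hp B hB]
  rfl

end Construction

/-! ## The spectral theorem for bounded normal operators -/

section Normal

variable {K : Type*} [NormedAddCommGroup K] [InnerProductSpace ℂ K] [CompleteSpace K]

/-- A star homomorphism from continuous functions on a compact space gives real quadratic forms on
real functions. -/
theorem inner_starHom_ofReal {X : Type*} [TopologicalSpace X] [CompactSpace X]
    (Φ : C(X, ℂ) →⋆ₐ[ℂ] (K →L[ℂ] K)) (f : C(X, ℝ)) (x : K) :
    ⟪x, Φ ((ContinuousMap.mk _ Complex.continuous_ofReal).comp f) x⟫_ℂ =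
      ((⟪x, Φ ((ContinuousMap.mk _ Complex.continuous_ofReal).comp f) x⟫_ℂ).re : ℂ) := by
  set g : C(X, ℂ) := (ContinuousMap.mk _ Complex.continuous_ofReal).comp f
  have hg : star g = g := by
    ext a
    simp [g]
  have h : (Φ g).adjoint = Φ g := by
    rw [← ContinuousLinearMap.star_eq_adjoint, ← map_star, hg]
  refine (Complex.conj_eq_iff_re.1 ?_).symm
  rw [inner_conj_symm, ← ContinuousLinearMap.adjoint_inner_right, h]

/-- A nonnegative function is the square of a real continuous one, whose image is self-adjoint, so
the form is a squared norm. This is the positivity needed for Riesz-Markov. -/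
theorem inner_starHom_nonneg {X : Type*} [TopologicalSpace X] [CompactSpace X]
    (Φ : C(X, ℂ) →⋆ₐ[ℂ] (K →L[ℂ] K)) (f : C(X, ℝ)) (hf : 0 ≤ f) (x : K) :
    0 ≤ (⟪x, Φ ((ContinuousMap.mk _ Complex.continuous_ofReal).comp f) x⟫_ℂ).re := by
  set g : C(X, ℂ) := ⟨fun a => ((Real.sqrt (f a) : ℝ) : ℂ), by fun_prop⟩ with hgdef
  have hg : star g = g := by
    ext a
    simp [g]
  have h : (Φ g).adjoint = Φ g := by
    rw [← ContinuousLinearMap.star_eq_adjoint, ← map_star, hg]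
  have e : (ContinuousMap.mk _ Complex.continuous_ofReal).comp f = g * g := by
    ext a
    simp only [ContinuousMap.comp_apply, ContinuousMap.coe_mk, hgdef, ContinuousMap.mul_apply]
    rw [← Complex.ofReal_mul, Real.mul_self_sqrt (show 0 ≤ f a from hf a)]
  rw [e, map_mul]
  have : ⟪x, (Φ g * Φ g) x⟫_ℂ = ⟪Φ g x, Φ g x⟫_ℂ := by
    conv_rhs => rw [← ContinuousLinearMap.adjoint_inner_right, h]
    rfl
  rw [this, inner_self_eq_ofReal, Complex.ofReal_re]
  positivity

/-- The spectral theorem for a bounded normal operator. -/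
theorem exists_pvm_of_isStarNormal (N : K →L[ℂ] K) (hN : IsStarNormal N) :
    ∃ (X : Set ℂ) (E : PVM X K), IsBddMeas (fun z : X => (z : ℂ)) ∧
      E.integral (fun z => (z : ℂ)) = N := by
  classical
  have hcomp : CompactSpace (spectrum ℂ N) := isCompact_iff_compactSpace.1 (spectrum.isCompact N)
  set X := spectrum ℂ N
  let H : C(X, ℂ) →⋆ₐ[ℂ] (K →L[ℂ] K) := cfcHom (R := ℂ) (a := N) (p := IsStarNormal) hN
  let r : C(ℝ, ℂ) := ⟨_, Complex.continuous_ofReal⟩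
  have hbdd : ∀ f : X → ℂ, Continuous f → IsBddMeas f := fun f hf => by
    obtain ⟨M, hM⟩ := isCompact_univ.exists_bound_of_continuousOn (f := f) hf.continuousOn
    exact ⟨hf.measurable, M, fun a => hM a trivial⟩
  -- The spectrum is compact, so every continuous function on it has compact support and the
  -- Riesz-Markov theorem yields the scalar spectral measure of each vector.
  let L : K → CompactlySupportedContinuousMap X ℝ →ₚ[ℝ] ℝ := fun x => PositiveLinearMap.mk₀
    { toFun := fun f => (⟪x, H (r.comp f.toContinuousMap) x⟫_ℂ).re
      map_add' := fun f g => by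
        have : r.comp (f + g).toContinuousMap = r.comp f.toContinuousMap
            + r.comp g.toContinuousMap := by
          ext a
          simp [r]
        rw [this, map_add, add_apply, inner_add_right, Complex.add_re]
      map_smul' := fun c f => by
        have : r.comp (c • f).toContinuousMap = (c : ℂ) • r.comp f.toContinuousMap := by
          ext a
          simp [r]
        rw [this, map_smul, smul_apply, inner_smul_right, Complex.re_ofReal_mul]
        rfl }
    (fun f hf => inner_starHom_nonneg H f.toContinuousMap (fun a => hf a) x)
  let μ : K → Measure X := fun x => RealRMK.rieszMeasure (L x)
  have hreal : ∀ (x : K) (f : C(X, ℝ)), ⟪x, H (r.comp f) x⟫_ℂ = ((∫ a, f a ∂(μ x) : ℝ) : ℂ) := by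
    intro x f
    rw [inner_starHom_ofReal H f x]
    congr 1
    exact (RealRMK.integral_rieszMeasure (L x)
      (CompactlySupportedContinuousMap.continuousMapEquiv f)).symm
  have hfin : ∀ x, IsFiniteMeasure (μ x) := fun x => by
    refine ⟨IsCompact.measure_lt_top ?_⟩
    exact isCompact_univ
  have hμ : IsMassFamily μ := fun x => by
    have h := hreal x 1
    have e : r.comp (1 : C(X, ℝ)) = 1 := by
      ext a
      simp [r]
    rw [e, map_one, one_apply_eq_self, inner_self_eq_ofReal] at h
    have h2 : ‖x‖ ^ 2 = (μ x).real Set.univ := by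
      have := Complex.ofReal_injective h
      simpa using this
    rw [← ofReal_measureReal, ← h2, ENNReal.ofReal_pow (norm_nonneg _), ofReal_norm]
  let Φ : (X → ℂ) → K →L[ℂ] K := fun f => if h : Continuous f then H ⟨f, h⟩ else 0
  have hΦ' : ∀ f : C(X, ℂ), Φ f = H f := fun f => dif_pos f.continuous
  obtain ⟨E, hE⟩ := exists_pvm_of_continuous (Φ := Φ) hμ (fun f hc hb x => by
      have := hfin x
      rw [show Φ f = H ⟨f, hc⟩ from dif_pos hc]
      have e : (⟨f, hc⟩ : C(X, ℂ)) = r.comp ⟨fun a => (f a).re, by fun_prop⟩ +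
          Complex.I • r.comp ⟨fun a => (f a).im, by fun_prop⟩ := by
        ext a
        simp only [ContinuousMap.coe_mk, ContinuousMap.add_apply, ContinuousMap.comp_apply,
          ContinuousMap.smul_apply, smul_eq_mul, r]
        rw [mul_comm, Complex.re_add_im]
      rw [e, map_add, map_smul, add_apply, smul_apply, inner_add_right, inner_smul_right, hreal,
        hreal]
      have hi := hb.integrable (μ x)
      simp only [ContinuousMap.coe_mk]
      rw [mul_comm, ← integral_re_add_im hi]
      rfl)
    (fun f g hf hg _ _ => by
      have h1 : Φ f = H ⟨f, hf⟩ := dif_pos hf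
      have h2 : Φ g = H ⟨g, hg⟩ := dif_pos hg
      have h3 : Φ (f * g) = H ⟨f * g, hf.mul hg⟩ := dif_pos (hf.mul hg)
      rw [h1, h2, h3, ← map_mul]
      rfl)
  refine ⟨X, E, hbdd _ continuous_subtype_val,
    PVM.integral_eq (hbdd _ continuous_subtype_val) fun x => ?_⟩
  have hid : H ((ContinuousMap.id ℂ).restrict X) = N := cfcHom_id hN
  have := hfin x
  set f : C(X, ℂ) := (ContinuousMap.id ℂ).restrict X with hf
  have e : f = r.comp ⟨fun a => (f a).re, by fun_prop⟩ +
      Complex.I • r.comp ⟨fun a => (f a).im, by fun_prop⟩ := by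
    ext a
    simp only [ContinuousMap.coe_mk, ContinuousMap.add_apply, ContinuousMap.comp_apply,
      ContinuousMap.smul_apply, smul_eq_mul, r]
    rw [mul_comm, Complex.re_add_im]
  rw [← hid, e, map_add, map_smul, add_apply, smul_apply, inner_add_right, inner_smul_right, hreal,
    hreal, hE]
  have hi := (hbdd f f.continuous).integrable (μ x)
  simp only [ContinuousMap.coe_mk]
  rw [mul_comm]
  exact integral_re_add_im hi

end Normal

/-! ## Unitary groups and Stone generators -/

section Stone

variable {α : Type*} [MeasurableSpace α] {K : Type*} [NormedAddCommGroup K]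
  [InnerProductSpace ℂ K]

theorem IsBddMeas.memLp {f : α → ℂ} (hf : IsBddMeas f) (μ : Measure α) [IsFiniteMeasure μ] :
    MemLp f 2 μ := by
  obtain ⟨M, hM⟩ := hf.bdd
  exact MemLp.of_bound hf.measurable.aestronglyMeasurable M (Eventually.of_forall hM)

theorem isBddMeas_exp (t : ℝ) : IsBddMeas fun l : ℝ => Complex.exp (-Complex.I * t * l) :=
  ⟨by fun_prop, 1, fun l => by
    have : -Complex.I * t * l = ((-(t * l) : ℝ) : ℂ) * Complex.I := by push_cast; ring
    rw [this, Complex.norm_exp_ofReal_mul_I]⟩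

/-- Makes |l| a majorant, uniform in t, of the difference quotients of the exponential. -/
theorem norm_exp_sub_one_le (t l : ℝ) : ‖Complex.exp (-Complex.I * t * l) - 1‖ ≤ |t| * |l| := by
  have : -Complex.I * t * l = Complex.I * ((-(t * l) : ℝ) : ℂ) := by push_cast; ring
  rw [this]
  refine (Real.norm_exp_I_mul_ofReal_sub_one_le).trans ?_
  rw [norm_neg, Real.norm_eq_abs, abs_mul]

theorem tendsto_exp_slope (l : ℝ) : Tendsto (fun t : ℝ => (t : ℂ)⁻¹ *
    (Complex.exp (-Complex.I * t * l) - 1)) (𝓝[≠] 0) (𝓝 (-Complex.I * l)) := by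
  have h : HasDerivAt (fun t : ℝ => Complex.exp (-Complex.I * t * l)) (-Complex.I * l) 0 := by
    have h1 : HasDerivAt (fun t : ℂ => Complex.exp (-Complex.I * t * l))
        (-Complex.I * l) ((0 : ℝ) : ℂ) := by
      have h2 : HasDerivAt (fun t : ℂ => -Complex.I * t * l) (-Complex.I * l) ((0 : ℝ) : ℂ) := by
        simpa using ((hasDerivAt_id ((0 : ℝ) : ℂ)).const_mul (-Complex.I)).mul_const (l : ℂ)
      simpa using h2.cexp
    exact h1.comp_ofReal
  rw [hasDerivAt_iff_tendsto_slope_zero] at h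
  refine h.congr fun t => ?_
  simp only [zero_add, Complex.ofReal_zero, mul_zero, zero_mul, Complex.exp_zero]
  rw [Complex.real_smul, Complex.ofReal_inv]

variable [CompleteSpace K] (E : PVM α K)

theorem PVM.norm_integral_eq_norm_toLp {f : α → ℂ} (hf : IsBddMeas f) (x : K) :
    ‖E.integral f x‖ = ‖(hf.memLp (E.measure x)).toLp f‖ := by
  have h := E.enorm_integral_sq hf x
  have h2 : eLpNorm f 2 (E.measure x) ^ 2 = ∫⁻ a, ‖f a‖ₑ ^ 2 ∂(E.measure x) := by
    have := eLpNorm_nnreal_pow_eq_lintegral (p := 2) (f := f) (μ := E.measure x) (by norm_num)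
    simpa using this
  rw [Lp.norm_toLp, ← toReal_enorm]
  congr 1
  rw [← h2] at h
  exact le_antisymm ((ENNReal.pow_le_pow_left_iff two_ne_zero).1 h.le)
    ((ENNReal.pow_le_pow_left_iff two_ne_zero).1 h.ge)

/-- The vector `∫ f dE x` for a possibly unbounded square integrable `f`. -/
theorem PVM.exists_integral_of_memLp {f : α → ℂ} {x : K} (hf : MemLp f 2 (E.measure x)) :
    ∃ v : K, ∀ (g : α → ℂ) (hg : IsBddMeas g),
      ‖v - E.integral g x‖ = ‖hf.toLp f - (hg.memLp (E.measure x)).toLp g‖ := by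
  have h1 : ∀ n : ℕ, ∃ u : SimpleFunc α ℂ,
      eLpNorm (f - (u : α → ℂ)) 2 (E.measure x) < ENNReal.ofReal (1 / ((n : ℝ) + 1)) := fun n => by
    obtain ⟨u, hu, -⟩ := hf.exists_simpleFunc_eLpNorm_sub_lt (by norm_num)
      (ε := ENNReal.ofReal (1 / ((n : ℝ) + 1))) (by
        rw [Ne, ENNReal.ofReal_eq_zero, not_le]; positivity)
    exact ⟨u, hu⟩
  choose u hu using h1
  have hub : ∀ n, IsBddMeas (u n : α → ℂ) := fun n => by
    obtain ⟨M, hM⟩ := (u n).exists_forall_norm_le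
    exact ⟨(u n).measurable, M, hM⟩
  -- Integration against `E` applied to `x` is an isometry from L² of the scalar measure, so an L²
  -- approximation of `f` gives a Cauchy sequence of vectors.
  have hdiff : ∀ (g k : α → ℂ) (hg : IsBddMeas g) (hk : IsBddMeas k),
      ‖E.integral g x - E.integral k x‖ =
        ‖(hg.memLp (E.measure x)).toLp g - (hk.memLp (E.measure x)).toLp k‖ := by
    intro g k hg hk
    rw [← sub_apply, ← E.integral_sub hg hk, E.norm_integral_eq_norm_toLp (hg.sub hk)]
    rfl
  have ht : Tendsto (fun n => ((hub n).memLp (E.measure x)).toLp (u n)) atTop (𝓝 (hf.toLp f)) := by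
    rw [tendsto_iff_norm_sub_tendsto_zero]
    refine squeeze_zero (fun _ => norm_nonneg _) (fun n => ?_)
      tendsto_one_div_add_atTop_nhds_zero_nat
    rw [norm_sub_rev, ← MemLp.toLp_sub, Lp.norm_toLp]
    exact ENNReal.toReal_le_of_le_ofReal (by positivity) (hu n).le
  have hc : CauchySeq fun n => E.integral (u n) x := by
    have := ht.cauchySeq
    rw [Metric.cauchySeq_iff'] at this ⊢
    intro ε hε
    obtain ⟨N, hN⟩ := this ε hε
    refine ⟨N, fun n hn => ?_⟩
    rw [dist_eq_norm, hdiff _ _ (hub n) (hub N), ← dist_eq_norm]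
    exact hN n hn
  obtain ⟨v, hv⟩ := cauchySeq_tendsto_of_complete hc
  refine ⟨v, fun g hg => ?_⟩
  have l1 := (hv.sub_const (E.integral g x)).norm
  have l2 := (ht.sub_const ((hg.memLp (E.measure x)).toLp g)).norm
  simp only [fun n => hdiff _ _ (hub n) hg] at l1
  exact tendsto_nhds_unique l1 l2

/-- Strong convergence of bounded functions of a projection-valued measure follows from dominated
convergence with a square integrable majorant. -/
theorem PVM.exists_tendsto_integral {ι : Type*} {l : Filter ι} [l.IsCountablyGenerated] [l.NeBot]
    {f : α → ℂ} {G : α → ℝ} {x : K} {u : ι → α → ℂ} (hu : ∀ i, IsBddMeas (u i))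
    (hG : ∫⁻ a, ‖G a‖ₑ ^ 2 ∂(E.measure x) < ∞) (hGm : Measurable G)
    (huG : ∀ᶠ i in l, ∀ a, ‖u i a‖ ≤ G a)
    (h : ∀ a, Tendsto (fun i => u i a) l (𝓝 (f a))) (hfm : Measurable f) :
    ∃ v : K, Tendsto (fun i => E.integral (u i) x) l (𝓝 v) ∧
      ⟪x, v⟫_ℂ = ∫ a, f a ∂(E.measure x) := by
  have hG2 : MemLp G 2 (E.measure x) := by
    refine ⟨hGm.aestronglyMeasurable, ?_⟩
    have := eLpNorm_nnreal_pow_eq_lintegral (p := 2) (f := G) (μ := E.measure x) (by norm_num)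
    have h2 : eLpNorm G 2 (E.measure x) ^ 2 = ∫⁻ a, ‖G a‖ₑ ^ 2 ∂(E.measure x) := by simpa using this
    rw [← h2] at hG
    exact (ENNReal.pow_lt_top_iff.1 hG).resolve_right (by norm_num)
  have hfG : ∀ a, ‖f a‖ ≤ G a := fun a =>
    le_of_tendsto (h a).norm (huG.mono fun i hi => hi a)
  have hf : MemLp f 2 (E.measure x) := hG2.mono' hfm.aestronglyMeasurable
    (Eventually.of_forall hfG)
  obtain ⟨v, hv⟩ := E.exists_integral_of_memLp hf
  have ht : Tendsto (fun i => E.integral (u i) x) l (𝓝 v) := by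
    have hsq : ∀ i, ‖v - E.integral (u i) x‖ ^ 2 = ∫ a, ‖f a - u i a‖ ^ 2 ∂(E.measure x) := by
      intro i
      rw [hv _ (hu i), ← MemLp.toLp_sub, Lp.norm_toLp]
      have h1 := (hf.sub ((hu i).memLp (E.measure x))).eLpNorm_eq_integral_rpow_norm
        (by norm_num) (by norm_num)
      rw [h1, ENNReal.toReal_ofReal (by positivity)]
      simp only [ENNReal.toReal_ofNat, Real.rpow_ofNat, Pi.sub_apply]
      rw [← one_div, ← Real.sqrt_eq_rpow, Real.sq_sqrt (integral_nonneg fun a => by positivity)]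
    have h0 : Tendsto (fun i => ∫ a, ‖f a - u i a‖ ^ 2 ∂(E.measure x)) l
        (𝓝 (∫ _, (0 : ℝ) ∂(E.measure x))) := by
      refine tendsto_integral_filter_of_dominated_convergence (fun a => 4 * G a ^ 2)
        (Eventually.of_forall fun i =>
          ((hfm.sub (hu i).measurable).norm.pow_const 2).aestronglyMeasurable)
        (huG.mono fun i hi => Eventually.of_forall fun a => ?_) (hG2.integrable_sq.const_mul 4)
        (Eventually.of_forall fun a => ?_)
      · rw [norm_pow, norm_norm]
        have h2 : ‖f a - u i a‖ ≤ 2 * G a :=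
          (norm_sub_le _ _).trans (by linarith [hfG a, hi a])
        nlinarith [pow_le_pow_left₀ (norm_nonneg _) h2 2]
      · have := ((h a).const_sub (f a)).norm.pow 2
        simpa using this
    rw [integral_zero] at h0
    rw [tendsto_iff_norm_sub_tendsto_zero]
    have h3 := (Real.continuous_sqrt.tendsto 0).comp h0
    rw [Real.sqrt_zero] at h3
    refine h3.congr fun i => ?_
    rw [Function.comp_apply, ← hsq, Real.sqrt_sq (norm_nonneg _), norm_sub_rev]
  refine ⟨v, ht, ?_⟩
  have l1 : Tendsto (fun i => ⟪x, E.integral (u i) x⟫_ℂ) l (𝓝 ⟪x, v⟫_ℂ) :=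
    tendsto_const_nhds.inner ht
  simp only [fun i => E.inner_integral (hu i) x] at l1
  refine tendsto_nhds_unique l1 ?_
  exact tendsto_integral_filter_of_dominated_convergence G
    (Eventually.of_forall fun i => (hu i).measurable.aestronglyMeasurable)
    (huG.mono fun i hi => Eventually.of_forall hi) (hG2.integrable (by norm_num))
    (Eventually.of_forall h)

end Stone

/-! ### Stone's theorem, and uniqueness of operators and their spectral measures -/

section Uniqueness

variable {K : Type*} [NormedAddCommGroup K] [InnerProductSpace ℂ K] [CompleteSpace K]
  (E : PVM ℝ K)

/-- The unitary group of a projection-valued measure on the line. -/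
def PVM.unitary (t : ℝ) : K →L[ℂ] K := E.integral fun l => Complex.exp (-Complex.I * t * l)

theorem PVM.unitary_zero : E.unitary 0 = 1 := by
  have : (fun l : ℝ => Complex.exp (-Complex.I * (0 : ℝ) * l)) = 1 := by
    ext l
    simp
  rw [PVM.unitary, this, E.integral_one]

theorem PVM.unitary_add (s t : ℝ) (x : K) : E.unitary (s + t) x = E.unitary s (E.unitary t x) := by
  rw [PVM.unitary, PVM.unitary, PVM.unitary,
    ← E.integral_mul_apply (isBddMeas_exp s) (isBddMeas_exp t)]
  congr 2
  ext l
  rw [Pi.mul_apply, ← Complex.exp_add]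
  push_cast
  ring_nf

theorem PVM.measure_unitary (t : ℝ) (x : K) : E.measure (E.unitary t x) = E.measure x := by
  rw [PVM.unitary, E.measure_integral (isBddMeas_exp t)]
  have : (fun l : ℝ => ‖Complex.exp (-Complex.I * t * l)‖ₑ ^ 2) = 1 := by
    ext l
    have : -Complex.I * t * l = ((-(t * l) : ℝ) : ℂ) * Complex.I := by push_cast; ring
    rw [this, ← ofReal_norm, Complex.norm_exp_ofReal_mul_I]
    simp
  rw [this, withDensity_one]

theorem PVM.slope_unitary (t : ℝ) (x : K) : t⁻¹ • (E.unitary t x - x) =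
    E.integral ((t : ℂ)⁻¹ • ((fun l : ℝ => Complex.exp (-Complex.I * t * l)) - 1)) x := by
  have h1 : IsBddMeas (1 : ℝ → ℂ) := IsBddMeas.const 1
  rw [E.integral_smul _ ((isBddMeas_exp t).sub h1), E.integral_sub (isBddMeas_exp t) h1, E.integral_one, smul_apply, sub_apply,
    one_apply_eq_self, ← Complex.ofReal_inv, Complex.coe_smul]
  rfl

theorem norm_slope_le (t l : ℝ) :
    ‖((t : ℂ)⁻¹ • ((fun l : ℝ => Complex.exp (-Complex.I * t * l)) - 1)) l‖ ≤ |l| := by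
  simp only [Pi.smul_apply, Pi.sub_apply, Pi.one_apply, smul_eq_mul, norm_mul, norm_inv,
    Complex.norm_real, Real.norm_eq_abs]
  by_cases ht : t = 0
  · simp [ht]
  · rw [inv_mul_le_iff₀ (abs_pos.2 ht)]
    exact norm_exp_sub_one_le t l

/-- Stone's theorem, for the group generated by a projection-valued measure. -/
theorem PVM.hasDerivAt_unitary {x : K} (hx : ∫⁻ l, ‖l‖ₑ ^ 2 ∂(E.measure x) < ∞) :
    ∃ v, HasDerivAt (fun t => E.unitary t x) v 0 ∧
      ⟪x, v⟫_ℂ = ∫ l, -Complex.I * (l : ℂ) ∂(E.measure x) := by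
  obtain ⟨v, hv, hi⟩ := E.exists_tendsto_integral (l := 𝓝[≠] (0 : ℝ)) (x := x) (G := fun l => |l|)
    (u := fun t => (t : ℂ)⁻¹ • ((fun l : ℝ => Complex.exp (-Complex.I * t * l)) - 1))
    (f := fun l => -Complex.I * l)
    (fun t => ((isBddMeas_exp t).sub (IsBddMeas.const 1)).smul _) (by simpa using hx) (by fun_prop)
    (Eventually.of_forall norm_slope_le) tendsto_exp_slope (by fun_prop)
  refine ⟨v, ?_, hi⟩
  rw [hasDerivAt_iff_tendsto_slope_zero]
  refine hv.congr fun t => ?_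
  rw [← E.slope_unitary, zero_add, E.unitary_zero]
  rfl

/-- Fatou's lemma along t = 1/(n+1): the L² norms of the difference quotients converge to the norm
of the derivative, while their moduli converge pointwise to |l|. -/
theorem PVM.lintegral_lt_top_of_differentiableAt {x : K}
    (hx : DifferentiableAt ℝ (fun t => E.unitary t x) 0) :
    ∫⁻ l, ‖l‖ₑ ^ 2 ∂(E.measure x) < ∞ := by
  have h := hx.hasDerivAt
  set v := deriv (fun t => E.unitary t x) 0
  rw [hasDerivAt_iff_tendsto_slope_zero] at h
  have hn : Tendsto (fun n : ℕ => 1 / ((n : ℝ) + 1)) atTop (𝓝[≠] 0) :=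
    tendsto_nhdsWithin_iff.2 ⟨tendsto_one_div_add_atTop_nhds_zero_nat,
      Eventually.of_forall fun n => by
        have : (0 : ℝ) < 1 / ((n : ℝ) + 1) := by positivity
        exact this.ne'⟩
  have h1 := h.comp hn
  set u : ℝ → ℝ → ℂ := fun t => (t : ℂ)⁻¹ • ((fun l : ℝ => Complex.exp (-Complex.I * t * l)) - 1)
  have hu : ∀ t, IsBddMeas (u t) := fun t => ((isBddMeas_exp t).sub (IsBddMeas.const 1)).smul _
  have h2 : Tendsto (fun n : ℕ => ∫⁻ l, ‖u (1 / ((n : ℝ) + 1)) l‖ₑ ^ 2 ∂(E.measure x)) atTop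
      (𝓝 (‖v‖ₑ ^ 2)) := by
    have h3 := (ENNReal.continuous_pow 2).tendsto _ |>.comp h1.enorm
    refine h3.congr fun n => ?_
    rw [← E.enorm_integral_sq (hu _)]
    simp only [Function.comp_apply, zero_add, E.unitary_zero, one_apply_eq_self]
    rw [E.slope_unitary]
  have h4 : ∫⁻ l, ‖l‖ₑ ^ 2 ∂(E.measure x) ≤ ‖v‖ₑ ^ 2 := by
    rw [← h2.liminf_eq]
    refine le_trans (le_of_eq ?_) (lintegral_liminf_le fun n => (hu _).measurable.enorm.pow_const 2)
    refine lintegral_congr fun l => ?_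
    have h5 := (ENNReal.continuous_pow 2).tendsto _ |>.comp ((tendsto_exp_slope l).comp hn).enorm
    have h6 : ‖-Complex.I * (l : ℂ)‖ₑ = ‖l‖ₑ := by
      rw [← ofReal_norm, ← ofReal_norm]
      simp
    rw [h6] at h5
    exact h5.liminf_eq.symm
  exact h4.trans_lt (ENNReal.pow_lt_top enorm_lt_top)

/-- Once a one-parameter group is recognized as the unitary group of a projection-valued measure,
its Stone generator is diagonalized. ℋ_L, ℋ_R and ℒ are all handled in this way. -/
theorem PVM.isSpectralMeasure_stoneGenerator : IsSpectralMeasure E (stoneGenerator E.unitary) := by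
  have hdom : ∀ x, x ∈ (stoneGenerator E.unitary).domain ↔
      ∫⁻ l, ‖l‖ₑ ^ 2 ∂(E.measure x) < ∞ := fun x =>
    ⟨E.lintegral_lt_top_of_differentiableAt, fun h => by
      obtain ⟨v, hv, -⟩ := E.hasDerivAt_unitary h
      exact hv.differentiableAt⟩
  refine ⟨hdom, fun x => ?_⟩
  obtain ⟨v, hv, hi⟩ := E.hasDerivAt_unitary ((hdom x).1 x.2)
  have : stoneGenerator E.unitary x = Complex.I • v := by
    rw [← hv.deriv]
    rfl
  rw [this, inner_smul_right, hi, integral_const_mul, ← mul_assoc]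
  simp

variable {E} in
-- The vectors E([-n, n])x have bounded spectral support, hence lie in the domain, and they tend to
-- x.
theorem IsSpectralMeasure.dense_domain {T : K →ₗ.[ℂ] K} (h : IsSpectralMeasure E T) :
    Dense (T.domain : Set K) := by
  intro x
  have hB : ∀ n : ℕ, MeasurableSet (Set.Icc (-(n : ℝ)) n) := fun n => measurableSet_Icc
  have ht := E.tendsto_integral (l := atTop) (M := 1)
    (u := fun n : ℕ => (Set.Icc (-(n : ℝ)) n).indicator 1) (f := 1)
    (fun n => IsBddMeas.indicator_one (hB n))
    (fun n a => (norm_indicator_le_norm_self _ _).trans (by simp)) (IsBddMeas.const 1)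
    (fun a => by
      obtain ⟨N, hN⟩ := exists_nat_ge |a|
      refine tendsto_const_nhds.congr' ?_
      filter_upwards [eventually_ge_atTop N] with n hn
      have : |a| ≤ n := hN.trans (by exact_mod_cast hn)
      rw [Set.indicator_of_mem (Set.mem_Icc.2 (abs_le.1 this))]) x
  rw [E.integral_one, one_apply_eq_self] at ht
  refine mem_closure_of_tendsto ht (Eventually.of_forall fun n => ?_)
  rw [SetLike.mem_coe, h.1, E.measure_integral (IsBddMeas.indicator_one (hB n)),
    lintegral_withDensity_eq_lintegral_mul _
      ((IsBddMeas.indicator_one (hB n)).measurable.enorm.pow_const 2) (by fun_prop)]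
  refine lt_of_le_of_lt (lintegral_mono (g := fun _ => ‖(n : ℝ)‖ₑ ^ 2) fun l => ?_) ?_
  · by_cases hl : l ∈ Set.Icc (-(n : ℝ)) n
    · simp only [Pi.mul_apply, Set.indicator_of_mem hl, Pi.one_apply, enorm_one, one_pow, one_mul]
      gcongr
      rw [enorm_le_iff_norm_le, Real.norm_eq_abs, Real.norm_eq_abs, Nat.abs_cast]
      exact abs_le.2 hl
    · simp [Set.indicator_of_notMem hl]
  · rw [lintegral_const]
    exact ENNReal.mul_lt_top (ENNReal.pow_lt_top enorm_lt_top) (measure_lt_top _ _)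

/-- An operator is determined by its spectral measure. -/
theorem IsSpectralMeasure.operator_unique {E : PVM ℝ K} {S T : K →ₗ.[ℂ] K}
    (hS : IsSpectralMeasure E S) (hT : IsSpectralMeasure E T) : S = T := by
  have hd : S.domain = T.domain := by
    ext x
    rw [hS.1, hT.1]
  refine LinearPMap.ext hd fun x hx hx' => ?_
  refine hS.dense_domain.eq_of_inner_right (𝕜 := ℂ) fun y hy => ?_
  -- Polarization is carried out on the common domain, where the two quadratic forms agree; its
  -- density then finishes the argument.
  let ι : S.domain →ₗ[ℂ] T.domain := Submodule.inclusion hd.le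
  have h1 := inner_eq_polar_linearMap S.domain.subtype S.toFun ⟨y, hy⟩ ⟨x, hx⟩
  have h2 := inner_eq_polar_linearMap S.domain.subtype (T.toFun ∘ₗ ι) ⟨y, hy⟩ ⟨x, hx⟩
  have h3 : (fun z : S.domain => ⟪S.domain.subtype z, S.toFun z⟫_ℂ) =
      fun z => ⟪S.domain.subtype z, (T.toFun ∘ₗ ι) z⟫_ℂ := by
    ext z
    exact (hS.2 z).trans (hT.2 (ι z)).symm
  rw [h3, ← h2] at h1
  exact h1

variable {E} in
-- The unitary group preserves scalar spectral measures, hence the domain, and the group law moves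
-- the derivative from 0 to t.
theorem IsSpectralMeasure.hasDerivAt {T : K →ₗ.[ℂ] K} (h : IsSpectralMeasure E T) {x : K}
    (hx : x ∈ T.domain) (t : ℝ) : ∃ hy : E.unitary t x ∈ T.domain,
      HasDerivAt (fun t => E.unitary t x) (-Complex.I • T ⟨E.unitary t x, hy⟩) t := by
  have hy : E.unitary t x ∈ T.domain := by
    rw [h.1, E.measure_unitary, ← h.1]
    exact hx
  refine ⟨hy, ?_⟩
  have hT := h.operator_unique E.isSpectralMeasure_stoneGenerator
  subst hT
  have h1 : DifferentiableAt ℝ (fun s => E.unitary s (E.unitary t x)) 0 := hy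
  have h2 : -Complex.I • stoneGenerator E.unitary ⟨E.unitary t x, hy⟩ =
      deriv (fun s => E.unitary s (E.unitary t x)) 0 := by
    change -Complex.I • Complex.I • deriv (fun s => E.unitary s (E.unitary t x)) 0 = _
    rw [smul_smul]
    simp
  rw [h2]
  have h3 := h1.hasDerivAt
  have h4 : HasDerivAt (fun s => E.unitary (s - t) (E.unitary t x))
      (deriv (fun s => E.unitary s (E.unitary t x)) 0) t := by
    rw [← sub_self t] at h3
    have h5 := h3.comp_sub_const t t
    rwa [sub_self] at h5
  refine h4.congr_of_eventuallyEq (Eventually.of_forall fun s => ?_)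
  simp only [← E.unitary_add, sub_add_cancel]

/-- The spectral measure of an operator is unique. -/
theorem IsSpectralMeasure.unique {E F : PVM ℝ K} {T : K →ₗ.[ℂ] K} (hE : IsSpectralMeasure E T)
    (hF : IsSpectralMeasure F T) : E = F := by
  have key : ∀ t, ∀ x ∈ T.domain, E.unitary t x = F.unitary t x := by
    intro t x hx
    -- The difference solves w' = -iTw with w(0) = 0. Since ⟪w, Tw⟫ is real, ‖w‖² is constant, hence
    -- zero.
    set w : ℝ → K := fun t => E.unitary t x - F.unitary t x with hw
    have hd : ∀ s, HasDerivAt (fun s => ⟪w s, w s⟫_ℂ) 0 s := by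
      intro s
      obtain ⟨h1, h1'⟩ := hE.hasDerivAt hx s
      obtain ⟨h2, h2'⟩ := hF.hasDerivAt hx s
      let z : T.domain := ⟨E.unitary s x, h1⟩ - ⟨F.unitary s x, h2⟩
      have h3 : HasDerivAt w (-Complex.I • T z) s := by
        have h4 : -Complex.I • T z =
            -Complex.I • T ⟨E.unitary s x, h1⟩ - -Complex.I • T ⟨F.unitary s x, h2⟩ := by
          rw [← smul_sub, ← LinearPMap.map_sub]
        rw [h4]
        exact h1'.sub h2'
      have h5 := h3.inner ℂ h3
      have h7 : ⟪w s, T z⟫_ℂ = ∫ l, (l : ℂ) ∂(E.measure (w s)) := hE.2 z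
      have h8 : ⟪T z, w s⟫_ℂ = ⟪w s, T z⟫_ℂ := by
        rw [← inner_conj_symm, h7, integral_complex_ofReal, Complex.conj_ofReal]
      refine h5.congr_deriv ?_
      rw [inner_smul_right, inner_smul_left, h8]
      simp
    have hc := is_const_of_deriv_eq_zero (fun s => (hd s).differentiableAt)
      (fun s => (hd s).deriv) t 0
    have h0 : w 0 = 0 := by simp [hw, PVM.unitary_zero]
    rw [h0, inner_zero_left, inner_self_eq_zero] at hc
    have : w t = 0 := hc
    exact sub_eq_zero.1 this
  have key2 : ∀ t x, E.unitary t x = F.unitary t x := fun t x => by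
    have := Continuous.ext_on hE.dense_domain (E.unitary t).continuous (F.unitary t).continuous
      (key t)
    exact congrFun this x
  refine PVM.ext_of_measure fun x => ?_
  -- The quadratic form of the unitary group is the Fourier transform of the scalar spectral
  -- measure, and it determines that measure.
  refine Measure.ext_of_charFun ?_
  ext t
  have h1 := E.inner_integral (isBddMeas_exp (-t)) x
  have h2 := F.inner_integral (isBddMeas_exp (-t)) x
  have h3 : ⟪x, E.unitary (-t) x⟫_ℂ = ⟪x, F.unitary (-t) x⟫_ℂ := by rw [key2]
  have h4 : ∀ l : ℝ, Complex.exp (-Complex.I * ((-t : ℝ) : ℂ) * l) =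
      Complex.exp (t * l * Complex.I) := fun l => by
    congr 1
    push_cast
    ring
  simp only [h4] at h1 h2
  rw [charFun_apply_real, charFun_apply_real, ← h1, ← h2]
  simpa only [PVM.unitary, h4] using h3

theorem IsSpectralMeasure.spectralMeasure_eq {E : PVM ℝ K} {T : K →ₗ.[ℂ] K}
    (hE : IsSpectralMeasure E T) : spectralMeasure T = E :=
  (Classical.epsilon_spec (p := fun E => IsSpectralMeasure E T) ⟨E, hE⟩).unique hE

end Uniqueness

/-! ## The spectral theorem for unbounded self-adjoint operators -/

section SelfAdjoint

variable {K : Type*} [NormedAddCommGroup K] [InnerProductSpace ℂ K] [CompleteSpace K]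
  {T : K →ₗ.[ℂ] K}

theorem inner_apply_of_isSelfAdjoint (hT : IsSelfAdjoint T) (x y : T.domain) :
    ⟪T x, (y : K)⟫_ℂ = ⟪(x : K), T y⟫_ℂ := by
  have h := T.adjoint_isFormalAdjoint hT.dense_domain
  rw [LinearPMap.isSelfAdjoint_def.1 hT] at h
  exact h x y

/-- The cross term ⟪Tx, cx⟫ is purely imaginary for c = ±i. Injectivity, closed range and the
resolvent bound all come from this identity. -/
theorem norm_sq_apply_add_smul (hT : IsSelfAdjoint T) {c : ℂ} (hc : starRingEnd ℂ c = -c)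
    (hc1 : ‖c‖ = 1) (x : T.domain) : ‖T x + c • (x : K)‖ ^ 2 = ‖T x‖ ^ 2 + ‖(x : K)‖ ^ 2 := by
  have h : (⟪T x, c • (x : K)⟫_ℂ).re = 0 := by
    have h1 : starRingEnd ℂ ⟪T x, c • (x : K)⟫_ℂ = -⟪T x, c • (x : K)⟫_ℂ := by
      rw [inner_conj_symm, inner_smul_left, inner_smul_right, hc, inner_apply_of_isSelfAdjoint hT]
      ring
    have h2 := congrArg Complex.re h1
    simp only [Complex.conj_re, Complex.neg_re] at h2
    linarith
  rw [@norm_add_sq ℂ, RCLike.re_to_complex, h, norm_smul, hc1]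
  ring

/-- On the graph, which is closed and hence complete, `T + c` is bounded below, so its range is
closed. A vector w orthogonal to the range satisfies T*w = cw, so w is in the domain and 2cw is
orthogonal to w, which forces w = 0. -/
theorem surjective_apply_add_smul (hT : IsSelfAdjoint T) {c : ℂ} (hc : starRingEnd ℂ c = -c)
    (hc1 : ‖c‖ = 1) (y : K) : ∃ x : T.domain, T x + c • (x : K) = y := by
  let f : T.graph →L[ℂ] K :=
    (ContinuousLinearMap.snd ℂ K K + c • ContinuousLinearMap.fst ℂ K K).comp T.graph.subtypeL
  have hf : ∀ z : T.graph, ∃ x : T.domain, (z : K × K) = ((x : K), T x) ∧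
      f z = T x + c • (x : K) := by
    rintro ⟨⟨a, b⟩, hz⟩
    obtain ⟨x, h1, h2⟩ := LinearPMap.mem_graph_iff _ |>.1 hz
    refine ⟨x, ?_, ?_⟩
    · simp only at h1 h2
      rw [h1, h2]
    · simp only at h1 h2
      rw [h1, h2]
      rfl
  have hanti : AntilipschitzWith 1 f := by
    refine AddMonoidHomClass.antilipschitz_of_bound f fun z => ?_
    obtain ⟨x, h1, h2⟩ := hf z
    have h3 := norm_sq_apply_add_smul hT hc hc1 x
    rw [h2, NNReal.coe_one, one_mul, Submodule.norm_coe z |>.symm, h1, Prod.norm_def]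
    refine max_le ?_ ?_
    · exact le_of_sq_le_sq (by nlinarith [sq_nonneg ‖T x‖]) (norm_nonneg _)
    · exact le_of_sq_le_sq (by nlinarith [sq_nonneg ‖(x : K)‖]) (norm_nonneg _)
  have hcomp : CompleteSpace T.graph :=
    (show IsClosed (T.graph : Set (K × K)) from hT.isClosed).completeSpace_coe
  have hcl : IsClosed (Set.range f) := hanti.isClosed_range f.uniformContinuous
  have hclr : IsClosed (f.range : Set K) := hcl
  have hperp : f.rangeᗮ = ⊥ := by
    rw [Submodule.eq_bot_iff]
    intro w hw
    rw [Submodule.mem_orthogonal] at hw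
    have hw' : ∀ x : T.domain, ⟪T x + c • (x : K), w⟫_ℂ = 0 := fun x => by
      refine hw _ ⟨⟨((x : K), T x), T.mem_graph x⟩, rfl⟩
    have h1 : ∀ x : T.domain, ⟪c • w, (x : K)⟫_ℂ = ⟪w, T x⟫_ℂ := fun x => by
      have h2 := hw' x
      rw [inner_add_left, inner_smul_left, hc] at h2
      have h3 : ⟪T x, w⟫_ℂ = c * ⟪(x : K), w⟫_ℂ := by linear_combination h2
      rw [← inner_conj_symm w, h3, inner_smul_left, map_mul, inner_conj_symm]
    have hmem : w ∈ T.domain := by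
      have := T.mem_adjoint_domain_of_exists w ⟨_, h1⟩
      rwa [LinearPMap.isSelfAdjoint_def.1 hT] at this
    have happ : T ⟨w, hmem⟩ = c • w := by
      refine hT.dense_domain.eq_of_inner_left (𝕜 := ℂ) fun v hv => ?_
      have h4 := h1 ⟨v, hv⟩
      have h5 := inner_apply_of_isSelfAdjoint hT ⟨w, hmem⟩ ⟨v, hv⟩
      exact h5.trans h4.symm
    have h6 := hw' ⟨w, hmem⟩
    rw [happ, ← two_smul ℂ, inner_smul_left, inner_smul_left] at h6
    have hc0 : c ≠ 0 := norm_ne_zero_iff.1 (by rw [hc1]; norm_num)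
    simpa [hc0] using h6
  have htop : f.range = ⊤ := by
    have := Submodule.topologicalClosure_eq_top_iff.2 hperp
    rwa [IsClosed.submodule_topologicalClosure_eq hclr] at this
  have : y ∈ f.range := by rw [htop]; trivial
  obtain ⟨z, hz⟩ := this
  obtain ⟨x, -, h2⟩ := hf z
  exact ⟨x, h2.symm.trans hz⟩

theorem injective_apply_add_smul (hT : IsSelfAdjoint T) {c : ℂ} (hc : starRingEnd ℂ c = -c)
    (hc1 : ‖c‖ = 1) {x y : T.domain} (h : T x + c • (x : K) = T y + c • (y : K)) : x = y := by
  have h1 := norm_sq_apply_add_smul hT hc hc1 (x - y)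
  have h2 : T (x - y) + c • ((x - y : T.domain) : K) = 0 := by
    rw [LinearPMap.map_sub, Submodule.coe_sub, smul_sub]
    rw [← sub_eq_zero] at h
    rw [← h]
    abel
  rw [h2, norm_zero] at h1
  have h3 : ‖((x - y : T.domain) : K)‖ ^ 2 = 0 := by
    nlinarith [sq_nonneg ‖T (x - y)‖, sq_nonneg ‖((x - y : T.domain) : K)‖]
  have h4 : ((x - y : T.domain) : K) = 0 := by simpa using h3
  exact sub_eq_zero.1 (Subtype.ext h4)

theorem exists_resolvent (hT : IsSelfAdjoint T) {c : ℂ} (hc : starRingEnd ℂ c = -c)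
    (hc1 : ‖c‖ = 1) :
    ∃ R : K →L[ℂ] K, ∀ y, ∃ h : R y ∈ T.domain, T ⟨R y, h⟩ + c • R y = y := by
  choose r hr using surjective_apply_add_smul hT hc hc1
  have inj := fun {x y : T.domain} => injective_apply_add_smul hT hc hc1 (x := x) (y := y)
  let L : K →ₗ[ℂ] K :=
    { toFun := fun y => r y
      map_add' := fun y z => by
        rw [← Submodule.coe_add]
        congr 1
        refine inj ?_
        rw [hr, LinearPMap.map_add, Submodule.coe_add, smul_add, add_add_add_comm, hr, hr]
      map_smul' := fun a y => by
        rw [RingHom.id_apply, ← Submodule.coe_smul]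
        congr 1
        refine inj ?_
        rw [hr, LinearPMap.map_smul, Submodule.coe_smul, smul_comm c a, ← smul_add, hr] }
  refine ⟨L.mkContinuous 1 fun y => ?_, fun y => ⟨(r y).2, hr y⟩⟩
  have h3 := norm_sq_apply_add_smul hT hc hc1 (r y)
  rw [hr] at h3
  rw [one_mul]
  exact le_of_sq_le_sq (by
    change ‖(r y : K)‖ ^ 2 ≤ _
    nlinarith [sq_nonneg ‖T (r y)‖]) (norm_nonneg _)

/-- The spectral theorem for unbounded self-adjoint operators. -/
theorem exists_isSpectralMeasure (hT : IsSelfAdjoint T) : ∃ E : PVM ℝ K, IsSpectralMeasure E T := by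
  have hI : starRingEnd ℂ Complex.I = -Complex.I := Complex.conj_I
  have hI' : starRingEnd ℂ (-Complex.I) = -(-Complex.I) := by rw [map_neg, Complex.conj_I]
  have hI1 : ‖Complex.I‖ = 1 := Complex.norm_I
  have hI1' : ‖-Complex.I‖ = 1 := by rw [norm_neg, Complex.norm_I]
  -- `R` = (T+i)⁻¹ and `S` = (T-i)⁻¹ are adjoint to each other. The resolvent identity, written in
  -- both orders, makes them commute, so `R` is a bounded normal operator.
  obtain ⟨R, hR⟩ := exists_resolvent hT hI hI1
  obtain ⟨S, hS⟩ := exists_resolvent hT hI' hI1'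
  choose hRd hRe using hR
  choose hSd hSe using hS
  have hTR : ∀ y, T ⟨R y, hRd y⟩ = y - Complex.I • R y := fun y => eq_sub_of_add_eq (hRe y)
  have hTS : ∀ y, T ⟨S y, hSd y⟩ = y + Complex.I • S y := fun y => by
    rw [eq_sub_of_add_eq (hSe y), neg_smul, sub_neg_eq_add]
  have hRS : ∀ y, R y - S y = (-2 * Complex.I) • R (S y) := by
    intro y
    have h := injective_apply_add_smul hT hI hI1 (x := ⟨R y, hRd y⟩ - ⟨S y, hSd y⟩)
      (y := (-2 * Complex.I) • ⟨R (S y), hRd (S y)⟩) ?_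
    · exact congrArg Subtype.val h
    · rw [LinearPMap.map_sub, LinearPMap.map_smul, Submodule.coe_sub, Submodule.coe_smul,
        smul_comm Complex.I, ← smul_add, hRe, smul_sub]
      rw [hTS, hTR]
      module
  have hSR : ∀ y, R y - S y = (-2 * Complex.I) • S (R y) := by
    intro y
    have h := injective_apply_add_smul hT hI' hI1' (x := ⟨R y, hRd y⟩ - ⟨S y, hSd y⟩)
      (y := (-2 * Complex.I) • ⟨S (R y), hSd (R y)⟩) ?_
    · exact congrArg Subtype.val h
    · rw [LinearPMap.map_sub, LinearPMap.map_smul, Submodule.coe_sub, Submodule.coe_smul,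
        smul_comm (-Complex.I), ← smul_add, hSe, smul_sub]
      rw [hTS, hTR]
      module
  have hadj : R.adjoint = S := by
    refine (ContinuousLinearMap.eq_adjoint_iff S R).2 (fun x y => ?_) |>.symm
    have h1 := inner_apply_of_isSelfAdjoint hT ⟨S x, hSd x⟩ ⟨R y, hRd y⟩
    rw [hTS, hTR, inner_add_left, inner_sub_right, inner_smul_left, inner_smul_right, hI] at h1
    linear_combination -h1
  have hnormal : IsStarNormal R := by
    refine ⟨?_⟩
    rw [ContinuousLinearMap.star_eq_adjoint, hadj, commute_iff_eq]
    ext y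
    have h := (hSR y).symm.trans (hRS y)
    have h0 : (-2 * Complex.I) ≠ 0 := by simp
    exact smul_right_injective K h0 h
  obtain ⟨X, E, hz, hE⟩ := exists_pvm_of_isStarNormal R hnormal
  have hz2 : IsBddMeas fun z : X => starRingEnd ℂ (z : ℂ) := hz.conj
  have hES : (E.integral fun z => starRingEnd ℂ (z : ℂ)) = S := by
    rw [← E.adjoint_integral hz, hE, hadj]
  -- the spectrum of the resolvent lies on a circle
  have hcirc : ∀ x, ∀ᵐ z : X ∂(E.measure x), (z : ℂ).im = -‖(z : ℂ)‖ ^ 2 := by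
    intro x
    -- The integral of `q` is R - S + 2iRS, which vanishes by the resolvent identity.
    set q : X → ℂ := (fun z : X => (z : ℂ)) -
      (fun z : X => starRingEnd ℂ (z : ℂ)) - (-2 * Complex.I) •
        ((fun z : X => (z : ℂ)) * fun z : X => starRingEnd ℂ (z : ℂ)) with hq
    have hqb : IsBddMeas q := (hz.sub hz2).sub ((hz.mul hz2).smul _)
    have h0 : E.integral q x = 0 := by
      rw [hq, E.integral_sub (hz.sub hz2) ((hz.mul hz2).smul _), E.integral_sub hz hz2,
        E.integral_smul _ (hz.mul hz2), E.integral_mul hz hz2, hE, hES, sub_apply, sub_apply,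
        smul_apply]
      exact sub_eq_zero.2 (hRS x)
    have h1 := E.enorm_integral_sq hqb x
    rw [h0, enorm_zero, zero_pow two_ne_zero, eq_comm,
      lintegral_eq_zero_iff (hqb.measurable.enorm.pow_const 2)] at h1
    filter_upwards [h1] with z hz
    have h2 : q z = 0 := by simpa using hz
    have h3 : ((z : ℂ).im : ℂ) = ((-‖(z : ℂ)‖ ^ 2 : ℝ) : ℂ) := by
      simp only [hq, Pi.sub_apply, Pi.smul_apply, Pi.mul_apply, smul_eq_mul, Complex.sub_conj,
        Complex.mul_conj, Complex.normSq_eq_norm_sq] at h2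
      have h4 : (2 * Complex.I) * (((z : ℂ).im : ℂ) + ((‖(z : ℂ)‖ ^ 2 : ℝ) : ℂ)) = 0 := by
        rw [← h2]
        push_cast
        ring
      have h5 := (mul_eq_zero.1 h4).resolve_left (by simp)
      push_cast at h5 ⊢
      linear_combination h5
    exact_mod_cast h3
  -- `R` is injective, so 0 carries no spectral mass.
  have hne : ∀ x, ∀ᵐ z : X ∂(E.measure x), (z : ℂ) ≠ 0 := by
    intro x
    have hB : MeasurableSet {z : X | (z : ℂ) = 0} :=
      measurable_subtype_coe (measurableSet_singleton 0)
    have hBi := IsBddMeas.indicator_one hB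
    have h0 : R (E.proj {z : X | (z : ℂ) = 0} x) = 0 := by
      rw [← hE, ← E.integral_indicator hB, ← E.integral_mul_apply hz hBi]
      have : ((fun z : X => (z : ℂ)) * Set.indicator {z : X | (z : ℂ) = 0} 1) = (0 : ℂ) • 1 := by
        ext z
        by_cases h : (z : ℂ) = 0 <;> simp [h]
      rw [this, E.integral_smul _ IsBddMeas.one]
      simp
    have h1 := hRe (E.proj {z : X | (z : ℂ) = 0} x)
    have h2 : (⟨R (E.proj {z : X | (z : ℂ) = 0} x), hRd _⟩ : T.domain) = 0 := Subtype.ext h0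
    rw [h2, h0, LinearPMap.map_zero, smul_zero, add_zero] at h1
    rw [ae_iff]
    simp only [ne_eq, not_not]
    rw [E.measure_apply hB, ← h1]
    simp
  -- If z = 1/(t+i), then z⁻¹ = t+i, so the spectral parameter of `T` is the real part of z⁻¹. The
  -- value 0 assigned at z = 0 lies on a null set.
  let φ : X → ℝ := fun z => ((z : ℂ)⁻¹).re
  have hφ : Measurable φ := Complex.measurable_re.comp measurable_subtype_coe.inv
  have hφz : ∀ z : X, φ z * ‖(z : ℂ)‖ ^ 2 = (z : ℂ).re := fun z => by
    by_cases h : (z : ℂ) = 0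
    · simp [h]
    · simp only [φ, Complex.inv_re, Complex.normSq_eq_norm_sq]
      rw [div_mul_cancel₀]
      simpa using h
  have hφle : ∀ z : X, |φ z| ≤ ‖(z : ℂ)‖⁻¹ := fun z => by
    rw [← norm_inv]
    exact Complex.abs_re_le_norm _
  have hmeas : ∀ y, E.measure (R y) = (E.measure y).withDensity fun z : X => ‖(z : ℂ)‖ₑ ^ 2 :=
    fun y => by
      conv_lhs => rw [← hE]
      exact E.measure_integral hz y
  have hzm : Measurable fun z : X => ‖(z : ℂ)‖ₑ ^ 2 := measurable_subtype_coe.enorm.pow_const 2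
  have hrep : ∀ x ∈ T.domain, ∃ y, R y = x := fun x hx => by
    refine ⟨T ⟨x, hx⟩ + Complex.I • x, ?_⟩
    have h := injective_apply_add_smul hT hI hI1 (x := ⟨_, hRd (T ⟨x, hx⟩ + Complex.I • x)⟩)
      (y := ⟨x, hx⟩) (hRe _)
    exact congrArg Subtype.val h
  refine ⟨E.map φ hφ, fun x => ⟨fun hx => ?_, fun hx => ?_⟩, fun x => ?_⟩
  · obtain ⟨y, rfl⟩ := hrep x hx
    rw [E.measure_map, lintegral_map (by fun_prop) hφ, hmeas,
      lintegral_withDensity_eq_lintegral_mul _ hzm (by fun_prop)]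
    refine lt_of_le_of_lt (lintegral_mono (g := fun _ => 1) fun z => ?_) ?_
    · rw [Pi.mul_apply, ← mul_pow, ← enorm_norm (z : ℂ), ← enorm_mul]
      refine pow_le_one₀ (zero_le) ?_
      rw [← enorm_one (G := ℝ), enorm_le_iff_norm_le, norm_mul, norm_norm, norm_one,
        Real.norm_eq_abs]
      refine (mul_le_mul_of_nonneg_left (hφle z) (norm_nonneg _)).trans ?_
      exact mul_inv_le_one
    · rw [lintegral_one]
      exact measure_lt_top _ _
  · rw [E.measure_map, lintegral_map (by fun_prop) hφ] at hx
    -- On the circle |z⁻¹|² = φ² + 1, so square integrability of φ gives that of z⁻¹. Cutting off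
    -- near z = 0 and passing to the limit produces v = ∫ z⁻¹ dE x with Rv = x, which places x in
    -- the domain.
    let B : ℕ → Set (X) := fun n => {z | 1 / ((n : ℝ) + 1) ≤ ‖(z : ℂ)‖}
    have hB : ∀ n, MeasurableSet (B n) := fun n =>
      measurableSet_le measurable_const measurable_subtype_coe.norm
    have hBlim : ∀ z : X, (z : ℂ) ≠ 0 → ∀ᶠ n in atTop, z ∈ B n := fun z hz => by
      have := tendsto_one_div_add_atTop_nhds_zero_nat (𝕜 := ℝ)
      filter_upwards [this.eventually_le_const (norm_pos_iff.2 hz)] with n hn using hn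
    let u : ℕ → X → ℂ := fun n => (B n).indicator fun z => (z : ℂ)⁻¹
    have hu : ∀ n, IsBddMeas (u n) := fun n =>
      ⟨measurable_subtype_coe.inv.indicator (hB n), (n : ℝ) + 1, fun z => by
        by_cases hz : z ∈ B n
        · simp only [u, Set.indicator_of_mem hz, norm_inv]
          have h1 : 1 / ((n : ℝ) + 1) ≤ ‖(z : ℂ)‖ := hz
          have h2 := inv_anti₀ (by positivity) h1
          simpa using h2
        · simp only [u, Set.indicator_of_notMem hz, norm_zero]
          positivity⟩
    have hG : ∫⁻ z : X, ‖‖(z : ℂ)‖⁻¹‖ₑ ^ 2 ∂(E.measure x) < ∞ := by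
      have h1 : ∫⁻ z : X, ‖‖(z : ℂ)‖⁻¹‖ₑ ^ 2 ∂(E.measure x) =
          ∫⁻ z : X, (‖φ z‖ₑ ^ 2 + 1) ∂(E.measure x) := by
        refine lintegral_congr_ae ?_
        filter_upwards [hcirc x, hne x] with z h1 h2
        have h3 : (‖(z : ℂ)‖⁻¹) ^ 2 = φ z ^ 2 + 1 := by
          have h4 : ((z : ℂ)⁻¹).im = 1 := by
            rw [Complex.inv_im, h1, neg_neg, Complex.normSq_eq_norm_sq, div_self]
            simpa using h2
          rw [← norm_inv, ← Complex.normSq_eq_norm_sq, Complex.normSq_apply, h4]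
          simp only [φ]
          ring
        rw [← ofReal_norm, ← ofReal_norm, ← ENNReal.ofReal_pow (norm_nonneg _),
          ← ENNReal.ofReal_pow (norm_nonneg _), ← ENNReal.ofReal_one,
          ← ENNReal.ofReal_add (by positivity) (by norm_num), norm_inv, norm_norm, h3,
          Real.norm_eq_abs, sq_abs]
      rw [h1, lintegral_add_right _ measurable_const, lintegral_one]
      exact ENNReal.add_lt_top.2 ⟨hx, measure_lt_top _ _⟩
    obtain ⟨v, hv, -⟩ := E.exists_tendsto_integral (l := atTop) (u := u)
      (f := fun z : X => (z : ℂ)⁻¹) (G := fun z : X => ‖(z : ℂ)‖⁻¹) (x := x) hu hG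
      measurable_subtype_coe.norm.inv
      (Eventually.of_forall fun n z => by
        refine (norm_indicator_le_norm_self _ _).trans ?_
        rw [norm_inv])
      (fun z => by
        by_cases h : (z : ℂ) = 0
        · refine tendsto_const_nhds.congr fun n => ?_
          by_cases hz : z ∈ B n <;> simp [u, hz, h]
        · refine tendsto_const_nhds.congr' ?_
          filter_upwards [hBlim z h] with n hn
          simp [u, hn]) measurable_subtype_coe.inv
    have h1 : Tendsto (fun n => R (E.integral (u n) x)) atTop (𝓝 (R v)) :=
      (R.continuous.tendsto v).comp hv
    have h2 : Tendsto (fun n => R (E.integral (u n) x)) atTop (𝓝 x) := by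
      have hB0 : MeasurableSet {z : X | (z : ℂ) ≠ 0} :=
        (measurable_subtype_coe (measurableSet_singleton 0)).compl
      have h3 := E.tendsto_integral (l := atTop) (M := 1) (u := fun n => (B n).indicator 1)
        (f := Set.indicator {z : X | (z : ℂ) ≠ 0} 1)
        (fun n => IsBddMeas.indicator_one (hB n))
        (fun n a => (norm_indicator_le_norm_self _ _).trans (by simp))
        (IsBddMeas.indicator_one hB0)
        (fun z => by
          by_cases h : (z : ℂ) = 0
          · refine tendsto_const_nhds.congr fun n => ?_
            have : z ∉ B n := fun hz => by
              have h1 : 1 / ((n : ℝ) + 1) ≤ ‖(z : ℂ)‖ := hz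
              rw [h, norm_zero] at h1
              have : 0 < 1 / ((n : ℝ) + 1) := by positivity
              linarith
            simp [this, h]
          · refine tendsto_const_nhds.congr' ?_
            filter_upwards [hBlim z h] with n hn
            simp [hn, h]) x
      have h4 : E.integral (Set.indicator {z : X | (z : ℂ) ≠ 0} 1) x = x := by
        have h5 : E.integral 1 x = x := by rw [E.integral_one]; rfl
        conv_rhs => rw [← h5]
        refine E.integral_congr_of_ae (IsBddMeas.indicator_one hB0) (IsBddMeas.const 1) ?_
        filter_upwards [hne x] with z hz
        simp [hz]
      rw [h4] at h3
      refine h3.congr fun n => ?_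
      conv_rhs => rw [← hE]
      rw [← E.integral_mul_apply hz (hu n)]
      congr 2
      ext z
      by_cases hzn : z ∈ B n
      · have h1 : 1 / ((n : ℝ) + 1) ≤ ‖(z : ℂ)‖ := hzn
        have h2 : (z : ℂ) ≠ 0 := norm_pos_iff.1 (lt_of_lt_of_le (by positivity) h1)
        simp [u, hzn, h2]
      · simp [u, hzn]
    rw [tendsto_nhds_unique h2 h1]
    exact hRd v
  · obtain ⟨y, hy⟩ := hrep x x.2
    have hx : x = ⟨R y, hRd y⟩ := Subtype.ext hy.symm
    subst hx
    -- As TRy = y - iRy, the form ⟪Ry, TRy⟫ is the integral of the conjugate of z minus i|z|². On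
    -- the circle this integrand equals Re z, that is φ(z)|z|².
    have h2 : ⟪R y, y⟫_ℂ = ∫ z : X, starRingEnd ℂ (z : ℂ) ∂(E.measure y) := by
      rw [← ContinuousLinearMap.adjoint_inner_right, hadj, ← hES]
      exact E.inner_integral hz2 y
    have h3 : ⟪R y, R y⟫_ℂ = ∫ z : X, ((‖(z : ℂ)‖ ^ 2 : ℝ) : ℂ) ∂(E.measure y) := by
      rw [inner_self_eq_ofReal, integral_complex_ofReal, ← E.norm_integral_sq hz, hE]
    rw [hTR, inner_sub_right, inner_smul_right]
    simp only
    rw [h2, h3, E.measure_map, MeasureTheory.integral_map hφ.aemeasurable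
      (by fun_prop), hmeas, integral_withDensity_eq_integral_toReal_smul hzm
        (Eventually.of_forall fun z => ENNReal.pow_lt_top enorm_lt_top), ← integral_const_mul,
      ← integral_sub (hz2.integrable _)]
    · refine integral_congr_ae ?_
      filter_upwards [hcirc y] with z h4
      rw [ENNReal.toReal_pow, toReal_enorm, Complex.real_smul, ← Complex.ofReal_mul,
        mul_comm (‖(z : ℂ)‖ ^ 2) (φ z), hφz z]
      have h6 : ((‖(z : ℂ)‖ ^ 2 : ℝ) : ℂ) = -((z : ℂ).im : ℂ) := by rw [h4]; push_cast; ring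
      rw [h6]
      apply Complex.ext <;> simp
    · refine Integrable.const_mul ?_ _
      have h5 : (fun z : X => ((‖(z : ℂ)‖ ^ 2 : ℝ) : ℂ)) =
          (fun z : X => (z : ℂ)) *
            fun z : X => starRingEnd ℂ (z : ℂ) := by
        ext z
        rw [Pi.mul_apply, Complex.mul_conj, Complex.normSq_eq_norm_sq]
      rw [h5]
      exact (hz.mul hz2).integrable _

theorem isSpectralMeasure_spectralMeasure (hT : IsSelfAdjoint T) :
    IsSpectralMeasure (spectralMeasure T) T :=
  Classical.epsilon_spec (p := fun E => IsSpectralMeasure E T) (exists_isSpectralMeasure hT)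

end SelfAdjoint

/-! ## Joint spectral measures -/

section Joint

variable {α : Type*} [MeasurableSpace α] {K : Type*} [NormedAddCommGroup K] [InnerProductSpace ℂ K]
  [CompleteSpace K]

theorem PVM.commute_integral (E : PVM α K) {S : K →L[ℂ] K}
    (h : ∀ B, MeasurableSet B → Commute S (E.proj B)) {f : α → ℂ} (hf : IsBddMeas f) :
    Commute S (E.integral f) := by
  refine hf.induction (p := fun f => IsBddMeas f → Commute S (E.integral f)) ?_ ?_ ?_ ?_ hf
  · intro B hB _
    rw [E.integral_indicator hB]
    exact h B hB
  · intro f g hf hg h1 h2 _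
    rw [E.integral_add hf hg]
    exact (h1 hf).add_right (h2 hg)
  · intro c f hf h1 _
    rw [E.integral_smul c hf]
    exact (h1 hf).smul_right c
  · intro u f M hm hM hlim hu hf
    have hub : ∀ n, IsBddMeas (u n) := fun n => ⟨hm n, M, hM n⟩
    have ht := fun x => E.tendsto_integral (l := atTop) hub hM hf hlim x
    ext x
    refine tendsto_nhds_unique (((S.continuous.tendsto _).comp (ht x))) ?_
    refine (ht (S x)).congr fun n => ?_
    have := congrArg (fun V : K →L[ℂ] K => V x) (hu n (hub n)).eq
    exact this.symm

/-- With uniqueness of spectral measures, this identifies the image of `E` under φ from the single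
bounded operator ∫ φ dE. -/
theorem PVM.isSpectralMeasure_map (E : PVM α K) {φ : α → ℝ} (hφ : Measurable φ) {M : ℝ}
    (hM : ∀ a, |φ a| ≤ M) : IsSpectralMeasure (E.map φ hφ)
      ((E.integral fun a => (φ a : ℂ)).toLinearMap.toPMap ⊤) := by
  have hb : IsBddMeas fun a => (φ a : ℂ) := ⟨by fun_prop, M, by simpa using hM⟩
  refine ⟨fun x => ⟨fun _ => ?_, fun _ => by simp⟩, fun x => ?_⟩
  · rw [E.measure_map, lintegral_map (by fun_prop) hφ]
    refine lt_of_le_of_lt (lintegral_mono (g := fun _ => ‖M‖ₑ ^ 2) fun a => ?_) ?_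
    · refine pow_le_pow_left' ?_ 2
      rw [enorm_le_iff_norm_le]
      exact (hM a).trans (le_abs_self M)
    · rw [lintegral_const]
      exact ENNReal.mul_lt_top (ENNReal.pow_lt_top enorm_lt_top) (measure_lt_top _ _)
  · rw [E.measure_map, MeasureTheory.integral_map hφ.aemeasurable (by fun_prop)]
    exact E.inner_integral hb x

theorem PVM.adjoint_integral_ofReal (E : PVM α K) {φ : α → ℝ} (hb : IsBddMeas fun a => (φ a : ℂ)) :
    (E.integral fun a => (φ a : ℂ)).adjoint = E.integral fun a => (φ a : ℂ) := by
  rw [E.adjoint_integral hb]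
  simp

/-- Two commuting projection-valued measures on the line are the marginals of a
projection-valued measure on the plane. -/
theorem exists_joint_pvm (E F : PVM ℝ K)
    (hcomm : ∀ B C, MeasurableSet B → MeasurableSet C → Commute (E.proj B) (F.proj C)) :
    ∃ G : PVM (ℝ × ℝ) K, G.map Prod.fst measurable_fst = E ∧ G.map Prod.snd measurable_snd = F := by
  -- The line is squeezed into ]-1, 1[ so that bounded operators replace the possibly unbounded
  -- ones; `ψ` undoes this.
  let φ : ℝ → ℝ := fun x => x / (1 + |x|)
  let ψ : ℝ → ℝ := fun y => y / (1 - |y|)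
  have hφ : Measurable φ := by fun_prop
  have hψ : Measurable ψ := by fun_prop
  have hψφ : ∀ x, ψ (φ x) = x := fun x => by
    have h1 : 0 < 1 + |x| := by positivity
    simp only [φ, ψ, abs_div, abs_of_pos h1]
    field_simp
    simp
  have hφ1 : ∀ x, |φ x| ≤ 1 := fun x => by
    have h1 : 0 < 1 + |x| := by positivity
    rw [abs_div, abs_of_pos h1, div_le_one h1]
    linarith
  have hφb : IsBddMeas fun x => (φ x : ℂ) := ⟨by fun_prop, 1, by simpa using hφ1⟩
  set a : K →L[ℂ] K := E.integral fun x => (φ x : ℂ) with ha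
  set b : K →L[ℂ] K := F.integral fun x => (φ x : ℂ) with hb
  have hab : Commute a b := F.commute_integral (fun C hC =>
    (E.commute_integral (fun B hB => (hcomm B C hB hC).symm) hφb).symm) hφb
  have ha' : star a = a := E.adjoint_integral_ofReal hφb
  have hb' : star b = b := F.adjoint_integral_ofReal hφb
  have hstar : star (a + Complex.I • b) = a - Complex.I • b := by
    rw [star_add, star_smul, ha', hb', ← starRingEnd_apply, Complex.conj_I, neg_smul, sub_eq_add_neg]
  -- A commuting self-adjoint pair is one normal operator, whose spectral measure already lives on
  -- the complex plane.
  have hN : IsStarNormal (a + Complex.I • b) := by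
    refine ⟨?_⟩
    rw [hstar]
    have h1 : Commute a (Complex.I • b) := hab.smul_right _
    exact ((Commute.refl a).sub_left h1.symm).add_right (h1.sub_left (Commute.refl _))
  obtain ⟨X, G, hz, hG⟩ := exists_pvm_of_isStarNormal _ hN
  obtain ⟨M, hM⟩ := hz.bdd
  have hz2 : IsBddMeas fun z : X => starRingEnd ℂ (z : ℂ) := hz.conj
  have hGs : (G.integral fun z => starRingEnd ℂ (z : ℂ)) = a - Complex.I • b := by
    rw [← G.adjoint_integral hz, hG, ← hstar]
    rfl
  have hre : Measurable fun z : X => (z : ℂ).re :=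
    Complex.measurable_re.comp measurable_subtype_coe
  have him : Measurable fun z : X => (z : ℂ).im :=
    Complex.measurable_im.comp measurable_subtype_coe
  have hGa : (G.integral fun z : X => (((z : ℂ).re : ℝ) : ℂ)) = a := by
    have : (fun z : X => (((z : ℂ).re : ℝ) : ℂ)) = (1 / 2 : ℂ) • ((fun z : X => (z : ℂ)) +
        fun z : X => starRingEnd ℂ (z : ℂ)) := by
      ext z
      rw [Complex.re_eq_add_conj]
      simp only [Pi.smul_apply, Pi.add_apply, smul_eq_mul]
      ring
    rw [this, G.integral_smul _ (hz.add hz2), G.integral_add hz hz2, hG, hGs]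
    module
  have hGb : (G.integral fun z : X => (((z : ℂ).im : ℝ) : ℂ)) = b := by
    have : (fun z : X => (((z : ℂ).im : ℝ) : ℂ)) = (1 / (2 * Complex.I) : ℂ) •
        ((fun z : X => (z : ℂ)) - fun z : X => starRingEnd ℂ (z : ℂ)) := by
      ext z
      rw [Complex.im_eq_sub_conj]
      simp only [Pi.smul_apply, Pi.sub_apply, smul_eq_mul]
      ring
    rw [this, G.integral_smul _ (hz.sub hz2), G.integral_sub hz hz2, hG, hGs]
    have h2 : a + Complex.I • b - (a - Complex.I • b) = (2 * Complex.I) • b := by module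
    rw [h2, smul_smul, one_div, inv_mul_cancel₀ (by simp), one_smul]
  -- Both sides are spectral measures of the same bounded operator `a`.
  have hEa : E.map φ hφ = G.map _ hre := by
    have h1 := E.isSpectralMeasure_map hφ hφ1
    have h2 := G.isSpectralMeasure_map hre (fun z => (Complex.abs_re_le_norm _).trans (hM z))
    rw [hGa] at h2
    exact h1.unique h2
  have hFb : F.map φ hφ = G.map _ him := by
    have h1 := F.isSpectralMeasure_map hφ hφ1
    have h2 := G.isSpectralMeasure_map him (fun z => (Complex.abs_im_le_norm _).trans (hM z))
    rw [hGb] at h2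
    exact h1.unique h2
  refine ⟨G.map (fun z : X => (ψ (z : ℂ).re, ψ (z : ℂ).im))
    ((hψ.comp hre).prodMk (hψ.comp him)), ?_, ?_⟩
  · rw [PVM.map_map]
    have h := congrArg (fun A : PVM ℝ K => A.map ψ hψ) hEa
    simp only [PVM.map_map] at h
    rw [← h]
    exact E.map_id' _ hψφ
  · rw [PVM.map_map]
    have h := congrArg (fun A : PVM ℝ K => A.map ψ hψ) hFb
    simp only [PVM.map_map] at h
    rw [← h]
    exact F.map_id' _ hψφ

omit [CompleteSpace K] in
theorem PVM.proj_prod (G : PVM (ℝ × ℝ) K) {B C : Set ℝ} (hB : MeasurableSet B)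
    (hC : MeasurableSet C) : G.proj (B ×ˢ C) =
      (G.map Prod.fst measurable_fst).proj B * (G.map Prod.snd measurable_snd).proj C := by
  rw [PVM.map_proj _ _ hB, PVM.map_proj _ _ hC,
    ← G.inter _ _ (measurable_fst hB) (measurable_snd hC)]
  rfl

omit [CompleteSpace K] in
-- Unlike for scalar measures, marginals suffice: the projection of a rectangle is the product of
-- the marginal projections, and rectangles form a generating π-system.
theorem PVM.ext_of_marginals {G G' : PVM (ℝ × ℝ) K}
    (h1 : G.map Prod.fst measurable_fst = G'.map Prod.fst measurable_fst)
    (h2 : G.map Prod.snd measurable_snd = G'.map Prod.snd measurable_snd) : G = G' := by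
  refine PVM.ext_of_measure fun x => ?_
  refine ext_of_generate_finite _ generateFrom_prod.symm isPiSystem_prod ?_ ?_
  · rintro _ ⟨B, hB, C, hC, rfl⟩
    have hB : MeasurableSet B := hB
    have hC : MeasurableSet C := hC
    rw [G.measure_apply (hB.prod hC), G'.measure_apply (hB.prod hC), G.proj_prod hB hC,
      G'.proj_prod hB hC, h1, h2]
  · rw [G.isMassFamily, G'.isMassFamily]

theorem jointSpectralMeasure_eq {G : PVM (ℝ × ℝ) K} {S T : K →ₗ.[ℂ] K}
    (hS : IsSpectralMeasure (G.map Prod.fst measurable_fst) S)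
    (hT : IsSpectralMeasure (G.map Prod.snd measurable_snd) T) : jointSpectralMeasure S T = G := by
  have h := Classical.epsilon_spec (p := fun E : PVM (ℝ × ℝ) K =>
    IsSpectralMeasure (E.map Prod.fst measurable_fst) S ∧
      IsSpectralMeasure (E.map Prod.snd measurable_snd) T) ⟨G, hS, hT⟩
  exact PVM.ext_of_marginals (h.1.unique hS) (h.2.unique hT)

end Joint

/-! ## The spectral formula for an abstract Liouvillian -/

section Liouvillian

variable {K : Type*} [NormedAddCommGroup K] [InnerProductSpace ℂ K] [CompleteSpace K]

/-- Boundedness of l f(l) dominates the difference quotients times f, so the group is differentiable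
at this vector. The junk value of `applyOp` off the domain is never met. -/
theorem IsSpectralMeasure.apply_integral {D : PVM ℝ K} {T : K →ₗ.[ℂ] K}
    (hD : IsSpectralMeasure D T) {f : ℝ → ℂ} (hf : IsBddMeas f)
    (hlf : IsBddMeas fun l : ℝ => (l : ℂ) * f l) (x : K) :
    applyOp T (D.integral f x) = D.integral (fun l => (l : ℂ) * f l) x := by
  have hT := hD.operator_unique D.isSpectralMeasure_stoneGenerator
  subst hT
  have hq : ∀ t : ℝ, IsBddMeas
      ((t : ℂ)⁻¹ • ((fun l : ℝ => Complex.exp (-Complex.I * t * l)) - 1)) := fun t =>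
    ((isBddMeas_exp t).sub IsBddMeas.one).smul _
  obtain ⟨M, hM⟩ := hlf.bdd
  have hd : HasDerivAt (fun t => D.unitary t (D.integral f x))
      (D.integral (-Complex.I • fun l : ℝ => (l : ℂ) * f l) x) 0 := by
    rw [hasDerivAt_iff_tendsto_slope_zero]
    have := D.tendsto_integral (l := 𝓝[≠] (0 : ℝ)) (M := M)
      (u := fun t => ((t : ℂ)⁻¹ • ((fun l : ℝ => Complex.exp (-Complex.I * t * l)) - 1)) * f)
      (f := -Complex.I • fun l : ℝ => (l : ℂ) * f l) (fun t => (hq t).mul hf) (fun t l => by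
        rw [Pi.mul_apply, norm_mul]
        refine le_trans ?_ (hM l)
        rw [norm_mul, Complex.norm_real]
        exact mul_le_mul_of_nonneg_right (norm_slope_le t l) (norm_nonneg _)) (hlf.smul _)
      (fun l => by
        have := (tendsto_exp_slope l).mul_const (f l)
        rw [mul_assoc] at this
        exact this) x
    refine this.congr fun t => ?_
    rw [D.integral_mul_apply (hq t) hf, ← D.slope_unitary, zero_add, D.unitary_zero]
    rfl
  have hmem : D.integral f x ∈ (stoneGenerator D.unitary).domain := hd.differentiableAt
  rw [applyOp, dif_pos hmem]
  change Complex.I • deriv (fun t => D.unitary t (D.integral f x)) 0 = _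
  rw [hd.deriv, D.integral_smul _ hlf, smul_apply, smul_smul]
  simp

/-- The data of a pair of commuting self-adjoint operators with joint spectral measure `G`. -/
theorem PVM.unitary_comp_unitary (G : PVM (ℝ × ℝ) K) (t : ℝ) :
    ((G.map Prod.fst measurable_fst).unitary t).comp
      ((G.map Prod.snd measurable_snd).unitary (-t)) =
      (G.map (fun p : ℝ × ℝ => p.1 - p.2) (by fun_prop)).unitary t := by
  have h1 : IsBddMeas fun p : ℝ × ℝ => Complex.exp (-Complex.I * t * p.1) :=
    (isBddMeas_exp t).comp measurable_fst
  have h2 : IsBddMeas fun p : ℝ × ℝ => Complex.exp (-Complex.I * (-t : ℝ) * p.2) :=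
    (isBddMeas_exp (-t)).comp measurable_snd
  rw [PVM.unitary, PVM.unitary, PVM.unitary, G.integral_map _ (isBddMeas_exp t),
    G.integral_map _ (isBddMeas_exp (-t)), G.integral_map _ (isBddMeas_exp t)]
  refine (G.integral_mul h1 h2).symm.trans ?_
  congr 1
  ext p
  rw [Pi.mul_apply, ← Complex.exp_add]
  push_cast
  ring_nf

omit [CompleteSpace K] in
theorem PVM.measure_oppositeSides_compl (G : PVM (ℝ × ℝ) K) {e : ℝ} {Y : K}
    (h1 : G.proj (Set.Iic e ×ˢ Set.Iic e) Y = 0) (h2 : G.proj (Set.Ioi e ×ˢ Set.Ioi e) Y = 0) :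
    G.measure Y (oppositeSides e)ᶜ = 0 := by
  have hsub : (oppositeSides e)ᶜ ⊆ (Set.Iic e ×ˢ Set.Iic e) ∪ (Set.Ioi e ×ˢ Set.Ioi e) := by
    rintro ⟨a, b⟩ h
    simp only [oppositeSides, Set.mem_compl_iff, Set.mem_union, Set.mem_prod, Set.mem_Iic,
      Set.mem_Ioi, not_or, not_and, not_lt, not_le] at h ⊢
    rcases le_or_gt a e with ha | ha
    · exact Or.inl ⟨ha, h.1 ha⟩
    · exact Or.inr ⟨ha, h.2 ha⟩
  refine measure_mono_null hsub (measure_union_null ?_ ?_)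
  · rw [G.measure_apply (measurableSet_Iic.prod measurableSet_Iic), h1]
    simp
  · rw [G.measure_apply (measurableSet_Ioi.prod measurableSet_Ioi), h2]
    simp

/-- The function `χ_{]-∞, e]}(l₁) - χ_{]-∞, e]}(l₂)`. -/
def fermiSign (e : ℝ) (p : ℝ × ℝ) : ℂ :=
  (Set.Iic e).indicator 1 p.1 - (Set.Iic e).indicator 1 p.2

theorem isBddMeas_fermiSign (e : ℝ) : IsBddMeas (fermiSign e) :=
  ((IsBddMeas.indicator_one measurableSet_Iic).comp measurable_fst).sub
    ((IsBddMeas.indicator_one measurableSet_Iic).comp measurable_snd)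

/-- Here the absolute value arises, and with it the positivity of -ℒ𝒫: the sign is +1 where p.1 ≤ e
< p.2, and -1 where p.2 ≤ e < p.1. -/
theorem sub_mul_fermiSign {e : ℝ} {p : ℝ × ℝ} (hp : p ∈ oppositeSides e) :
    -((p.1 - p.2 : ℝ) : ℂ) * fermiSign e p = (|p.1 - p.2| : ℝ) := by
  rcases hp with ⟨h1, h2⟩ | ⟨h1, h2⟩
  · have h2' : p.2 ∉ Set.Iic e := Set.notMem_Iic.2 h2
    have h3 : p.1 - p.2 ≤ 0 := sub_nonpos.2 (le_trans (Set.mem_Iic.1 h1) (le_of_lt h2))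
    rw [fermiSign, Set.indicator_of_mem h1, Set.indicator_of_notMem h2', abs_of_nonpos h3]
    simp
  · have h1' : p.1 ∉ Set.Iic e := Set.notMem_Iic.2 h1
    have h3 : 0 ≤ p.1 - p.2 := sub_nonneg.2 (le_trans (Set.mem_Iic.1 h2) (le_of_lt h1))
    rw [fermiSign, Set.indicator_of_mem h2, Set.indicator_of_notMem h1', abs_of_nonneg h3]
    simp

/-- Hence 𝒫Y and Y have the same scalar spectral measure when Y is carried by the opposite sides. -/
theorem enorm_fermiSign {e : ℝ} {p : ℝ × ℝ} (hp : p ∈ oppositeSides e) : ‖fermiSign e p‖ₑ = 1 := by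
  rcases hp with ⟨h1, h2⟩ | ⟨h1, h2⟩
  · have h2' : p.2 ∉ Set.Iic e := Set.notMem_Iic.2 h2
    rw [fermiSign, Set.indicator_of_mem h1, Set.indicator_of_notMem h2']
    simp
  · have h1' : p.1 ∉ Set.Iic e := Set.notMem_Iic.2 h1
    rw [fermiSign, Set.indicator_of_mem h2, Set.indicator_of_notMem h1']
    simp

theorem PVM.proj_sub_proj_eq_integral (G : PVM (ℝ × ℝ) K) (e : ℝ) :
    (G.map Prod.fst measurable_fst).proj (Set.Iic e) -
      (G.map Prod.snd measurable_snd).proj (Set.Iic e) = G.integral (fermiSign e) := by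
  have h : IsBddMeas ((Set.Iic e).indicator (1 : ℝ → ℂ)) := IsBddMeas.indicator_one measurableSet_Iic
  rw [← PVM.integral_indicator _ measurableSet_Iic, ← PVM.integral_indicator _ measurableSet_Iic,
    G.integral_map _ h, G.integral_map _ h, ← G.integral_sub (h.comp measurable_fst)
      (h.comp measurable_snd)]
  rfl

variable (G : PVM (ℝ × ℝ) K) {e : ℝ} {Y : K} {T : K →ₗ.[ℂ] K}

/-- The regularized conductivity measure as an integral over the plane. -/
theorem PVM.inner_cutoff (hT : IsSpectralMeasure (G.map (fun p : ℝ × ℝ => p.1 - p.2) (by fun_prop)) T)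
    (hY : G.measure Y (oppositeSides e)ᶜ = 0) {B : Set ℝ} (hB : MeasurableSet B) (n : ℕ) :
    ⟪Y, (spectralMeasure T).proj B (-applyOp T ((spectralMeasure T).proj (Set.Icc (-(n : ℝ)) n)
      (G.integral (fermiSign e) Y)))⟫_ℂ = ((∫ p, |p.1 - p.2| * (B ∩ Set.Icc (-(n : ℝ)) n).indicator 1
        (p.1 - p.2) ∂(G.measure Y) : ℝ) : ℂ) := by
  have hδ : Measurable fun p : ℝ × ℝ => p.1 - p.2 := by fun_prop
  have hI : MeasurableSet (Set.Icc (-(n : ℝ)) n) := measurableSet_Icc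
  have hIb : IsBddMeas ((Set.Icc (-(n : ℝ)) n).indicator (1 : ℝ → ℂ)) := IsBddMeas.indicator_one hI
  have hBb : IsBddMeas (B.indicator (1 : ℝ → ℂ)) := IsBddMeas.indicator_one hB
  have hlb : IsBddMeas fun l : ℝ => (l : ℂ) * (Set.Icc (-(n : ℝ)) n).indicator 1 l :=
    ⟨Complex.measurable_ofReal.mul hIb.measurable, n, fun l => by
      by_cases hl : l ∈ Set.Icc (-(n : ℝ)) n
      · rw [Set.indicator_of_mem hl, Pi.one_apply, mul_one, Complex.norm_real]
        exact abs_le.2 hl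
      · rw [Set.indicator_of_notMem hl, mul_zero, norm_zero]
        positivity⟩
  have hs := isBddMeas_fermiSign e
  rw [hT.spectralMeasure_eq, ← PVM.integral_indicator _ hI, hT.apply_integral hIb hlb,
    ← PVM.integral_indicator _ hB, G.integral_map hδ hlb, G.integral_map hδ hBb,
    ← G.integral_mul_apply (hlb.comp hδ) hs, ← neg_apply,
    ← G.integral_neg ((hlb.comp hδ).mul hs), ← G.integral_mul_apply (hBb.comp hδ)
      ((hlb.comp hδ).mul hs).neg, G.inner_integral ((hBb.comp hδ).mul ((hlb.comp hδ).mul hs).neg),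
    ← integral_complex_ofReal]
  refine integral_congr_ae ?_
  -- All operators have been merged into one integral over the plane, so the integrands need to
  -- agree only where the measure of `Y` lives.
  have hae : ∀ᵐ p ∂(G.measure Y), p ∈ oppositeSides e := hY
  filter_upwards [hae] with p hp
  have h1 := sub_mul_fermiSign hp
  simp only [Pi.mul_apply, Pi.neg_apply]
  by_cases hpB : p.1 - p.2 ∈ B
  · by_cases hpI : p.1 - p.2 ∈ Set.Icc (-(n : ℝ)) n
    · have hm : p.1 - p.2 ∈ B ∩ Set.Icc (-(n : ℝ)) n := ⟨hpB, hpI⟩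
      rw [Set.indicator_of_mem hpB, Set.indicator_of_mem hpI, Set.indicator_of_mem hm]
      simp only [Pi.one_apply, one_mul, mul_one]
      rw [← h1]
      ring
    · have hm : p.1 - p.2 ∉ B ∩ Set.Icc (-(n : ℝ)) n := fun h => hpI h.2
      rw [Set.indicator_of_notMem hpI, Set.indicator_of_notMem hm]
      simp
  · have hm : p.1 - p.2 ∉ B ∩ Set.Icc (-(n : ℝ)) n := fun h => hpB h.1
    rw [Set.indicator_of_notMem hpB, Set.indicator_of_notMem hm]
    simp

/-- Monotone convergence: the cutoff integrands are nonnegative and increase with n, and at each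
point they reach the full integrand as soon as n ≥ |λ₁ - λ₂|. -/
theorem PVM.iSup_cutoff (hT : IsSpectralMeasure (G.map (fun p : ℝ × ℝ => p.1 - p.2) (by fun_prop)) T)
    (hY : G.measure Y (oppositeSides e)ᶜ = 0) {B : Set ℝ} (hB : MeasurableSet B) :
    ⨆ n : ℕ, ENNReal.ofReal (Real.pi * (⟪Y, (spectralMeasure T).proj B (-applyOp T
      ((spectralMeasure T).proj (Set.Icc (-(n : ℝ)) n) (G.integral (fermiSign e) Y)))⟫_ℂ).re) =
      ENNReal.ofReal Real.pi * ∫⁻ p, ENNReal.ofReal |p.1 - p.2| * B.indicator 1 (p.1 - p.2)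
        ∂(G.measure Y) := by
  have hδ : Measurable fun p : ℝ × ℝ => p.1 - p.2 := by fun_prop
  let w : ℕ → ℝ × ℝ → ℝ := fun n p =>
    |p.1 - p.2| * (B ∩ Set.Icc (-(n : ℝ)) n).indicator 1 (p.1 - p.2)
  have hw0 : ∀ n p, 0 ≤ w n p := fun n p =>
    mul_nonneg (abs_nonneg _) (Set.indicator_nonneg (fun _ _ => zero_le_one) _)
  have hwm : ∀ n, Measurable (w n) := fun n =>
    hδ.abs.mul ((measurable_one.indicator (hB.inter measurableSet_Icc)).comp hδ)
  have hwi : ∀ n, Integrable (w n) (G.measure Y) := fun n => by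
    refine Integrable.of_bound (hwm n).aestronglyMeasurable n (Eventually.of_forall fun p => ?_)
    rw [Real.norm_of_nonneg (hw0 n p)]
    by_cases hp : p.1 - p.2 ∈ B ∩ Set.Icc (-(n : ℝ)) n
    · simp only [w, Set.indicator_of_mem hp, Pi.one_apply, mul_one]
      exact abs_le.2 hp.2
    · simp [w, Set.indicator_of_notMem hp]
  simp only [fun n => G.inner_cutoff hT hY hB n, Complex.ofReal_re]
  rw [show (∫⁻ p, ENNReal.ofReal |p.1 - p.2| * B.indicator 1 (p.1 - p.2) ∂(G.measure Y)) =
    ∫⁻ p, ⨆ n, ENNReal.ofReal (w n p) ∂(G.measure Y) from lintegral_congr fun p => ?_]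
  · rw [lintegral_iSup (fun n => (hwm n).ennreal_ofReal), ENNReal.mul_iSup]
    · refine iSup_congr fun n => ?_
      rw [ENNReal.ofReal_mul Real.pi_pos.le, ofReal_integral_eq_lintegral_ofReal (hwi n)
        (Eventually.of_forall (hw0 n))]
    · intro m n hmn p
      refine ENNReal.ofReal_le_ofReal (mul_le_mul_of_nonneg_left ?_ (abs_nonneg _))
      refine Set.indicator_le_indicator_of_subset (Set.inter_subset_inter_right _ ?_)
        (fun _ => zero_le_one) _
      have : (m : ℝ) ≤ n := by exact_mod_cast hmn
      exact Set.Icc_subset_Icc (neg_le_neg this) this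
  · refine le_antisymm ?_ (iSup_le fun n => ?_)
    · obtain ⟨n, hn⟩ := exists_nat_ge |p.1 - p.2|
      refine le_iSup_of_le n ?_
      by_cases hp : p.1 - p.2 ∈ B
      · have : p.1 - p.2 ∈ B ∩ Set.Icc (-(n : ℝ)) n := ⟨hp, abs_le.1 hn⟩
        simp [w, Set.indicator_of_mem hp, Set.indicator_of_mem this]
      · simp [Set.indicator_of_notMem hp]
    · by_cases hp : p.1 - p.2 ∈ B ∩ Set.Icc (-(n : ℝ)) n
      · simp [w, Set.indicator_of_mem hp, Set.indicator_of_mem hp.1]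
      · simp [w, Set.indicator_of_notMem hp]

/-- Because the Fermi sign is unimodular almost everywhere, membership of 𝒫Y in the domain says that
λ₁ - λ₂ is square integrable, hence integrable for a finite measure. -/
theorem PVM.integrable_of_mem_domain
    (hT : IsSpectralMeasure (G.map (fun p : ℝ × ℝ => p.1 - p.2) (by fun_prop)) T)
    (hY : G.measure Y (oppositeSides e)ᶜ = 0) (h : G.integral (fermiSign e) Y ∈ T.domain) :
    Integrable (fun p : ℝ × ℝ => |p.1 - p.2|) (G.measure Y) := by
  have hδ : Measurable fun p : ℝ × ℝ => p.1 - p.2 := by fun_prop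
  have hae : ∀ᵐ p ∂(G.measure Y), p ∈ oppositeSides e := hY
  have h1 := (hT.1 _).1 h
  rw [G.measure_map hδ, lintegral_map (by fun_prop) hδ, G.measure_integral (isBddMeas_fermiSign e),
    lintegral_withDensity_eq_lintegral_mul _
      ((isBddMeas_fermiSign e).measurable.enorm.pow_const 2) (by fun_prop)] at h1
  have h2 : ∫⁻ p, ‖p.1 - p.2‖ₑ ^ 2 ∂(G.measure Y) < ∞ := by
    refine lt_of_le_of_lt (lintegral_mono_ae ?_) h1
    filter_upwards [hae] with p hp
    rw [Pi.mul_apply, enorm_fermiSign hp]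
    simp
  have h3 : MemLp (fun p : ℝ × ℝ => p.1 - p.2) 2 (G.measure Y) := by
    refine ⟨hδ.aestronglyMeasurable, ?_⟩
    have h4 : eLpNorm (fun p : ℝ × ℝ => p.1 - p.2) 2 (G.measure Y) ^ 2 =
        ∫⁻ p, ‖p.1 - p.2‖ₑ ^ 2 ∂(G.measure Y) := by
      have := eLpNorm_nnreal_pow_eq_lintegral (p := 2) (f := fun p : ℝ × ℝ => p.1 - p.2)
        (μ := G.measure Y) (by norm_num)
      simpa using this
    rw [← h4] at h2
    exact (ENNReal.pow_lt_top_iff.1 h2).resolve_right (by norm_num)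
  exact (h3.integrable (by norm_num)).abs

/-- The generator is evaluated as the limit of difference quotients of its group. Under the scalar
product these become integrals dominated by |λ₁ - λ₂|, which is integrable by the previous lemma. -/
theorem PVM.inner_proj_generator
    (hT : IsSpectralMeasure (G.map (fun p : ℝ × ℝ => p.1 - p.2) (by fun_prop)) T)
    (hY : G.measure Y (oppositeSides e)ᶜ = 0) (h : G.integral (fermiSign e) Y ∈ T.domain) {B : Set ℝ}
    (hB : MeasurableSet B) :
    ⟪Y, (spectralMeasure T).proj B (-T ⟨G.integral (fermiSign e) Y, h⟩)⟫_ℂ =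
      ((∫ p, |p.1 - p.2| * B.indicator 1 (p.1 - p.2) ∂(G.measure Y) : ℝ) : ℂ) := by
  have hδ : Measurable fun p : ℝ × ℝ => p.1 - p.2 := by fun_prop
  have hae : ∀ᵐ p ∂(G.measure Y), p ∈ oppositeSides e := hY
  have hint := G.integrable_of_mem_domain hT hY h
  have hs := isBddMeas_fermiSign e
  have hBb : IsBddMeas (B.indicator (1 : ℝ → ℂ)) := IsBddMeas.indicator_one hB
  rw [hT.spectralMeasure_eq, ← PVM.integral_indicator _ hB, G.integral_map hδ hBb]
  set D := G.map (fun p : ℝ × ℝ => p.1 - p.2) hδ with hD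
  have hTe := hT.operator_unique D.isSpectralMeasure_stoneGenerator
  subst hTe
  set v := G.integral (fermiSign e) Y with hv
  have hd : DifferentiableAt ℝ (fun t => D.unitary t v) 0 := h
  have hd' := hd.hasDerivAt
  change ⟪Y, G.integral (fun p => B.indicator 1 (p.1 - p.2))
    (-(Complex.I • deriv (fun t => D.unitary t v) 0))⟫_ℂ = _
  set W := G.integral fun p : ℝ × ℝ => B.indicator (1 : ℝ → ℂ) (p.1 - p.2)
  rw [hasDerivAt_iff_tendsto_slope_zero] at hd'
  let q : ℝ → ℝ → ℂ := fun t => (t : ℂ)⁻¹ • ((fun l : ℝ => Complex.exp (-Complex.I * t * l)) - 1)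
  have hq : ∀ t : ℝ, IsBddMeas (q t) := fun t => ((isBddMeas_exp t).sub IsBddMeas.one).smul _
  have l1 : Tendsto (fun t : ℝ => ⟪Y, W (-(Complex.I • t⁻¹ • (D.unitary (0 + t) v -
      D.unitary 0 v)))⟫_ℂ) (𝓝[≠] 0) (𝓝 ⟪Y, W (-(Complex.I • deriv (fun t => D.unitary t v) 0))⟫_ℂ) :=
    tendsto_const_nhds.inner ((W.continuous.tendsto _).comp ((hd'.const_smul Complex.I).neg))
  refine tendsto_nhds_unique l1 ?_
  let k : ℝ → ℝ × ℝ → ℂ := fun t =>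
    (fun p => B.indicator (1 : ℝ → ℂ) (p.1 - p.2)) *
      ((-Complex.I) • ((fun p => q t (p.1 - p.2)) * fermiSign e))
  have hkb : ∀ t, IsBddMeas (k t) := fun t =>
    (hBb.comp hδ).mul ((((hq t).comp hδ).mul hs).smul _)
  have hk : ∀ t : ℝ, ⟪Y, W (-(Complex.I • t⁻¹ • (D.unitary (0 + t) v - D.unitary 0 v)))⟫_ℂ =
      ∫ p, k t p ∂(G.measure Y) := fun t => by
    rw [← G.inner_integral (hkb t), G.integral_mul_apply (hBb.comp hδ)
      ((((hq t).comp hδ).mul hs).smul _), G.integral_smul _ (((hq t).comp hδ).mul hs), smul_apply,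
      G.integral_mul_apply ((hq t).comp hδ) hs, ← G.integral_map hδ (hq t), zero_add, D.unitary_zero,
      one_apply_eq_self, D.slope_unitary, neg_smul]
  refine Tendsto.congr (fun t => (hk t).symm) ?_
  rw [← integral_complex_ofReal]
  refine tendsto_integral_filter_of_dominated_convergence (fun p => |p.1 - p.2|)
    (Eventually.of_forall fun t => (hkb t).measurable.aestronglyMeasurable)
    (Eventually.of_forall fun t => ?_) hint ?_
  · filter_upwards [hae] with p hp
    have h1 : ‖B.indicator (1 : ℝ → ℂ) (p.1 - p.2)‖ ≤ 1 :=
      (norm_indicator_le_norm_self _ _).trans (by simp)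
    have h2 : ‖fermiSign e p‖ = 1 := by
      have := enorm_fermiSign hp
      rw [← toReal_enorm, this, ENNReal.toReal_one]
    simp only [k, Pi.mul_apply, Pi.smul_apply, smul_eq_mul, norm_mul, norm_neg, Complex.norm_I,
      one_mul, h2, mul_one]
    calc _ ≤ 1 * ‖q t (p.1 - p.2)‖ := mul_le_mul_of_nonneg_right h1 (norm_nonneg _)
      _ ≤ _ := by rw [one_mul]; exact norm_slope_le t _
  · filter_upwards [hae] with p hp
    have h1 := ((tendsto_exp_slope (p.1 - p.2)).mul_const (fermiSign e p)).const_mul (-Complex.I)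
    have h2 := h1.const_mul (B.indicator (1 : ℝ → ℂ) (p.1 - p.2))
    have h3 := sub_mul_fermiSign hp
    have h4 : B.indicator (1 : ℝ → ℂ) (p.1 - p.2) * (-Complex.I *
        (-Complex.I * ((p.1 - p.2 : ℝ) : ℂ) * fermiSign e p)) =
        ((|p.1 - p.2| * B.indicator 1 (p.1 - p.2) : ℝ) : ℂ) := by
      have h5 : -Complex.I * (-Complex.I * ((p.1 - p.2 : ℝ) : ℂ) * fermiSign e p) =
          -((p.1 - p.2 : ℝ) : ℂ) * fermiSign e p := by
        linear_combination ((p.1 - p.2 : ℝ) : ℂ) * fermiSign e p * Complex.I_sq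
      rw [h5, h3]
      by_cases hpB : p.1 - p.2 ∈ B <;> simp [hpB]
    rw [h4] at h2
    exact h2

/-- The vector and the measure enter through equations so that they can be substituted although the
domain proof depends on the vector. -/
theorem PVM.integrable_and_inner_proj_generator
    (hT : IsSpectralMeasure (G.map (fun p : ℝ × ℝ => p.1 - p.2) (by fun_prop)) T)
    (hY : G.measure Y (oppositeSides e)ᶜ = 0) {v : K} (hv : v = G.integral (fermiSign e) Y)
    {μ : Measure (ℝ × ℝ)} (hμ : μ = G.measure Y) : ∀ h : v ∈ T.domain,
      Integrable (fun p : ℝ × ℝ => |p.1 - p.2|) μ ∧ ∀ B : Set ℝ, MeasurableSet B →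
        Real.pi * ⟪Y, (spectralMeasure T).proj B (-T ⟨v, h⟩)⟫_ℂ =
          ((Real.pi * ∫ p, |p.1 - p.2| * B.indicator 1 (p.1 - p.2) ∂μ : ℝ) : ℂ) := by
  subst hv hμ
  refine fun h => ⟨G.integrable_of_mem_domain hT hY h, fun B hB => ?_⟩
  rw [G.inner_proj_generator hT hY h hB, Complex.ofReal_mul]

end Liouvillian

/-! ## Hilbert-Schmidt norms -/

section HilbertSchmidt

variable {ι K : Type*} [NormedAddCommGroup K] [InnerProductSpace ℂ K] (b : HilbertBasis ι ℂ K)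

theorem tsum_enorm_inner_sq (x : K) : ∑' i, ‖⟪b i, x⟫_ℂ‖ₑ ^ 2 = ‖x‖ₑ ^ 2 := by
  have h := Complex.hasSum_re (b.hasSum_inner_mul_inner x x)
  have e : ∀ i, (⟪x, b i⟫_ℂ * ⟪b i, x⟫_ℂ).re = ‖⟪b i, x⟫_ℂ‖ ^ 2 := fun i => by
    rw [← inner_conj_symm, mul_comm, Complex.mul_conj, Complex.ofReal_re, Complex.normSq_eq_norm_sq]
  simp only [e] at h
  rw [inner_self_eq_ofReal, Complex.ofReal_re] at h
  have h2 := ENNReal.ofReal_tsum_of_nonneg (fun _ => by positivity) h.summable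
  rw [h.tsum_eq] at h2
  simpa [ENNReal.ofReal_pow, ofReal_norm] using h2.symm

/-- The square of the Hilbert-Schmidt norm. -/
def hsSq (T : K →L[ℂ] K) : ℝ≥0∞ := ∑' i, ‖T (b i)‖ₑ ^ 2

theorem hsSq_mono {S T : K →L[ℂ] K} (h : ∀ x, ‖S x‖ ≤ ‖T x‖) : hsSq b S ≤ hsSq b T :=
  ENNReal.tsum_le_tsum fun _ => pow_le_pow_left' (enorm_le_iff_norm_le.2 (h _)) 2

theorem hsSq_congr {S T : K →L[ℂ] K} (h : ∀ x, ‖S x‖ = ‖T x‖) : hsSq b S = hsSq b T :=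
  le_antisymm (hsSq_mono b fun x => (h x).le) (hsSq_mono b fun x => (h x).ge)

variable [CompleteSpace K]

/-- Both are double sums of squared matrix elements, with the order of summation exchanged. -/
theorem hsSq_adjoint (T : K →L[ℂ] K) : hsSq b T.adjoint = hsSq b T := by
  simp only [hsSq]
  simp only [← tsum_enorm_inner_sq b (T.adjoint _), ← tsum_enorm_inner_sq b (T _)]
  rw [ENNReal.tsum_comm]
  refine tsum_congr fun i => tsum_congr fun j => ?_
  rw [ContinuousLinearMap.adjoint_inner_right, ← inner_conj_symm, RCLike.enorm_conj]

theorem enorm_apply_sq_le_hsSq (T : K →L[ℂ] K) (x : K) : ‖T x‖ₑ ^ 2 ≤ hsSq b T * ‖x‖ₑ ^ 2 := by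
  rw [← tsum_enorm_inner_sq b, ← hsSq_adjoint, hsSq, ← ENNReal.tsum_mul_right]
  refine ENNReal.tsum_le_tsum fun i => ?_
  rw [← ContinuousLinearMap.adjoint_inner_left, ← mul_pow]
  refine pow_le_pow_left' ?_ 2
  rw [← ofReal_norm, ← ofReal_norm, ← ofReal_norm, ← ENNReal.ofReal_mul (norm_nonneg _)]
  exact ENNReal.ofReal_le_ofReal (norm_inner_le_norm _ _)

/-- Cauchy-Schwarz in extended nonnegative reals, so that infinite Hilbert-Schmidt norms need no
separate treatment. -/
theorem enorm_sum_sq_le {α F : Type*} [NormedAddCommGroup F] (s : Finset α) {x : α → F}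
    {h v : α → ℝ≥0∞} (hx : ∀ a, ‖x a‖ₑ ^ 2 ≤ h a * v a ^ 2) :
    ‖∑ a ∈ s, x a‖ₑ ^ 2 ≤ (∑ a ∈ s, h a) * ∑ a ∈ s, v a ^ 2 := by
  have e : ∀ z : ℝ≥0∞, (z ^ (1 / 2 : ℝ)) ^ 2 = z := fun z => by
    rw [← ENNReal.rpow_natCast, ← ENNReal.rpow_mul]
    norm_num
  have h1 : ∀ a, ‖x a‖ₑ ≤ h a ^ (1 / 2 : ℝ) * v a := fun a => by
    refine (ENNReal.pow_le_pow_left_iff two_ne_zero).1 ?_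
    rw [mul_pow, e]
    exact hx a
  have h2 := ENNReal.inner_le_Lp_mul_Lq s (fun a => h a ^ (1 / 2 : ℝ)) v
    (Real.HolderConjugate.two_two)
  simp only [ENNReal.rpow_two, e] at h2
  have h3 := pow_le_pow_left' (((enorm_sum_le s x).trans (Finset.sum_le_sum fun a _ => h1 a)).trans h2) 2
  rwa [mul_pow, e, e] at h3

/-- After passing to adjoints the unitary acts on the outside and preserves norms, so no change of
basis is needed. -/
theorem hsSq_comp_isometry (T : K →L[ℂ] K) (V : K ≃ₗᵢ[ℂ] K) :
    hsSq b (T.comp (V : K →L[ℂ] K)) = hsSq b T := by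
  rw [← hsSq_adjoint, ← hsSq_adjoint b T]
  refine hsSq_congr b fun x => ?_
  rw [ContinuousLinearMap.adjoint_comp]
  have h : ((V : K →L[ℂ] K)).adjoint = (V.symm : K →L[ℂ] K) := by
    refine (ContinuousLinearMap.eq_adjoint_iff _ _).2 (fun x y => ?_) |>.symm
    change ⟪V.symm x, y⟫_ℂ = ⟪x, V y⟫_ℂ
    rw [← V.inner_map_map, V.apply_symm_apply]
  rw [h]
  exact V.symm.norm_map _

end HilbertSchmidt

/-! ## Unit cubes -/

namespace ConfigSpace

variable {d : ℕ} (C : ConfigSpace d)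

/-- The cube of a point is found by rounding its coordinates, which makes disjointness and covering
of the half-open cubes immediate. -/
theorem mem_cell_iff (a : Fin d → ℤ) (x : C.Pt) :
    x ∈ C.cell a ↔ ∀ j, ⌊C.pos x j + 1 / 2⌋ = a j := by
  refine forall_congr' fun j => ?_
  rw [Int.floor_eq_iff]
  constructor <;> rintro ⟨h1, h2⟩ <;> constructor <;> linarith

theorem pairwise_disjoint_cell : Pairwise (Function.onFun Disjoint C.cell) := by
  intro a b hab
  rw [Function.onFun, Set.disjoint_left]
  intro x ha hb
  exact hab (funext fun j => ((C.mem_cell_iff a x).1 ha j).symm.trans ((C.mem_cell_iff b x).1 hb j))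

theorem iUnion_cell : ⋃ a, C.cell a = Set.univ :=
  Set.eq_univ_of_forall fun x => Set.mem_iUnion.2 ⟨_, (C.mem_cell_iff _ x).2 fun _ => rfl⟩

theorem coeFn_chi (a : Fin d → ℤ) (f : C.Hil) :
    C.chi a f =ᵐ[C.vol] (C.cell a).indicator f := C.coeFn_restrict _ _ f

theorem enorm_sq_eq_lintegral (f : C.Hil) : ‖f‖ₑ ^ 2 = ∫⁻ x, ‖f x‖ₑ ^ 2 ∂C.vol := by
  have := eLpNorm_nnreal_pow_eq_lintegral (p := 2) (f := f) (μ := C.vol) (by norm_num)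
  rw [Lp.enorm_def]
  simpa using this

theorem enorm_chi_sq (a : Fin d → ℤ) (f : C.Hil) :
    ‖C.chi a f‖ₑ ^ 2 = ∫⁻ x in C.cell a, ‖f x‖ₑ ^ 2 ∂C.vol := by
  rw [C.enorm_sq_eq_lintegral, ← lintegral_indicator (C.measurableSet_cell a)]
  refine lintegral_congr_ae ?_
  filter_upwards [C.coeFn_chi a f] with x hx
  rw [hx]
  by_cases h : x ∈ C.cell a <;> simp [h]

theorem tsum_enorm_chi_sq (f : C.Hil) : ∑' a, ‖C.chi a f‖ₑ ^ 2 = ‖f‖ₑ ^ 2 := by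
  simp only [C.enorm_chi_sq]
  rw [← lintegral_iUnion C.measurableSet_cell C.pairwise_disjoint_cell, C.iUnion_cell,
    setLIntegral_univ, C.enorm_sq_eq_lintegral]

theorem enorm_chi_le (a : Fin d → ℤ) (f : C.Hil) : ‖C.chi a f‖ₑ ≤ ‖f‖ₑ := by
  have h : ‖C.chi a f‖ₑ ^ 2 ≤ ‖f‖ₑ ^ 2 := by
    rw [← C.tsum_enorm_chi_sq f]
    exact ENNReal.le_tsum a
  exact (ENNReal.pow_le_pow_left_iff two_ne_zero).1 h

theorem norm_chi_le (a : Fin d → ℤ) (f : C.Hil) : ‖C.chi a f‖ ≤ ‖f‖ :=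
  enorm_le_iff_norm_le.1 (C.enorm_chi_le a f)

/-- `χ_a` as a bounded operator. -/
def chiL (a : Fin d → ℤ) : C.Hil →L[ℂ] C.Hil :=
  (C.chi a).mkContinuous 1 fun f => by simpa using C.norm_chi_le a f

@[simp]
theorem chiL_apply (a : Fin d → ℤ) (f : C.Hil) : C.chiL a f = C.chi a f := rfl

@[simp]
theorem coe_chiHc (a : Fin d → ℤ) (f : C.Hil) : (C.chiHc a f : C.Hil) = C.chi a f := rfl

theorem inner_chi (a : Fin d → ℤ) (f g : C.Hil) : ⟪C.chi a f, g⟫_ℂ = ⟪f, C.chi a g⟫_ℂ := by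
  rw [L2.inner_def, L2.inner_def]
  refine integral_congr_ae ?_
  filter_upwards [C.coeFn_chi a f, C.coeFn_chi a g] with x h1 h2
  rw [h1, h2]
  by_cases h : x ∈ C.cell a <;> simp [h]

theorem chi_chi_self (a : Fin d → ℤ) (f : C.Hil) : C.chi a (C.chi a f) = C.chi a f := by
  refine Lp.ext ?_
  filter_upwards [C.coeFn_chi a f, C.coeFn_chi a (C.chi a f)] with x h1 h2
  rw [h2]
  by_cases h : x ∈ C.cell a <;> simp [h, h1]

theorem chi_chi_of_ne {a b : Fin d → ℤ} (hab : a ≠ b) (f : C.Hil) : C.chi a (C.chi b f) = 0 := by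
  refine Lp.ext ?_
  filter_upwards [C.coeFn_chi b f, C.coeFn_chi a (C.chi b f), Lp.coeFn_zero ℂ 2 C.vol] with x h1 h2 h3
  rw [h2, h3]
  by_cases h : x ∈ C.cell a
  · have h' : x ∉ C.cell b := Set.disjoint_left.1 (C.pairwise_disjoint_cell hab) h
    simp [h, h1, h']
  · simp [h]

theorem chiHc_chi_self (a : Fin d → ℤ) (f : C.Hil) : C.chiHc a (C.chi a f) = C.chiHc a f :=
  Subtype.ext (C.chi_chi_self a f)

theorem chiHc_chi_of_ne {a b : Fin d → ℤ} (hab : a ≠ b) (f : C.Hil) : C.chiHc a (C.chi b f) = 0 :=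
  Subtype.ext (C.chi_chi_of_ne hab f)

theorem ext_chi {f g : C.Hil} (h : ∀ a, C.chi a f = C.chi a g) : f = g := by
  have h2 := C.tsum_enorm_chi_sq (f - g)
  simp only [map_sub, h, sub_self, enorm_zero] at h2
  rw [tsum_congr fun _ => zero_pow two_ne_zero, tsum_zero, eq_comm, pow_eq_zero_iff two_ne_zero,
    enorm_eq_zero, sub_eq_zero] at h2
  exact h2

theorem eq_sum_chi {f : C.Hil} {s : Finset (Fin d → ℤ)} (hs : ∀ a ∉ s, C.chi a f = 0) :
    f = ∑ a ∈ s, C.chi a f := by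
  refine C.ext_chi fun b => ?_
  rw [map_sum]
  by_cases hb : b ∈ s
  · rw [Finset.sum_eq_single_of_mem b hb fun a _ hab => C.chi_chi_of_ne hab.symm f, C.chi_chi_self]
  · rw [hs b hb, Finset.sum_eq_zero fun a ha => C.chi_chi_of_ne (fun e : b = a => hb (by rwa [e])) f]

theorem exists_finset_of_mem_Hc {f : C.Hil} (hf : f ∈ C.Hc) :
    ∃ s : Finset (Fin d → ℤ), ∀ a ∉ s, C.chi a f = 0 := by
  obtain ⟨R, hR⟩ := hf
  -- A cube outside the index box has a coordinate of absolute value at least N + 1/2 at all of its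
  -- points, beyond the radius `R`.
  obtain ⟨N, hN⟩ := exists_nat_ge (R + 1)
  refine ⟨Fintype.piFinset fun _ => Finset.Icc (-(N : ℤ)) N, fun a ha => ?_⟩
  simp only [Fintype.mem_piFinset, Finset.mem_Icc, not_forall] at ha
  obtain ⟨j, hj⟩ := ha
  refine Lp.ext ?_
  filter_upwards [hR, C.coeFn_chi a f, Lp.coeFn_zero ℂ 2 C.vol] with x h1 h2 h3
  rw [h2, h3]
  by_cases hx : x ∈ C.cell a
  · rw [Set.indicator_of_mem hx, h1]
    · rfl
    refine lt_of_lt_of_le ?_ (norm_le_pi_norm (C.pos x) j)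
    have hx' := hx j
    rw [Real.norm_eq_abs, lt_abs]
    by_cases h4 : -(N : ℤ) ≤ a j
    · have h5 : (N : ℤ) + 1 ≤ a j := by
        by_contra h
        exact hj ⟨h4, by omega⟩
      have h6 : (N : ℝ) + 1 ≤ a j := by exact_mod_cast h5
      left
      linarith [hx'.1]
    · have h5 : a j ≤ -(N : ℤ) - 1 := by omega
      have h6 : (a j : ℝ) ≤ -(N : ℝ) - 1 := by exact_mod_cast h5
      right
      linarith [hx'.2]
  · rw [Set.indicator_of_notMem hx]
    rfl

theorem mem_Hc_of_finset {f : C.Hil} {s : Finset (Fin d → ℤ)} (hs : ∀ a ∉ s, C.chi a f = 0) :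
    f ∈ C.Hc := by
  rw [C.eq_sum_chi hs]
  exact Submodule.sum_mem _ fun a _ => C.chi_mem a f

theorem eq_sum_chiHc {f : C.Hc} {s : Finset (Fin d → ℤ)} (hs : ∀ a ∉ s, C.chi a f = 0) :
    f = ∑ a ∈ s, C.chiHc a f := by
  refine Subtype.ext ?_
  rw [Submodule.coe_sum]
  exact C.eq_sum_chi hs

theorem eq_of_inner_Hc {x y : C.Hil} (h : ∀ f : C.Hc, ⟪x, (f : C.Hil)⟫_ℂ = ⟪y, (f : C.Hil)⟫_ℂ) :
    x = y :=
  C.dense_hc.eq_of_inner_left ℂ fun v hv => h ⟨v, hv⟩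

/-- A linear map on the functions of compact support is determined on the unit cubes. -/
theorem linearMap_ext_chiHc {M : Type*} [AddCommGroup M] [Module ℂ M] {A B : C.Hc →ₗ[ℂ] M}
    (h : ∀ a f, A (C.chiHc a f) = B (C.chiHc a f)) : A = B := by
  refine LinearMap.ext fun f => ?_
  obtain ⟨s, hs⟩ := C.exists_finset_of_mem_Hc f.2
  rw [C.eq_sum_chiHc hs, map_sum, map_sum]
  exact Finset.sum_congr rfl fun a _ => h a f

/-! ### Columns of locally bounded operators -/

/-- `A χ_a` is bounded for all `a`. -/
def ColBdd (A : C.Hc →ₗ[ℂ] C.Hil) : Prop :=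
  ∀ a, ∃ M : ℝ, ∀ f : C.Hil, ‖A (C.chiHc a f)‖ ≤ M * ‖f‖

/-- `χ_a A` is bounded for all `a`. -/
def RowBdd (A : C.Hc →ₗ[ℂ] C.Hil) : Prop :=
  ∀ a, ∃ M : ℝ, ∀ f : C.Hc, ‖C.chi a (A f)‖ ≤ M * ‖f‖

/-- The operator `A χ_a`, when it is bounded. -/
def col (A : C.Hc →ₗ[ℂ] C.Hil) (a : Fin d → ℤ) : C.Hil →L[ℂ] C.Hil := by
  classical
  exact if h : ∃ M : ℝ, ∀ f : C.Hil, ‖A (C.chiHc a f)‖ ≤ M * ‖f‖ then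
    (A.comp (C.chiHc a)).mkContinuousOfExistsBound h else 0

variable {C}

theorem ColBdd.col_apply {A : C.Hc →ₗ[ℂ] C.Hil} (hA : C.ColBdd A) (a : Fin d → ℤ) (f : C.Hil) :
    C.col A a f = A (C.chiHc a f) := by
  rw [col, dif_pos (hA a)]
  rfl

theorem ColBdd.sub {A B : C.Hc →ₗ[ℂ] C.Hil} (hA : C.ColBdd A) (hB : C.ColBdd B) :
    C.ColBdd (A - B) := fun a => by
  obtain ⟨M, hM⟩ := hA a
  obtain ⟨N, hN⟩ := hB a
  refine ⟨M + N, fun f => ?_⟩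
  rw [LinearMap.sub_apply, add_mul]
  exact (norm_sub_le _ _).trans (add_le_add (hM f) (hN f))

theorem ColBdd.hsSq_col {A : C.Hc →ₗ[ℂ] C.Hil} (hA : C.ColBdd A) (a : Fin d → ℤ) :
    hsSq C.basis (C.col A a) = ∑' i, ‖A (C.chiHc a (C.basis i))‖ₑ ^ 2 := by
  simp only [hsSq, hA.col_apply]

/-- The Hilbert-Schmidt norms of the blocks in a row bound the row. -/
theorem ColBdd.enorm_chi_sq_le {A : C.Hc →ₗ[ℂ] C.Hil} (hA : C.ColBdd A) (b : Fin d → ℤ) (f : C.Hc) :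
    ‖C.chi b (A f)‖ₑ ^ 2 ≤
      (∑' a, hsSq C.basis ((C.chiL b).comp (C.col A a))) * ‖(f : C.Hil)‖ₑ ^ 2 := by
  obtain ⟨s, hs⟩ := C.exists_finset_of_mem_Hc f.2
  have h1 : C.chi b (A f) = ∑ a ∈ s, (C.chiL b).comp (C.col A a) (C.chi a f) := by
    conv_lhs => rw [C.eq_sum_chiHc hs, map_sum, map_sum]
    refine Finset.sum_congr rfl fun a _ => ?_
    rw [ContinuousLinearMap.comp_apply, hA.col_apply, C.chiHc_chi_self]
    rfl
  rw [h1]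
  refine (enorm_sum_sq_le s fun a => enorm_apply_sq_le_hsSq C.basis _ _).trans ?_
  refine mul_le_mul' (ENNReal.sum_le_tsum s) ?_
  rw [← C.tsum_enorm_chi_sq]
  exact ENNReal.sum_le_tsum s

end ConfigSpace

/-! ## Covariant operators -/

namespace ErgodicOperator

section Translations

variable {d : ℕ} {C : ConfigSpace d} {Ω : Type*} [MeasurableSpace Ω] [AddAction (Fin d → ℤ) Ω]
  {P : Measure Ω} (S : ErgodicOperator C Ω P)

theorem chi_U (a b : Fin d → ℤ) (f : C.Hil) : C.chi b (S.U a f) = S.U a (C.chi (b - a) f) := by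
  rw [S.U_chi, sub_add_cancel]

theorem chi_U_symm (a b : Fin d → ℤ) (f : C.Hil) :
    C.chi b ((S.U a).symm f) = (S.U a).symm (C.chi (b + a) f) := by
  rw [LinearIsometryEquiv.eq_symm_apply, S.U_chi, LinearIsometryEquiv.apply_symm_apply]

theorem U_mem (a : Fin d → ℤ) {f : C.Hil} (hf : f ∈ C.Hc) : S.U a f ∈ C.Hc := by
  classical
  obtain ⟨s, hs⟩ := C.exists_finset_of_mem_Hc hf
  refine C.mem_Hc_of_finset (s := s.image fun b => b + a) fun b hb => ?_
  rw [S.chi_U, hs, map_zero]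
  exact fun h => hb (Finset.mem_image.2 ⟨_, h, sub_add_cancel b a⟩)

theorem U_symm_mem (a : Fin d → ℤ) {f : C.Hil} (hf : f ∈ C.Hc) : (S.U a).symm f ∈ C.Hc := by
  classical
  obtain ⟨s, hs⟩ := C.exists_finset_of_mem_Hc hf
  refine C.mem_Hc_of_finset (s := s.image fun b => b - a) fun b hb => ?_
  rw [S.chi_U_symm, hs, map_zero]
  exact fun h => hb (Finset.mem_image.2 ⟨_, h, add_sub_cancel_right b a⟩)

end Translations

variable {d : ℕ} {C : ConfigSpace d} {Ω : Type*} [MeasurableSpace Ω] [AddAction (Fin d → ℤ) Ω]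
  {P : Measure Ω} {S : ErgodicOperator C Ω P} {A B : Ω → C.Hc →ₗ[ℂ] C.Hil}

theorem IsCovariantOp.apply_U (hA : S.IsCovariantOp A) (a : Fin d → ℤ) : ∀ᵐ ω ∂P, ∀ f : C.Hc,
    A (a +ᵥ ω) ⟨S.U a f, S.U_mem a f.2⟩ = S.U a (A ω f) := by
  filter_upwards [hA a] with ω h f
  exact h f _ rfl

theorem IsMeasurableOp.aemeasurable_hsSq (hA : S.IsMeasurableOp A) (hb : ∀ᵐ ω ∂P, C.ColBdd (A ω))
    (b a : Fin d → ℤ) :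
    AEMeasurable (fun ω => hsSq C.basis ((C.chiL b).comp (C.col (A ω) a))) P := by
  have h : AEMeasurable (fun ω => ∑' i, ‖C.chiL b (A ω (C.chiHc a (C.basis i)))‖ₑ ^ 2) P :=
    AEMeasurable.tsum fun i => ((C.chiL b).continuous.comp_aestronglyMeasurable
      (hA.aestronglyMeasurable _)).enorm.pow_const 2
  refine h.congr ?_
  filter_upwards [hb] with ω hω
  simp only [hsSq, ContinuousLinearMap.comp_apply, hω.col_apply]

/-- Covariance makes the block from cube a to cube 0 at the translated point a unitary conjugate of
the block from cube 0 to cube -a. -/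
theorem hsSq_block_vadd {A A' : C.Hc →ₗ[ℂ] C.Hil} (hA : C.ColBdd A) (hA' : C.ColBdd A')
    {a : Fin d → ℤ} (h : ∀ f : C.Hc, A' ⟨S.U a f, S.U_mem a f.2⟩ = S.U a (A f)) :
    hsSq C.basis ((C.chiL 0).comp (C.col A' a)) = hsSq C.basis ((C.chiL (-a)).comp (C.col A 0)) := by
  rw [← hsSq_comp_isometry C.basis _ (S.U a)]
  refine hsSq_congr C.basis fun f => ?_
  have h1 : C.chiHc a (S.U a f) = ⟨S.U a (C.chiHc 0 f), S.U_mem a (C.chiHc 0 f).2⟩ :=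
    Subtype.ext (by simp only [C.coe_chiHc, S.chi_U, sub_self])
  have h2 : ((C.chiL 0).comp (C.col A' a)).comp (S.U a : C.Hil →L[ℂ] C.Hil) f =
      C.chi 0 (C.col A' a (S.U a f)) := rfl
  rw [h2, hA'.col_apply, h1, h, S.chi_U, LinearIsometryEquiv.norm_map, zero_sub,
    ContinuousLinearMap.comp_apply, hA.col_apply, C.chiL_apply]

variable [MeasurableConstVAdd (Fin d → ℤ) Ω] [ErgodicVAdd (Fin d → ℤ) Ω P]

omit S C in
theorem ae_vadd (a : Fin d → ℤ) {p : Ω → Prop} (h : ∀ᵐ ω ∂P, p ω) : ∀ᵐ ω ∂P, p (a +ᵥ ω) :=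
  (measurePreserving_vadd a P).quasiMeasurePreserving.ae h

omit S C in
theorem lintegral_vadd (a : Fin d → ℤ) (f : Ω → ℝ≥0∞) : ∫⁻ ω, f (a +ᵥ ω) ∂P = ∫⁻ ω, f ω ∂P :=
  (measurePreserving_vadd a P).lintegral_comp_emb (measurableEmbedding_const_vadd a) f

/-- The row of a covariant operator has the same expected Hilbert-Schmidt norm as the column. -/
theorem lintegral_row (hm : S.IsMeasurableOp A) (hc : S.IsCovariantOp A)
    (hb : ∀ᵐ ω ∂P, C.ColBdd (A ω)) :
    ∫⁻ ω, ∑' a, hsSq C.basis ((C.chiL 0).comp (C.col (A ω) a)) ∂P = S.hsNormSq A := by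
  have h1 : S.hsNormSq A = ∫⁻ ω, ∑' b, hsSq C.basis ((C.chiL b).comp (C.col (A ω) 0)) ∂P := by
    refine lintegral_congr_ae ?_
    filter_upwards [hb] with ω hω
    simp only [hsSq, ContinuousLinearMap.comp_apply, hω.col_apply]
    rw [ENNReal.tsum_comm]
    exact tsum_congr fun i => (C.tsum_enorm_chi_sq _).symm
  rw [h1, lintegral_tsum fun b => hm.aemeasurable_hsSq hb b 0,
    lintegral_tsum fun a => hm.aemeasurable_hsSq hb 0 a, ← (Equiv.neg (Fin d → ℤ)).tsum_eq]
  refine tsum_congr fun a => ?_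
  -- Invariance of the probability measure turns each row block into a column block, after the
  -- relabelling a ↦ -a.
  rw [← lintegral_vadd (P := P) (-a)]
  refine lintegral_congr_ae ?_
  filter_upwards [hb, ae_vadd (-a) hb, hc.apply_U (-a)] with ω h2 h3 h4
  rw [Equiv.neg_apply, hsSq_block_vadd h2 h3 h4, neg_neg]

/-- The row at the origin has finite expected Hilbert-Schmidt norm, hence is almost surely bounded,
and translations reach the other rows. So bounded columns and finite norm suffice for membership in
`K2pre`. -/
theorem ae_rowBdd (hm : S.IsMeasurableOp A) (hc : S.IsCovariantOp A)
    (hb : ∀ᵐ ω ∂P, C.ColBdd (A ω)) (hf : S.hsNormSq A < ∞) : ∀ᵐ ω ∂P, C.RowBdd (A ω) := by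
  have h0 : ∀ᵐ ω ∂P, ∃ M : ℝ, ∀ f : C.Hc, ‖C.chi 0 (A ω f)‖ ≤ M * ‖f‖ := by
    rw [← lintegral_row hm hc hb] at hf
    have h1 := ae_lt_top' (AEMeasurable.tsum fun a => hm.aemeasurable_hsSq hb 0 a) hf.ne
    filter_upwards [h1, hb] with ω h2 h3
    set c := ∑' a, hsSq C.basis ((C.chiL 0).comp (C.col (A ω) a))
    refine ⟨√c.toReal, fun f => ?_⟩
    have h4 := ENNReal.toReal_mono (ENNReal.mul_ne_top h2.ne (by simp)) (h3.enorm_chi_sq_le 0 f)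
    simp only [ENNReal.toReal_mul, ENNReal.toReal_pow, toReal_enorm] at h4
    refine abs_le_of_sq_le_sq' ?_ (by positivity) |>.2
    rw [mul_pow, Real.sq_sqrt ENNReal.toReal_nonneg]
    exact h4
  refine ae_all_iff.2 fun c => ?_
  filter_upwards [ae_vadd (-c) h0, ae_vadd (-c) (hc.apply_U c)] with ω ⟨M, hM⟩ h2
  refine ⟨M, fun f => ?_⟩
  have h3 := h2 ⟨(S.U c).symm f, S.U_symm_mem c f.2⟩
  simp only [LinearIsometryEquiv.apply_symm_apply, vadd_neg_vadd] at h3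
  rw [h3, S.chi_U, sub_self, LinearIsometryEquiv.norm_map]
  refine (hM _).trans_eq ?_
  rw [Submodule.coe_norm, LinearIsometryEquiv.norm_map, Submodule.coe_norm]

theorem mem_K2pre (hm : S.IsMeasurableOp A) (hc : S.IsCovariantOp A)
    (hb : ∀ᵐ ω ∂P, C.ColBdd (A ω)) (hf : S.hsNormSq A < ∞) : A ∈ S.K2pre := by
  refine ⟨hm, hc, ?_, hf⟩
  filter_upwards [hb, ae_rowBdd hm hc hb hf] with ω h1 h2 a
  exact ⟨h1 a, h2 a⟩

section K2pre

omit [MeasurableConstVAdd (Fin d → ℤ) Ω] [ErgodicVAdd (Fin d → ℤ) Ω P]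

theorem K2pre.colBdd (A : S.K2pre) : ∀ᵐ ω ∂P, C.ColBdd (A.1 ω) := by
  filter_upwards [A.2.2.2.1] with ω h a
  exact (h a).1

theorem K2pre.rowBdd (A : S.K2pre) : ∀ᵐ ω ∂P, C.RowBdd (A.1 ω) := by
  filter_upwards [A.2.2.2.1] with ω h a
  exact (h a).2

theorem K2pre.ae_summable (A : S.K2pre) :
    ∀ᵐ ω ∂P, ∑' i, ‖A.1 ω (C.chiHc 0 (C.basis i))‖ₑ ^ 2 < ∞ :=
  MagneticKubo.ae_summable (fun _ => A.2.1.aestronglyMeasurable _) A.2.2.2.2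

theorem K2pre.inner_eq (A B : S.K2pre) : ⟪A, B⟫_ℂ = S.hsInner A.1 B.1 := rfl

theorem K2pre.enorm_sq (A : S.K2pre) : ‖A‖ₑ ^ 2 = S.hsNormSq A.1 := by
  have h1 : ⟪A, A⟫_ℂ = ((∫ ω, ∑' i, ‖A.1 ω (C.chiHc 0 (C.basis i))‖ ^ 2 ∂P : ℝ) : ℂ) := by
    rw [K2pre.inner_eq, hsInner, ← integral_complex_ofReal]
    refine integral_congr_ae (Eventually.of_forall fun ω => ?_)
    simp only [inner_self_eq_ofReal, Complex.ofReal_tsum]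
  have h2 : ‖A‖ ^ 2 = ∫ ω, ∑' i, ‖A.1 ω (C.chiHc 0 (C.basis i))‖ ^ 2 ∂P := by
    rw [@norm_sq_eq_re_inner ℂ, h1]
    rfl
  have hm : AEMeasurable (fun ω => ∑' i, ‖A.1 ω (C.chiHc 0 (C.basis i))‖ₑ ^ 2) P :=
    AEMeasurable.tsum fun i => (A.2.1.aestronglyMeasurable _).enorm.pow_const 2
  have h3 : (fun ω => (∑' i, ‖A.1 ω (C.chiHc 0 (C.basis i))‖ₑ ^ 2).toReal) =
      fun ω => ∑' i, ‖A.1 ω (C.chiHc 0 (C.basis i))‖ ^ 2 := by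
    funext ω
    rw [ENNReal.tsum_toReal_eq fun i => by simp]
    simp
  rw [← h3, integral_toReal hm (K2pre.ae_summable A)] at h2
  rw [← ofReal_norm, ← ENNReal.ofReal_pow (norm_nonneg _), h2]
  exact ENNReal.ofReal_toReal A.2.2.2.2.ne

theorem enorm_toK2_sq (A : S.K2pre) : ‖S.toK2 A‖ₑ ^ 2 = S.hsNormSq A.1 := by
  rw [← K2pre.enorm_sq A, ← ofReal_norm, SeparationQuotient.norm_mk, ofReal_norm]

theorem inner_toK2 (A B : S.K2pre) : ⟪S.toK2 A, S.toK2 B⟫_ℂ = S.hsInner A.1 B.1 := rfl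

theorem toK2_eq_zero_iff (A : S.K2pre) : S.toK2 A = 0 ↔ S.hsNormSq A.1 = 0 := by
  rw [← enorm_toK2_sq, pow_eq_zero_iff two_ne_zero, enorm_eq_zero]

theorem hsNormSq_congr {A B : Ω → C.Hc →ₗ[ℂ] C.Hil} (h : ∀ᵐ ω ∂P, A ω = B ω) :
    S.hsNormSq A = S.hsNormSq B := by
  refine lintegral_congr_ae ?_
  filter_upwards [h] with ω hω
  rw [hω]

theorem toK2_congr {A B : S.K2pre} (h : ∀ᵐ ω ∂P, A.1 ω = B.1 ω) : S.toK2 A = S.toK2 B := by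
  rw [← sub_eq_zero, ← SeparationQuotient.mk_sub, toK2_eq_zero_iff]
  rw [hsNormSq_congr (B := 0)]
  · simp [hsNormSq]
  · filter_upwards [h] with ω hω
    simp [hω]

end K2pre

/-- Zero norm kills the column at the origin, and covariance kills every other column. Thus classes
in 𝒦₂ are classes modulo almost sure equality. -/
theorem K2pre.ae_eq_zero (A : S.K2pre) (h : S.hsNormSq A.1 = 0) : ∀ᵐ ω ∂P, A.1 ω = 0 := by
  have hm : AEMeasurable (fun ω => ∑' i, ‖A.1 ω (C.chiHc 0 (C.basis i))‖ₑ ^ 2) P :=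
    AEMeasurable.tsum fun i => (A.2.1.aestronglyMeasurable _).enorm.pow_const 2
  have h0 : ∀ᵐ ω ∂P, ∀ f, A.1 ω (C.chiHc 0 f) = 0 := by
    filter_upwards [(lintegral_eq_zero_iff' hm).1 h, K2pre.colBdd A] with ω h1 h2 f
    rw [← h2.col_apply]
    have h3 := enorm_apply_sq_le_hsSq C.basis (C.col (A.1 ω) 0) f
    rw [h2.hsSq_col, show ∑' i, ‖A.1 ω (C.chiHc 0 (C.basis i))‖ₑ ^ 2 = 0 from h1] at h3
    simpa using h3
  have h1 : ∀ a, ∀ᵐ ω ∂P, ∀ f, A.1 ω (C.chiHc a f) = 0 := fun a => by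
    filter_upwards [ae_vadd (-a) h0, ae_vadd (-a) (A.2.2.1.apply_U a)] with ω h2 h3 f
    have h4 := h3 (C.chiHc 0 ((S.U a).symm f))
    rw [h2, map_zero, vadd_neg_vadd] at h4
    rw [← h4]
    congr 1
    refine Subtype.ext ?_
    simp only [C.coe_chiHc]
    rw [S.U_chi, zero_add, LinearIsometryEquiv.apply_symm_apply]
  filter_upwards [ae_all_iff.2 h1] with ω h2
  exact C.linearMap_ext_chiHc fun a f => by rw [h2 a f, LinearMap.zero_apply]

theorem toK2_eq_iff {A B : S.K2pre} : S.toK2 A = S.toK2 B ↔ ∀ᵐ ω ∂P, A.1 ω = B.1 ω := by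
  refine ⟨fun h => ?_, toK2_congr⟩
  rw [← sub_eq_zero, ← SeparationQuotient.mk_sub, toK2_eq_zero_iff] at h
  filter_upwards [K2pre.ae_eq_zero _ h] with ω hω
  exact sub_eq_zero.1 hω

end ErgodicOperator

/-! ## The adjoint on functions of compact support -/

/-- Norms determine real parts; the imaginary part is the real part after multiplication by i, whose
sign is reversed by antilinearity. -/
theorem inner_map_map_of_conj {K : Type*} [NormedAddCommGroup K] [InnerProductSpace ℂ K]
    (J : K ≃ₗᵢ⋆[ℂ] K) (x y : K) : ⟪J x, J y⟫_ℂ = ⟪y, x⟫_ℂ := by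
  have hre : ∀ x y : K, (⟪J x, J y⟫_ℂ).re = (⟪x, y⟫_ℂ).re := by
    intro x y
    have h1 := re_inner_eq_norm_add_mul_self_sub_norm_sub_mul_self_div_four (𝕜 := ℂ) x y
    have h2 := re_inner_eq_norm_add_mul_self_sub_norm_sub_mul_self_div_four (𝕜 := ℂ)
      (J x) (J y)
    rw [← map_add, ← map_sub, LinearIsometryEquiv.norm_map, LinearIsometryEquiv.norm_map] at h2
    exact h2.trans h1.symm
  have him : ∀ x y : K, (⟪x, y⟫_ℂ).im = (⟪Complex.I • x, y⟫_ℂ).re := fun x y => by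
    simp
  have hsym : ∀ x y : K, ⟪x, y⟫_ℂ = starRingEnd ℂ ⟪y, x⟫_ℂ := fun x y => (inner_conj_symm x y).symm
  refine Complex.ext ?_ ?_
  · rw [hre, hsym, Complex.conj_re]
  · have h : Complex.I • J x = J (-Complex.I • x) := by
      rw [map_smulₛₗ]
      simp
    rw [him, h, hre, hsym y x, Complex.conj_im, him, neg_smul, inner_neg_left, Complex.neg_re]

namespace ConfigSpace

variable {d : ℕ} {C : ConfigSpace d}

/-- The restriction `A‡` of the adjoint of `A` to the functions of compact support. -/
def dagger (A : C.Hc →ₗ[ℂ] C.Hil) : C.Hc →ₗ[ℂ] C.Hil := by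
  classical
  exact if h : C.Hc ≤ (LinearPMap.adjoint ⟨C.Hc, A⟩).domain then
    (LinearPMap.adjoint ⟨C.Hc, A⟩).toFun.comp (Submodule.inclusion h) else 0

/-- A function of compact support meets finitely many cubes, so only finitely many bounded rows of
`A` enter the pairing. -/
theorem RowBdd.Hc_le {A : C.Hc →ₗ[ℂ] C.Hil} (hA : C.RowBdd A) :
    C.Hc ≤ (LinearPMap.adjoint ⟨C.Hc, A⟩).domain := by
  intro f hf
  obtain ⟨s, hs⟩ := C.exists_finset_of_mem_Hc hf
  choose M hM using hA
  rw [LinearPMap.mem_adjoint_domain_iff]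
  let φ : C.Hc →ₗ[ℂ] ℂ := (innerₛₗ ℂ f).comp A
  change Continuous φ
  refine AddMonoidHomClass.continuous_of_bound φ (‖f‖ * ∑ a ∈ s, M a) fun g => ?_
  have h1 : φ g = ∑ a ∈ s, ⟪f, C.chi a (A g)⟫_ℂ := by
    change ⟪f, A g⟫_ℂ = _
    conv_lhs => rw [C.eq_sum_chi hs, sum_inner]
    exact Finset.sum_congr rfl fun a _ => C.inner_chi a _ _
  rw [h1, mul_assoc, Finset.sum_mul, Finset.mul_sum]
  refine (norm_sum_le _ _).trans (Finset.sum_le_sum fun a _ => ?_)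
  exact (norm_inner_le_norm _ _).trans (mul_le_mul_of_nonneg_left (hM a g) (norm_nonneg _))

theorem RowBdd.inner_dagger {A : C.Hc →ₗ[ℂ] C.Hil} (hA : C.RowBdd A) (f g : C.Hc) :
    ⟪dagger A f, (g : C.Hil)⟫_ℂ = ⟪(f : C.Hil), A g⟫_ℂ := by
  rw [dagger, dif_pos hA.Hc_le]
  exact LinearPMap.adjoint_isFormalAdjoint (T := ⟨C.Hc, A⟩) C.dense_hc
    (Submodule.inclusion hA.Hc_le f) g

theorem RowBdd.dagger_eq {A D : C.Hc →ₗ[ℂ] C.Hil} (hA : C.RowBdd A)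
    (h : ∀ f g : C.Hc, ⟪D f, (g : C.Hil)⟫_ℂ = ⟪(f : C.Hil), A g⟫_ℂ) : dagger A = D :=
  LinearMap.ext fun f => C.eq_of_inner_Hc fun g => by rw [hA.inner_dagger, h]

theorem RowBdd.colBdd_dagger {A : C.Hc →ₗ[ℂ] C.Hil} (hA : C.RowBdd A) : C.ColBdd (dagger A) := by
  intro a
  obtain ⟨M, hM⟩ := hA a
  refine ⟨M, fun f => ?_⟩
  set v := dagger A (C.chiHc a f) with hv
  have h1 : ∀ g : C.Hil, ‖⟪v, g⟫_ℂ‖ ≤ M * ‖f‖ * ‖g‖ := by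
    intro g
    have hc : IsClosed {g : C.Hil | ‖⟪v, g⟫_ℂ‖ ≤ M * ‖f‖ * ‖g‖} :=
      isClosed_le (by fun_prop) (by fun_prop)
    refine hc.closure_subset_iff.2 (fun g hg => ?_) (C.dense_hc g)
    have h2 := hA.inner_dagger (C.chiHc a f) ⟨g, hg⟩
    simp only [C.coe_chiHc] at h2
    rw [Set.mem_ofPred_eq, hv, h2, C.inner_chi]
    refine (norm_inner_le_norm _ _).trans ?_
    have := hM ⟨g, hg⟩
    calc _ ≤ ‖f‖ * (M * ‖(⟨g, hg⟩ : C.Hc)‖) := mul_le_mul_of_nonneg_left this (norm_nonneg _)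
      _ = _ := by rw [Submodule.coe_norm]; ring
  -- `M` is not assumed nonnegative, so even for v = 0 the bound has to be read off the pairing
  -- estimate, tested at `f`.
  by_cases hv0 : v = 0
  · rw [hv0, norm_zero]
    have h2 := hM (0 : C.Hc)
    have h3 := h1 f
    rw [hv0, inner_zero_left, norm_zero, mul_assoc] at h3
    rcases eq_or_ne f 0 with rfl | hf
    · simp
    · have : 0 < ‖f‖ := norm_pos_iff.2 hf
      by_contra h4
      push Not at h4
      nlinarith
  · have h2 := h1 v
    rw [inner_self_eq_ofReal, Complex.norm_real, Real.norm_of_nonneg (by positivity)] at h2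
    have : 0 < ‖v‖ := norm_pos_iff.2 hv0
    nlinarith

/-- The block structure of the adjoint. -/
theorem hsSq_block_dagger {A : C.Hc →ₗ[ℂ] C.Hil} (hA : C.RowBdd A) (hA' : C.ColBdd A)
    (a b : Fin d → ℤ) : hsSq C.basis ((C.chiL b).comp (C.col (dagger A) a)) =
      hsSq C.basis ((C.chiL a).comp (C.col A b)) := by
  rw [← hsSq_adjoint]
  congr 1
  refine (ContinuousLinearMap.eq_adjoint_iff _ _).2 (fun x y => ?_) |>.symm
  rw [ContinuousLinearMap.comp_apply, ContinuousLinearMap.comp_apply, hA'.col_apply,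
    hA.colBdd_dagger.col_apply, C.chiL_apply, C.chiL_apply, C.inner_chi, ← C.inner_chi b,
    ← C.coe_chiHc, ← C.coe_chiHc, ← inner_conj_symm, ← hA.inner_dagger, inner_conj_symm]

/-- Reduces the iterated adjoint with its domains to pairings with functions of compact support. -/
theorem mem_graph_ddaggerAdjoint {A : C.Hc →ₗ[ℂ] C.Hil} (hA : C.RowBdd A) {x y : C.Hil}
    (h : ∀ g : C.Hc, ⟪y, (g : C.Hil)⟫_ℂ = ⟪x, dagger A g⟫_ℂ) :
    (x, y) ∈ (ErgodicOperator.ddaggerAdjoint C A).graph := by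
  set T := (LinearPMap.adjoint ⟨C.Hc, A⟩).domRestrict C.Hc with hT
  have hd : Dense (T.domain : Set C.Hil) := by
    rw [hT, LinearPMap.domRestrict_domain, inf_eq_left.2 hA.Hc_le]
    exact C.dense_hc
  have hTd : ∀ g : T.domain, T g = dagger A ⟨g, g.2.1⟩ := by
    intro g
    rw [dagger, dif_pos hA.Hc_le]
    rfl
  rw [ErgodicOperator.ddaggerAdjoint, LinearPMap.mem_graph_iff]
  have h' : ∀ g : T.domain, ⟪y, (g : C.Hil)⟫_ℂ = ⟪x, T g⟫_ℂ := fun g => by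
    rw [hTd]
    exact h ⟨g, g.2.1⟩
  have hx := LinearPMap.mem_adjoint_domain_of_exists x ⟨y, h'⟩
  exact ⟨⟨x, hx⟩, rfl, LinearPMap.adjoint_apply_eq hd _ h'⟩

end ConfigSpace

open ConfigSpace

namespace ErgodicOperator

variable {d : ℕ} {C : ConfigSpace d} {Ω : Type*} [MeasurableSpace Ω] [AddAction (Fin d → ℤ) Ω]
  {P : Measure Ω} (S : ErgodicOperator C Ω P) [MeasurableConstVAdd (Fin d → ℤ) Ω]
  [ErgodicVAdd (Fin d → ℤ) Ω P]

omit [MeasurableConstVAdd (Fin d → ℤ) Ω] [ErgodicVAdd (Fin d → ℤ) Ω P] in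
theorem ae_colBdd_dagger (A : S.K2pre) : ∀ᵐ ω ∂P, C.ColBdd (dagger (A.1 ω)) := by
  filter_upwards [K2pre.rowBdd A] with ω h
  exact h.colBdd_dagger

omit [MeasurableConstVAdd (Fin d → ℤ) Ω] [ErgodicVAdd (Fin d → ℤ) Ω P] in
theorem isMeasurableOp_dagger (A : S.K2pre) : S.IsMeasurableOp fun ω => dagger (A.1 ω) := by
  intro f
  have h : AEMeasurable (fun ω => starRingEnd ℂ ⟪(f : C.Hil), A.1 ω f⟫_ℂ) P :=
    RCLike.continuous_conj.measurable.comp_aemeasurable (A.2.1 f)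
  refine h.congr ?_
  filter_upwards [K2pre.rowBdd A] with ω hω
  rw [← hω.inner_dagger, inner_conj_symm]

theorem isCovariantOp_dagger (A : S.K2pre) : S.IsCovariantOp fun ω => dagger (A.1 ω) := by
  intro a
  filter_upwards [K2pre.rowBdd A, ae_vadd a (K2pre.rowBdd A), IsCovariantOp.apply_U A.2.2.1 a]
    with ω h1 h2 h3 f g hfg
  refine C.eq_of_inner_Hc fun k => ?_
  have h4 := h3 ⟨(S.U a).symm k, S.U_symm_mem a k.2⟩
  simp only [LinearIsometryEquiv.apply_symm_apply] at h4
  rw [h2.inner_dagger, hfg, show (k : C.Hc) = ⟨k, k.2⟩ from rfl, h4, LinearIsometryEquiv.inner_map_map,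
    ← h1.inner_dagger]
  simp only
  rw [← (S.U a).inner_map_map, LinearIsometryEquiv.apply_symm_apply]

/-- The column of A‡ at the origin is the adjoint of the row of A, and rows and columns of covariant
operators have equal expected norms. This is the trace property of the trace per unit volume. -/
theorem hsNormSq_dagger (A : S.K2pre) : S.hsNormSq (fun ω => dagger (A.1 ω)) = S.hsNormSq A.1 := by
  rw [← lintegral_row A.2.1 A.2.2.1 (K2pre.colBdd A)]
  refine lintegral_congr_ae ?_
  filter_upwards [K2pre.colBdd A, K2pre.rowBdd A] with ω h1 h2
  simp only [← hsSq_block_dagger h2 h1]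
  simp only [hsSq, ContinuousLinearMap.comp_apply, h2.colBdd_dagger.col_apply]
  rw [ENNReal.tsum_comm]
  exact tsum_congr fun i => (C.tsum_enorm_chi_sq _).symm

/-- The conjugation `A ↦ A‡`. -/
def preDagger (A : S.K2pre) : S.K2pre := ⟨fun ω => dagger (A.1 ω),
  mem_K2pre (S.isMeasurableOp_dagger A) (S.isCovariantOp_dagger A) (S.ae_colBdd_dagger A)
    (by rw [S.hsNormSq_dagger]; exact A.2.2.2.2)⟩

theorem preDagger_coe (A : S.K2pre) (ω : Ω) : (S.preDagger A).1 ω = dagger (A.1 ω) := rfl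

theorem toK2_preDagger_congr {A B : S.K2pre} (h : S.toK2 A = S.toK2 B) :
    S.toK2 (S.preDagger A) = S.toK2 (S.preDagger B) := by
  refine toK2_congr ?_
  filter_upwards [toK2_eq_iff.1 h] with ω hω
  simp only [preDagger, hω]

theorem exists_daggerMap : ∃ J : S.K2 → S.K2, ∀ A, J (S.toK2 A) = S.toK2 (S.preDagger A) :=
  ⟨fun x => S.toK2 (S.preDagger (SeparationQuotient.surjective_mk x).choose), fun A =>
    S.toK2_preDagger_congr (SeparationQuotient.surjective_mk (S.toK2 A)).choose_spec⟩

theorem exists_conjugation :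
    ∃ J : S.K2 ≃ₗᵢ⋆[ℂ] S.K2, (∀ A, J (S.toK2 A) = S.toK2 (S.preDagger A)) ∧ ∀ x, J (J x) = x := by
  obtain ⟨J, hJ⟩ := S.exists_daggerMap
  have hinv : Function.Involutive J := by
    intro x
    obtain ⟨A, rfl⟩ := SeparationQuotient.surjective_mk x
    rw [hJ, hJ]
    refine toK2_congr ?_
    filter_upwards [K2pre.rowBdd A, K2pre.rowBdd (S.preDagger A)] with ω h1 h2
    refine h2.dagger_eq fun f g => ?_
    rw [← inner_conj_symm, ← h1.inner_dagger, inner_conj_symm]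
    rfl
  have hadd : ∀ x y, J (x + y) = J x + J y := by
    intro x y
    obtain ⟨A, rfl⟩ := SeparationQuotient.surjective_mk x
    obtain ⟨B, rfl⟩ := SeparationQuotient.surjective_mk y
    rw [← SeparationQuotient.mk_add, hJ, hJ, hJ, ← SeparationQuotient.mk_add]
    refine toK2_congr ?_
    filter_upwards [K2pre.rowBdd A, K2pre.rowBdd B, K2pre.rowBdd (A + B)] with ω h1 h2 h3
    refine h3.dagger_eq fun f g => ?_
    change ⟪dagger (A.1 ω) f + dagger (B.1 ω) f, _⟫_ℂ = ⟪_, A.1 ω g + B.1 ω g⟫_ℂ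
    rw [inner_add_left, inner_add_right, h1.inner_dagger, h2.inner_dagger]
  have hsmul : ∀ (c : ℂ) x, J (c • x) = starRingEnd ℂ c • J x := by
    intro c x
    obtain ⟨A, rfl⟩ := SeparationQuotient.surjective_mk x
    rw [← SeparationQuotient.mk_smul, hJ, hJ, ← SeparationQuotient.mk_smul]
    refine toK2_congr ?_
    filter_upwards [K2pre.rowBdd A, K2pre.rowBdd (c • A)] with ω h1 h3
    refine h3.dagger_eq fun f g => ?_
    change ⟪starRingEnd ℂ c • dagger (A.1 ω) f, _⟫_ℂ = ⟪_, c • A.1 ω g⟫_ℂ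
    rw [inner_smul_left, inner_smul_right, h1.inner_dagger, Complex.conj_conj]
  have hnorm : ∀ x, ‖J x‖ = ‖x‖ := by
    intro x
    obtain ⟨A, rfl⟩ := SeparationQuotient.surjective_mk x
    have h : ‖J (S.toK2 A)‖ₑ ^ 2 = ‖S.toK2 A‖ₑ ^ 2 := by
      rw [hJ, enorm_toK2_sq, enorm_toK2_sq]
      exact S.hsNormSq_dagger A
    have h2 := le_antisymm
      ((ENNReal.pow_le_pow_left_iff two_ne_zero).1 h.le)
      ((ENNReal.pow_le_pow_left_iff two_ne_zero).1 h.ge)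
    rw [← toReal_enorm, h2, toReal_enorm]
  refine ⟨{
      toFun := J
      map_add' := hadd
      map_smul' := hsmul
      invFun := J
      left_inv := hinv
      right_inv := hinv
      norm_map' := hnorm }, hJ, hinv⟩

/-- The conjugation on `𝒦₂` induced by `A ↦ A‡`. -/
def conjugation : S.K2 ≃ₗᵢ⋆[ℂ] S.K2 := S.exists_conjugation.choose

theorem conjugation_toK2 (A : S.K2pre) : S.conjugation (S.toK2 A) = S.toK2 (S.preDagger A) :=
  S.exists_conjugation.choose_spec.1 A

theorem conjugation_conjugation (x : S.K2) : S.conjugation (S.conjugation x) = x :=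
  S.exists_conjugation.choose_spec.2 x

end ErgodicOperator

/-! ## Multiplication by bounded covariant operators -/

/-- The conjugate `J T J⁻¹` of a bounded operator by an antiunitary operator. -/
def conjBy {K : Type*} [NormedAddCommGroup K] [InnerProductSpace ℂ K] (J : K ≃ₗᵢ⋆[ℂ] K)
    (T : K →L[ℂ] K) : K →L[ℂ] K :=
  (J : K →SL[starRingEnd ℂ] K).comp (T.comp (J.symm : K →SL[starRingEnd ℂ] K))

theorem conjBy_apply {K : Type*} [NormedAddCommGroup K] [InnerProductSpace ℂ K] (J : K ≃ₗᵢ⋆[ℂ] K)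
    (T : K →L[ℂ] K) (x : K) : conjBy J T x = J (T (J.symm x)) := rfl

open ConfigSpace

namespace ErgodicOperator

variable {d : ℕ} {C : ConfigSpace d} {Ω : Type*} [MeasurableSpace Ω] [AddAction (Fin d → ℤ) Ω]
  {P : Measure Ω} (S : ErgodicOperator C Ω P)

/-- Measurable covariant essentially bounded operators. -/
structure IsBddCovariant (B : Ω → C.Hil →L[ℂ] C.Hil) : Prop where
  measurable : ∀ f g, AEMeasurable (fun ω => ⟪f, B ω g⟫_ℂ) P
  covariant : ∀ a, ∀ᵐ ω ∂P, ∀ f, B (a +ᵥ ω) (S.U a f) = S.U a (B ω f)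
  bdd : ∃ M : ℝ, ∀ᵐ ω ∂P, ‖B ω‖ ≤ M

namespace IsBddCovariant

variable {S} {B : Ω → C.Hil →L[ℂ] C.Hil} (hB : S.IsBddCovariant B)
include hB

/-- `B` is only weakly measurable, so the random vector is expanded in the countable basis before
`B` is applied. -/
theorem aemeasurable_inner {v : Ω → C.Hil} (hv : AEStronglyMeasurable v P) (f : C.Hil) :
    AEMeasurable (fun ω => ⟪f, B ω (v ω)⟫_ℂ) P := by
  refine aemeasurable_of_tendsto_metrizable_ae (atTop : Filter (Finset C.basisSet))
    (f := fun s ω => ∑ i ∈ s, ⟪C.basis i, v ω⟫_ℂ * ⟪f, B ω (C.basis i)⟫_ℂ) (fun s => ?_) ?_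
  · exact Finset.aemeasurable_fun_sum s fun i _ =>
      ((aestronglyMeasurable_const.inner hv).aemeasurable).mul (hB.measurable f _)
  · refine Eventually.of_forall fun ω => ?_
    have h := (C.basis.hasSum_repr (v ω)).mapL ((innerSL ℂ f).comp (B ω))
    simp only [HilbertBasis.repr_apply_apply, map_smul, ContinuousLinearMap.comp_apply,
      innerSL_apply_apply, smul_eq_mul] at h
    exact h

theorem isMeasurableOp_mul {A : Ω → C.Hc →ₗ[ℂ] C.Hil} (hA : S.IsMeasurableOp A) :
    S.IsMeasurableOp fun ω => (B ω : C.Hil →ₗ[ℂ] C.Hil).comp (A ω) := fun f =>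
  hB.aemeasurable_inner (hA.aestronglyMeasurable f) f

theorem isCovariantOp_mul {A : Ω → C.Hc →ₗ[ℂ] C.Hil} (hA : S.IsCovariantOp A) :
    S.IsCovariantOp fun ω => (B ω : C.Hil →ₗ[ℂ] C.Hil).comp (A ω) := fun a => by
  filter_upwards [hA a, hB.covariant a] with ω h1 h2 f g hfg
  simp only [LinearMap.comp_apply, h1 f g hfg]
  exact h2 _

omit hB in
theorem hsNormSq_mul_le {M : ℝ} (hM : ∀ᵐ ω ∂P, ‖B ω‖ ≤ M) (A : Ω → C.Hc →ₗ[ℂ] C.Hil) :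
    S.hsNormSq (fun ω => (B ω : C.Hil →ₗ[ℂ] C.Hil).comp (A ω)) ≤ ‖M‖ₑ ^ 2 * S.hsNormSq A := by
  rw [hsNormSq, hsNormSq, ← lintegral_const_mul' _ _ (by simp)]
  refine lintegral_mono_ae ?_
  filter_upwards [hM] with ω h
  rw [← ENNReal.tsum_mul_left]
  refine ENNReal.tsum_le_tsum fun i => ?_
  rw [← mul_pow, ← enorm_norm (A ω _), ← enorm_mul]
  refine pow_le_pow_left' ?_ 2
  rw [enorm_le_iff_norm_le, Real.norm_of_nonneg (mul_nonneg ((norm_nonneg _).trans h) (norm_nonneg _))]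
  exact (B ω).le_of_opNorm_le h _

theorem adjoint : S.IsBddCovariant fun ω => (B ω).adjoint where
  measurable f g := by
    have h : AEMeasurable (fun ω => starRingEnd ℂ ⟪g, B ω f⟫_ℂ) P :=
      RCLike.continuous_conj.measurable.comp_aemeasurable (hB.measurable g f)
    refine h.congr (Eventually.of_forall fun ω => ?_)
    simp only [ContinuousLinearMap.adjoint_inner_right, inner_conj_symm]
  covariant a := by
    filter_upwards [hB.covariant a] with ω h f
    refine ext_inner_right ℂ fun k => ?_
    rw [ContinuousLinearMap.adjoint_inner_left, ← (S.U a).apply_symm_apply k, h,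
      LinearIsometryEquiv.inner_map_map, LinearIsometryEquiv.inner_map_map,
      ContinuousLinearMap.adjoint_inner_left]
  bdd := by
    obtain ⟨M, hM⟩ := hB.bdd
    refine ⟨M, ?_⟩
    filter_upwards [hM] with ω h
    rwa [LinearIsometryEquiv.norm_map]

variable [MeasurableConstVAdd (Fin d → ℤ) Ω] [ErgodicVAdd (Fin d → ℤ) Ω P]

/-- Left multiplication on representatives. -/
def preMul : S.K2pre →ₗ[ℂ] S.K2pre where
  toFun A := ⟨fun ω => (B ω : C.Hil →ₗ[ℂ] C.Hil).comp (A.1 ω), by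
    refine mem_K2pre (hB.isMeasurableOp_mul A.2.1) (hB.isCovariantOp_mul A.2.2.1) ?_ ?_
    · filter_upwards [K2pre.colBdd A] with ω h a
      obtain ⟨M, hM⟩ := h a
      refine ⟨‖B ω‖ * M, fun f => ?_⟩
      rw [mul_assoc]
      exact ((B ω).le_opNorm _).trans (mul_le_mul_of_nonneg_left (hM f) (norm_nonneg _))
    · obtain ⟨M, hM⟩ := hB.bdd
      exact (hsNormSq_mul_le hM _).trans_lt (ENNReal.mul_lt_top (by simp) A.2.2.2.2)⟩
  map_add' A A' := Subtype.ext (funext fun ω => LinearMap.ext fun f => by simp)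
  map_smul' c A := Subtype.ext (funext fun ω => LinearMap.ext fun f => by simp)

theorem preMul_apply (A : S.K2pre) (ω : Ω) (f : C.Hc) :
    (hB.preMul A).1 ω f = B ω (A.1 ω f) := rfl

theorem enorm_preMul_sq_le {M : ℝ} (hM : ∀ᵐ ω ∂P, ‖B ω‖ ≤ M) (A : S.K2pre) :
    ‖hB.preMul A‖ ≤ |M| * ‖A‖ := by
  have h1 := hsNormSq_mul_le (S := S) hM A.1
  have h2 : ‖hB.preMul A‖ₑ ^ 2 ≤ (‖M‖ₑ * ‖A‖ₑ) ^ 2 := by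
    rw [mul_pow, K2pre.enorm_sq, K2pre.enorm_sq]
    exact h1
  have h3 := (ENNReal.pow_le_pow_left_iff two_ne_zero).1 h2
  have h4 := ENNReal.toReal_mono (ENNReal.mul_ne_top (by simp) (by simp)) h3
  simpa using h4

theorem exists_leftMul : ∃ T : S.K2 →L[ℂ] S.K2, ∀ A, T (S.toK2 A) = S.toK2 (hB.preMul A) := by
  obtain ⟨M, hM⟩ := hB.bdd
  let F : S.K2pre →L[ℂ] S.K2pre := hB.preMul.mkContinuous |M| fun A => hB.enorm_preMul_sq_le hM A
  let G : S.K2pre →L[ℂ] S.K2 := (SeparationQuotient.mkCLM ℂ S.K2pre).comp F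
  refine ⟨SeparationQuotient.liftCLM G fun A A' h => ?_, fun A => ?_⟩
  · exact (h.map G.continuous).eq
  · rfl

theorem leftMul_spec (A : S.K2pre) : ∃ D : S.K2pre,
    S.leftMul B (S.toK2 A) = S.toK2 D ∧ ∀ᵐ ω ∂P, ∀ f : C.Hc, D.1 ω f = B ω (A.1 ω f) := by
  obtain ⟨T, hT⟩ := hB.exists_leftMul
  exact Classical.epsilon_spec (p := fun T : S.K2 →L[ℂ] S.K2 => ∀ A : S.K2pre, ∃ D : S.K2pre,
    T (S.toK2 A) = S.toK2 D ∧ ∀ᵐ ω ∂P, ∀ f : C.Hc, D.1 ω f = B ω (A.1 ω f))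
    ⟨T, fun A => ⟨_, hT A, Eventually.of_forall fun ω f => rfl⟩⟩ A

theorem leftMul_toK2_of_ae {A D : S.K2pre} (h : ∀ᵐ ω ∂P, ∀ f : C.Hc, D.1 ω f = B ω (A.1 ω f)) :
    S.leftMul B (S.toK2 A) = S.toK2 D := by
  obtain ⟨D', h1, h2⟩ := hB.leftMul_spec A
  rw [h1]
  refine toK2_congr ?_
  filter_upwards [h, h2] with ω h3 h4
  exact LinearMap.ext fun f => by rw [h3, h4]

theorem leftMul_toK2 (A : S.K2pre) : S.leftMul B (S.toK2 A) = S.toK2 (hB.preMul A) :=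
  hB.leftMul_toK2_of_ae (Eventually.of_forall fun _ _ => rfl)

/-- Right multiplication by `B` on representatives, as the conjugate of left multiplication
by `B*`. -/
theorem inner_preDagger_preMul (A : S.K2pre) : ∀ᵐ ω ∂P, ∀ f g : C.Hc,
    ⟪(S.preDagger (hB.adjoint.preMul (S.preDagger A))).1 ω f, (g : C.Hil)⟫_ℂ =
      ⟪B ω f, dagger (A.1 ω) g⟫_ℂ := by
  filter_upwards [K2pre.rowBdd (hB.adjoint.preMul (S.preDagger A))] with ω h f g
  rw [preDagger_coe, h.inner_dagger f g, hB.adjoint.preMul_apply, preDagger_coe,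
    ContinuousLinearMap.adjoint_inner_right]

/-- A‡*B = (B*A‡)‡, so right multiplication exists as a conjugate of left multiplication. The
operator selected by choice agrees with it because the graph of A‡* is single-valued. -/
theorem rightMul_toK2 (A : S.K2pre) : S.rightMul B (S.toK2 A) =
    S.toK2 (S.preDagger (hB.adjoint.preMul (S.preDagger A))) := by
  have hgr : ∀ A : S.K2pre, ∀ᵐ ω ∂P, ∀ f : C.Hc,
      (B ω f, (S.preDagger (hB.adjoint.preMul (S.preDagger A))).1 ω f) ∈
        (ddaggerAdjoint C (A.1 ω)).graph := fun A => by
    filter_upwards [hB.inner_preDagger_preMul A, K2pre.rowBdd A] with ω h1 h2 f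
    exact mem_graph_ddaggerAdjoint h2 (h1 f)
  obtain ⟨D, h1, h2⟩ := Classical.epsilon_spec (p := fun T : S.K2 →L[ℂ] S.K2 =>
    ∀ A : S.K2pre, ∃ D : S.K2pre, T (S.toK2 A) = S.toK2 D ∧
      ∀ᵐ ω ∂P, ∀ f : C.Hc, (B ω f, D.1 ω f) ∈ (ddaggerAdjoint C (A.1 ω)).graph)
    ⟨conjBy S.conjugation (S.leftMul fun ω => (B ω).adjoint), fun A => ⟨_, by
      rw [conjBy_apply, show S.conjugation.symm (S.toK2 A) = S.conjugation (S.toK2 A) from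
        (LinearIsometryEquiv.symm_apply_eq _).2 (S.conjugation_conjugation _).symm,
        S.conjugation_toK2, hB.adjoint.leftMul_toK2, S.conjugation_toK2], hgr A⟩⟩ A
  refine h1.trans (toK2_congr ?_)
  filter_upwards [h2, hgr A] with ω h3 h4
  exact LinearMap.ext fun f => LinearPMap.mem_graph_snd_inj _ (h3 f) (h4 f) rfl

theorem rightMul_eq : S.rightMul B = conjBy S.conjugation (S.leftMul fun ω => (B ω).adjoint) := by
  refine ContinuousLinearMap.ext fun x => ?_
  obtain ⟨A, rfl⟩ := SeparationQuotient.surjective_mk x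
  refine (hB.rightMul_toK2 A).trans ?_
  rw [conjBy_apply, show S.conjugation.symm (S.toK2 A) = S.conjugation (S.toK2 A) from
    (LinearIsometryEquiv.symm_apply_eq _).2 (S.conjugation_conjugation _).symm,
    S.conjugation_toK2, hB.adjoint.leftMul_toK2, S.conjugation_toK2]

end IsBddCovariant

end ErgodicOperator

/-! ## Unitary equivalence of projection-valued measures -/

namespace PVM

variable {α : Type*} [MeasurableSpace α] {K : Type*} [NormedAddCommGroup K] [InnerProductSpace ℂ K]

/-- The image of a projection-valued measure under a unitary operator. -/
def conjUnitary (E : PVM α K) (V : K ≃ₗᵢ[ℂ] K) : PVM α K where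
  proj B := (V : K →L[ℂ] K).comp ((E.proj B).comp (V.symm : K →L[ℂ] K))
  not_measurable B hB := by ext x; simp [E.not_measurable B hB]
  symm B x y := by
    change ⟪V (E.proj B (V.symm x)), y⟫_ℂ = ⟪x, V (E.proj B (V.symm y))⟫_ℂ
    conv_lhs => rw [← V.apply_symm_apply y, V.inner_map_map, E.symm]
    conv_rhs => rw [← V.apply_symm_apply x, V.inner_map_map]
  univ := by ext x; simp [E.univ]
  inter B C hB hC := by ext x; simp [E.inter B C hB hC]
  iUnion f hf hd x := (E.iUnion f hf hd (V.symm x)).mapL (V : K →L[ℂ] K)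

theorem conjUnitary_proj (E : PVM α K) (V : K ≃ₗᵢ[ℂ] K) (B : Set α) (x : K) :
    (E.conjUnitary V).proj B x = V (E.proj B (V.symm x)) := rfl

theorem measure_conjUnitary (E : PVM α K) (V : K ≃ₗᵢ[ℂ] K) (x : K) :
    (E.conjUnitary V).measure x = E.measure (V.symm x) := by
  ext B hB
  rw [measure_apply _ hB, measure_apply _ hB, conjUnitary_proj, LinearIsometryEquiv.enorm_map]

theorem integral_conjUnitary [CompleteSpace K] (E : PVM α K) (V : K ≃ₗᵢ[ℂ] K) {f : α → ℂ}
    (hf : IsBddMeas f) (x : K) : (E.conjUnitary V).integral f x = V (E.integral f (V.symm x)) := by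
  have h : (E.conjUnitary V).integral f =
      (V : K →L[ℂ] K).comp ((E.integral f).comp (V.symm : K →L[ℂ] K)) := by
    refine integral_eq hf fun x => ?_
    rw [measure_conjUnitary, ← E.inner_integral hf]
    change ⟪x, V (E.integral f (V.symm x))⟫_ℂ = _
    conv_lhs => rw [← V.apply_symm_apply x, V.inner_map_map]
    simp
  rw [h]
  rfl

/-- A linear functional calculus that is continuous for bounded pointwise convergence is given by
the integral. -/
theorem eq_integral [CompleteSpace K] (E : PVM α K) {Φ : (α → ℂ) → K →L[ℂ] K}
    (hind : ∀ B, MeasurableSet B → Φ (B.indicator 1) = E.proj B)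
    (hadd : ∀ f g, IsBddMeas f → IsBddMeas g → Φ (f + g) = Φ f + Φ g)
    (hsmul : ∀ (c : ℂ) f, IsBddMeas f → Φ (c • f) = c • Φ f)
    (hlim : ∀ (u : ℕ → α → ℂ) f M, (∀ n, IsBddMeas (u n)) → (∀ n a, ‖u n a‖ ≤ M) → IsBddMeas f →
      (∀ a, Tendsto (fun n => u n a) atTop (𝓝 (f a))) →
      ∀ x, Tendsto (fun n => Φ (u n) x) atTop (𝓝 (Φ f x)))
    {g : α → ℂ} (hg : IsBddMeas g) : Φ g = E.integral g := by
  refine hg.induction (p := fun g => IsBddMeas g → Φ g = E.integral g) ?_ ?_ ?_ ?_ hg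
  · intro B hB _
    rw [PVM.integral_indicator _ hB, hind B hB]
  · intro g h hg hh h1 h2 _
    rw [hadd _ _ hg hh, PVM.integral_add _ hg hh, h1 hg, h2 hh]
  · intro c g hg h1 _
    rw [hsmul c _ hg, PVM.integral_smul _ c hg, h1 hg]
  · intro u g M hm hM hl hu hg
    have hub : ∀ n, IsBddMeas (u n) := fun n => ⟨hm n, M, hM n⟩
    refine ContinuousLinearMap.ext fun x => tendsto_nhds_unique (hlim u g M hub hM hg hl x) ?_
    simp only [fun n => hu n (hub n)]
    exact E.tendsto_integral (l := atTop) hub hM hg hl x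

end PVM

theorem tendsto_tsum_enorm_zero {ι : Type*} {F : ℕ → ι → ℝ≥0∞} {b : ι → ℝ≥0∞} (hb : ∑' i, b i ≠ ∞)
    (hF : ∀ n i, F n i ≤ b i) (hlim : ∀ i, Tendsto (fun n => F n i) atTop (𝓝 0)) :
    Tendsto (fun n => ∑' i, F n i) atTop (𝓝 0) := by
  let : MeasurableSpace ι := ⊤
  simp only [← lintegral_count] at hb ⊢
  have h := tendsto_lintegral_of_dominated_convergence (μ := Measure.count) (f := fun _ => 0) b
    (fun n => measurable_from_top) (fun n => Eventually.of_forall (hF n)) hb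
    (Eventually.of_forall hlim)
  simpa using h

theorem IsSpectralMeasure.conjUnitary {K : Type*} [NormedAddCommGroup K] [InnerProductSpace ℂ K]
    {E : PVM ℝ K} {T T' : K →ₗ.[ℂ] K} (h : IsSpectralMeasure E T) (V : K ≃ₗᵢ[ℂ] K)
    (hT : ∀ f g, (f, g) ∈ T.graph ↔ (V f, V g) ∈ T'.graph) :
    IsSpectralMeasure (E.conjUnitary V) T' := by
  have hgr : ∀ f g, (f, g) ∈ T'.graph ↔ (V.symm f, V.symm g) ∈ T.graph := fun f g => by
    rw [hT, V.apply_symm_apply, V.apply_symm_apply]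
  refine ⟨fun x => ?_, fun x => ?_⟩
  · rw [PVM.measure_conjUnitary, ← h.1, LinearPMap.mem_domain_iff, LinearPMap.mem_domain_iff]
    refine ⟨fun ⟨y, hy⟩ => ⟨_, (hgr x y).1 hy⟩, fun ⟨y, hy⟩ => ⟨V y, ?_⟩⟩
    rw [hgr, V.symm_apply_apply]
    exact hy
  · obtain ⟨y, hy1, hy2⟩ := (LinearPMap.mem_graph_iff _).1 ((hgr _ _).1 (LinearPMap.mem_graph T' x))
    simp only at hy1 hy2
    rw [PVM.measure_conjUnitary, ← hy1, ← h.2 y, hy1, hy2, LinearIsometryEquiv.inner_map_map]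

open ConfigSpace

/-! ### Left multiplication by bounded functions of `H` -/

namespace ErgodicOperator

variable {d : ℕ} {C : ConfigSpace d} {Ω : Type*} [MeasurableSpace Ω] [AddAction (Fin d → ℤ) Ω]
  {P : Measure Ω} (S : ErgodicOperator C Ω P)

theorem isSpectralMeasure_H (ω : Ω) : IsSpectralMeasure (spectralMeasure (S.H ω)) (S.H ω) :=
  isSpectralMeasure_spectralMeasure (S.selfAdjoint ω)

/-- Covariance of the operators passes to their spectral measures by uniqueness of the latter. -/
theorem ae_spectralMeasure_vadd (a : Fin d → ℤ) : ∀ᵐ ω ∂P,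
    spectralMeasure (S.H (a +ᵥ ω)) = (spectralMeasure (S.H ω)).conjUnitary (S.U a) := by
  filter_upwards [S.covariant a] with ω h
  exact ((S.isSpectralMeasure_H ω).conjUnitary (S.U a) h).spectralMeasure_eq

/-- The operator `g(H_ω)` for a bounded Borel function `g`. -/
def fun_H (g : ℝ → ℂ) (ω : Ω) : C.Hil →L[ℂ] C.Hil := (spectralMeasure (S.H ω)).integral g

theorem fun_H_indicator {B : Set ℝ} (hB : MeasurableSet B) :
    S.fun_H (B.indicator 1) = fun ω => (spectralMeasure (S.H ω)).proj B :=
  funext fun _ => PVM.integral_indicator _ hB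

theorem measurable_inner_fun_H {g : ℝ → ℂ} (hg : IsBddMeas g) (f : C.Hil) :
    Measurable fun ω => ⟪f, S.fun_H g ω f⟫_ℂ := by
  refine hg.induction (p := fun g => IsBddMeas g → Measurable fun ω => ⟪f, S.fun_H g ω f⟫_ℂ)
    ?_ ?_ ?_ ?_ hg
  · intro B hB _
    rw [S.fun_H_indicator hB]
    exact S.measurable B hB f
  · intro g h hg hh h1 h2 _
    simp only [fun_H, PVM.integral_add _ hg hh, add_apply, inner_add_right]
    exact (h1 hg).add (h2 hh)
  · intro c g hg h1 _
    simp only [fun_H, PVM.integral_smul _ c hg, smul_apply, inner_smul_right]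
    exact (h1 hg).const_mul c
  · intro u g M hm hM hlim hu hg
    have hub : ∀ n, IsBddMeas (u n) := fun n => ⟨hm n, M, hM n⟩
    refine measurable_of_tendsto_metrizable (fun n => hu n (hub n)) ?_
    refine tendsto_pi_nhds.2 fun ω => ?_
    exact tendsto_const_nhds.inner
      ((spectralMeasure (S.H ω)).tendsto_integral (l := atTop) hub hM hg hlim f)

theorem isBddCovariant_fun_H {g : ℝ → ℂ} (hg : IsBddMeas g) : S.IsBddCovariant (S.fun_H g) where
  measurable f h := by
    rw [funext fun ω => inner_eq_polar (S.fun_H g ω) f h]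
    have hm := fun z => (S.measurable_inner_fun_H hg z).aemeasurable (μ := P)
    exact ((((hm _).sub (hm _)).sub ((hm _).const_mul _)).add ((hm _).const_mul _)).div_const 4
  covariant a := by
    filter_upwards [S.ae_spectralMeasure_vadd a] with ω h f
    rw [fun_H, h, PVM.integral_conjUnitary _ _ hg, LinearIsometryEquiv.symm_apply_apply]
    rfl
  bdd := by
    obtain ⟨M, hM⟩ := hg.bdd
    exact ⟨M, Eventually.of_forall fun ω => ContinuousLinearMap.opNorm_le_bound _
      ((norm_nonneg _).trans (hM 0)) (PVM.norm_integral_le _ hg hM)⟩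

variable [MeasurableConstVAdd (Fin d → ℤ) Ω] [ErgodicVAdd (Fin d → ℤ) Ω P]

/-- Left multiplication by `g(H)`. -/
def leftFun (g : ℝ → ℂ) : S.K2 →L[ℂ] S.K2 := S.leftMul (S.fun_H g)

variable {g h : ℝ → ℂ}

theorem leftFun_toK2 (hg : IsBddMeas g) (A : S.K2pre) :
    S.leftFun g (S.toK2 A) = S.toK2 ((S.isBddCovariant_fun_H hg).preMul A) :=
  (S.isBddCovariant_fun_H hg).leftMul_toK2 A

theorem leftFun_toK2_of_ae (hg : IsBddMeas g) {A D : S.K2pre}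
    (hD : ∀ ω, ∀ f : C.Hc, D.1 ω f = S.fun_H g ω (A.1 ω f)) :
    S.leftFun g (S.toK2 A) = S.toK2 D :=
  (S.isBddCovariant_fun_H hg).leftMul_toK2_of_ae (Eventually.of_forall hD)

theorem leftFun_add (hg : IsBddMeas g) (hh : IsBddMeas h) :
    S.leftFun (g + h) = S.leftFun g + S.leftFun h := by
  refine ContinuousLinearMap.ext fun x => ?_
  obtain ⟨A, rfl⟩ := SeparationQuotient.surjective_mk x
  rw [add_apply, S.leftFun_toK2 hg, S.leftFun_toK2 hh, ← SeparationQuotient.mk_add]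
  refine S.leftFun_toK2_of_ae (hg.add hh) fun ω f => ?_
  rw [fun_H, PVM.integral_add _ hg hh]
  rfl

theorem leftFun_smul (c : ℂ) (hg : IsBddMeas g) : S.leftFun (c • g) = c • S.leftFun g := by
  refine ContinuousLinearMap.ext fun x => ?_
  obtain ⟨A, rfl⟩ := SeparationQuotient.surjective_mk x
  rw [smul_apply, S.leftFun_toK2 hg, ← SeparationQuotient.mk_smul]
  refine S.leftFun_toK2_of_ae (hg.smul c) fun ω f => ?_
  rw [fun_H, PVM.integral_smul _ c hg]
  rfl

theorem leftFun_mul (hg : IsBddMeas g) (hh : IsBddMeas h) :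
    S.leftFun (g * h) = S.leftFun g * S.leftFun h := by
  refine ContinuousLinearMap.ext fun x => ?_
  obtain ⟨A, rfl⟩ := SeparationQuotient.surjective_mk x
  rw [mul_apply_eq_comp, S.leftFun_toK2 hh, S.leftFun_toK2 hg]
  refine S.leftFun_toK2_of_ae (hg.mul hh) fun ω f => ?_
  rw [fun_H, PVM.integral_mul _ hg hh]
  rfl

theorem leftFun_one : S.leftFun 1 = 1 := by
  refine ContinuousLinearMap.ext fun x => ?_
  obtain ⟨A, rfl⟩ := SeparationQuotient.surjective_mk x
  refine S.leftFun_toK2_of_ae IsBddMeas.one fun ω f => ?_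
  rw [fun_H, PVM.integral_one]
  rfl

theorem leftFun_symm (hg : IsBddMeas g) (hreal : ∀ l, starRingEnd ℂ (g l) = g l) (x y : S.K2) :
    ⟪S.leftFun g x, y⟫_ℂ = ⟪x, S.leftFun g y⟫_ℂ := by
  obtain ⟨A, rfl⟩ := SeparationQuotient.surjective_mk x
  obtain ⟨B, rfl⟩ := SeparationQuotient.surjective_mk y
  rw [S.leftFun_toK2 hg, S.leftFun_toK2 hg, inner_toK2, inner_toK2]
  refine integral_congr_ae (Eventually.of_forall fun ω => tsum_congr fun i => ?_)
  rw [IsBddCovariant.preMul_apply, IsBddCovariant.preMul_apply, fun_H,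
    ← ContinuousLinearMap.adjoint_inner_right, PVM.adjoint_integral _ hg]
  simp only [hreal]

theorem enorm_leftFun_sq (hg : IsBddMeas g) (A : S.K2pre) : ‖S.leftFun g (S.toK2 A)‖ₑ ^ 2 =
    ∫⁻ ω, ∑' i, ‖S.fun_H g ω (A.1 ω (C.chiHc 0 (C.basis i)))‖ₑ ^ 2 ∂P := by
  rw [S.leftFun_toK2 hg, enorm_toK2_sq]
  rfl

theorem aemeasurable_fun_H (hg : IsBddMeas g) (A : S.K2pre) (f : C.Hc) :
    AEMeasurable (fun ω => ‖S.fun_H g ω (A.1 ω f)‖ₑ ^ 2) P :=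
  (((S.isBddCovariant_fun_H hg).preMul A).2.1.aestronglyMeasurable f).enorm.pow_const 2

/-- The spectral measure of left multiplication by `H`. -/
def leftPVM : PVM ℝ S.K2 := by
  classical
  exact PVM.ofNormSq (fun B => if MeasurableSet B then S.leftFun (B.indicator 1) else 0)
    (fun B hB => if_neg hB)
    (fun B x y => by
      by_cases hB : MeasurableSet B
      · rw [if_pos hB]
        refine S.leftFun_symm (IsBddMeas.indicator_one hB) (fun l => ?_) x y
        by_cases hl : l ∈ B <;> simp [hl]
      · rw [if_neg hB]
        simp)
    (by rw [if_pos MeasurableSet.univ, Set.indicator_univ, S.leftFun_one])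
    (fun B D hB hD => by
      rw [if_pos hB, if_pos hD, if_pos (hB.inter hD),
        ← S.leftFun_mul (IsBddMeas.indicator_one hB) (IsBddMeas.indicator_one hD),
        indicator_one_mul_indicator_one])
    (fun f hf hd x => by
      obtain ⟨A, rfl⟩ := SeparationQuotient.surjective_mk x
      have hb : ∀ n, IsBddMeas ((f n).indicator (1 : ℝ → ℂ)) := fun n =>
        IsBddMeas.indicator_one (hf n)
      have hU := MeasurableSet.iUnion hf
      rw [if_pos hU]
      -- The squared norm is the expectation of a sum of scalar spectral measures of `H_ω`, each
      -- countably additive; the sums and the expectation may be exchanged because all terms are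
      -- nonnegative.
      refine (S.enorm_leftFun_sq (IsBddMeas.indicator_one hU) A).trans ?_
      have h1 : ∀ n, ‖(if MeasurableSet (f n) then S.leftFun ((f n).indicator 1) else 0)
          (S.toK2 A)‖ₑ ^ 2 =
          ∫⁻ ω, ∑' i, ‖S.fun_H ((f n).indicator 1) ω (A.1 ω (C.chiHc 0 (C.basis i)))‖ₑ ^ 2 ∂P :=
        fun n => by
          rw [if_pos (hf n)]
          exact S.enorm_leftFun_sq (hb n) A
      refine Eq.trans ?_ (tsum_congr h1).symm
      rw [← lintegral_tsum fun n => AEMeasurable.tsum fun i => S.aemeasurable_fun_H (hb n) A _]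
      refine lintegral_congr fun ω => ?_
      rw [ENNReal.tsum_comm]
      refine tsum_congr fun i => ?_
      simp only [S.fun_H_indicator hU, fun n => S.fun_H_indicator (hf n)]
      simp only [← PVM.measure_apply _ hU, fun n => (PVM.measure_apply (spectralMeasure (S.H ω))
        (hf n) (A.1 ω (C.chiHc 0 (C.basis i)))).symm]
      exact measure_iUnion hd hf)

theorem leftPVM_proj {B : Set ℝ} (hB : MeasurableSet B) :
    S.leftPVM.proj B = S.leftFun (B.indicator 1) := if_pos hB

/-- Dominated convergence twice, in the basis sum at fixed ω and then in ω. The majorant is (M+N)²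
times the Hilbert-Schmidt density of `A`. -/
theorem tendsto_leftFun {u : ℕ → ℝ → ℂ} {M : ℝ} (hu : ∀ n, IsBddMeas (u n))
    (hM : ∀ n l, ‖u n l‖ ≤ M) (hg : IsBddMeas g)
    (hlim : ∀ l, Tendsto (fun n => u n l) atTop (𝓝 (g l))) (x : S.K2) :
    Tendsto (fun n => S.leftFun (u n) x) atTop (𝓝 (S.leftFun g x)) := by
  obtain ⟨A, rfl⟩ := SeparationQuotient.surjective_mk x
  obtain ⟨N, hN⟩ := hg.bdd
  have hug : ∀ n, IsBddMeas (u n - g) := fun n => (hu n).sub hg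
  have hb : ∀ n l, ‖(u n - g) l‖ ≤ M + N := fun n l =>
    (norm_sub_le _ _).trans (add_le_add (hM n l) (hN l))
  have hB0 : 0 ≤ M + N := (norm_nonneg _).trans (hb 0 0)
  have hle : ∀ n ω (v : C.Hil), ‖S.fun_H (u n - g) ω v‖ₑ ^ 2 ≤ ‖M + N‖ₑ ^ 2 * ‖v‖ₑ ^ 2 := by
    intro n ω v
    rw [← mul_pow, ← enorm_norm v, ← enorm_mul]
    refine pow_le_pow_left' ?_ 2
    rw [enorm_le_iff_norm_le, Real.norm_of_nonneg (mul_nonneg hB0 (norm_nonneg _))]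
    exact PVM.norm_integral_le _ (hug n) (hb n) v
  have hsub : ∀ n, S.leftFun (u n) (S.toK2 A) - S.leftFun g (S.toK2 A) =
      S.leftFun (u n - g) (S.toK2 A) := fun n => by
    rw [sub_eq_iff_eq_add, ← add_apply, ← S.leftFun_add (hug n) hg, sub_add_cancel]
  have hsq : Tendsto (fun n => ‖S.leftFun (u n - g) (S.toK2 A)‖ₑ ^ 2) atTop (𝓝 0) := by
    simp only [fun n => S.enorm_leftFun_sq (hug n) A]
    have h := tendsto_lintegral_of_dominated_convergence' (μ := P) (f := fun _ => 0)
      (F := fun n ω => ∑' i, ‖S.fun_H (u n - g) ω (A.1 ω (C.chiHc 0 (C.basis i)))‖ₑ ^ 2)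
      (fun ω => ∑' i, ‖M + N‖ₑ ^ 2 * ‖A.1 ω (C.chiHc 0 (C.basis i))‖ₑ ^ 2)
      (fun n => AEMeasurable.tsum fun i => S.aemeasurable_fun_H (hug n) A _)
      (fun n => Eventually.of_forall fun ω => ENNReal.tsum_le_tsum fun i => hle n ω _) ?_ ?_
    · simpa using h
    · simp only [ENNReal.tsum_mul_left]
      rw [lintegral_const_mul' _ _ (by simp)]
      exact ENNReal.mul_ne_top (by simp) A.2.2.2.2.ne
    · filter_upwards [K2pre.ae_summable A] with ω hω
      refine tendsto_tsum_enorm_zero (b := fun i => ‖M + N‖ₑ ^ 2 * ‖A.1 ω (C.chiHc 0 (C.basis i))‖ₑ ^ 2)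
        ?_ (fun n i => hle n ω _) fun i => ?_
      · rw [ENNReal.tsum_mul_left]
        exact ENNReal.mul_ne_top (by simp) hω.ne
      · have h0 := (spectralMeasure (S.H ω)).tendsto_integral (l := atTop) hug hb
          (IsBddMeas.const 0) (fun l => by
            have := (hlim l).sub_const (g l)
            rwa [sub_self] at this) (A.1 ω (C.chiHc 0 (C.basis i)))
        have hz : (spectralMeasure (S.H ω)).integral (fun _ => (0 : ℂ)) = 0 := by
          have := (spectralMeasure (S.H ω)).integral_smul 0 IsBddMeas.one
          rw [zero_smul, zero_smul] at this
          exact this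
        rw [hz] at h0
        have h1 := (ENNReal.continuous_pow 2).tendsto _ |>.comp
          ((continuous_enorm.tendsto _).comp h0)
        rw [zero_apply, enorm_zero, zero_pow two_ne_zero] at h1
        exact h1
  refine tendsto_iff_norm_sub_tendsto_zero.2 ?_
  simp only [hsub]
  have h2 := (ENNReal.continuousAt_toReal ENNReal.zero_ne_top).tendsto.comp hsq
  have h3 := (Real.continuous_sqrt.tendsto _).comp h2
  simpa [Function.comp_def, Real.sqrt_sq] using h3

theorem leftFun_eq_integral [CompleteSpace S.K2] (hg : IsBddMeas g) :
    S.leftFun g = S.leftPVM.integral g :=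
  S.leftPVM.eq_integral (Φ := S.leftFun) (fun _ hB => (S.leftPVM_proj hB).symm)
    (fun _ _ hf hg => S.leftFun_add hf hg) (fun c _ hf => S.leftFun_smul c hf)
    (fun _ _ _ hu hM hf hl x => S.tendsto_leftFun hu hM hf hl x) hg

end ErgodicOperator

/-! ### Antiunitary images of projection-valued measures -/

namespace PVM

variable {α : Type*} [MeasurableSpace α] {K : Type*} [NormedAddCommGroup K] [InnerProductSpace ℂ K]

theorem inner_symm_left (J : K ≃ₗᵢ⋆[ℂ] K) (x y : K) : ⟪x, J y⟫_ℂ = ⟪y, J.symm x⟫_ℂ := by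
  have h := inner_map_map_of_conj J (J.symm x) y
  rwa [J.apply_symm_apply] at h

/-- The image of a projection-valued measure under an antiunitary operator. -/
def conjAnti (E : PVM α K) (J : K ≃ₗᵢ⋆[ℂ] K) : PVM α K where
  proj B := conjBy J (E.proj B)
  not_measurable B hB := by ext x; simp [conjBy_apply, E.not_measurable B hB]
  symm B x y := by
    rw [conjBy_apply, conjBy_apply, inner_symm_left, E.symm, ← inner_conj_symm, inner_symm_left,
      inner_conj_symm]
  univ := by ext x; simp [conjBy_apply, E.univ]
  inter B C hB hC := by ext x; simp [conjBy_apply, E.inter B C hB hC]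
  iUnion f hf hd x := (E.iUnion f hf hd (J.symm x)).map (J : K →SL[starRingEnd ℂ] K) J.continuous

theorem conjAnti_proj (E : PVM α K) (J : K ≃ₗᵢ⋆[ℂ] K) (B : Set α) :
    (E.conjAnti J).proj B = conjBy J (E.proj B) := rfl

theorem measure_conjAnti (E : PVM α K) (J : K ≃ₗᵢ⋆[ℂ] K) (x : K) :
    (E.conjAnti J).measure x = E.measure (J.symm x) := by
  ext B hB
  rw [measure_apply _ hB, measure_apply _ hB, conjAnti_proj, conjBy_apply,
    LinearIsometryEquiv.enorm_map]

theorem integral_conjAnti [CompleteSpace K] (E : PVM α K) (J : K ≃ₗᵢ⋆[ℂ] K) {f : α → ℂ}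
    (hf : IsBddMeas f) :
    (E.conjAnti J).integral f = conjBy J (E.integral fun a => starRingEnd ℂ (f a)) := by
  refine integral_eq hf fun x => ?_
  rw [measure_conjAnti, conjBy_apply, inner_symm_left, ← inner_conj_symm, E.inner_integral hf.conj,
    ← integral_conj]
  simp

end PVM

/-! ### Right multiplication by functions of `H`, and the spectral measures of ℋ_L and ℋ_R -/

namespace ErgodicOperator

variable {d : ℕ} {C : ConfigSpace d} {Ω : Type*} [MeasurableSpace Ω] [AddAction (Fin d → ℤ) Ω]
  {P : Measure Ω} (S : ErgodicOperator C Ω P) [MeasurableConstVAdd (Fin d → ℤ) Ω]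
  [ErgodicVAdd (Fin d → ℤ) Ω P]

omit [MeasurableConstVAdd (Fin d → ℤ) Ω] [ErgodicVAdd (Fin d → ℤ) Ω P] in
theorem adjoint_fun_H {g : ℝ → ℂ} (hg : IsBddMeas g) (ω : Ω) :
    (S.fun_H g ω).adjoint = S.fun_H (fun l => starRingEnd ℂ (g l)) ω :=
  PVM.adjoint_integral _ hg

/-- The spectral measure of right multiplication by `H`. -/
def rightPVM : PVM ℝ S.K2 := S.leftPVM.conjAnti S.conjugation

/-- Two complex conjugations cancel: one from the adjoint of g(H) in passing from right to left
multiplication, the other from the antiunitary. So ℋ_R keeps the sign of `H`. -/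
theorem rightMul_fun_H [CompleteSpace S.K2] {g : ℝ → ℂ} (hg : IsBddMeas g) :
    S.rightMul (S.fun_H g) = S.rightPVM.integral g := by
  rw [(S.isBddCovariant_fun_H hg).rightMul_eq, rightPVM, PVM.integral_conjAnti _ _ hg,
    ← S.leftFun_eq_integral hg.conj, leftFun]
  congr 2
  exact funext fun ω => S.adjoint_fun_H hg ω

theorem evolutionL_eq [CompleteSpace S.K2] (t : ℝ) : S.evolutionL t = S.leftPVM.unitary t :=
  S.leftFun_eq_integral (isBddMeas_exp t)

theorem evolutionR_eq [CompleteSpace S.K2] (t : ℝ) : S.evolutionR t = S.rightPVM.unitary t :=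
  S.rightMul_fun_H (isBddMeas_exp t)

theorem isSpectralMeasure_HL [CompleteSpace S.K2] : IsSpectralMeasure S.leftPVM S.HL := by
  rw [HL, funext S.evolutionL_eq]
  exact S.leftPVM.isSpectralMeasure_stoneGenerator

theorem isSpectralMeasure_HR [CompleteSpace S.K2] : IsSpectralMeasure S.rightPVM S.HR := by
  rw [HR, funext S.evolutionR_eq]
  exact S.rightPVM.isSpectralMeasure_stoneGenerator

/-- The criterion for `D = A ⊙_R B`. -/
theorem IsBddCovariant.rightMul_toK2_of_ae {S : ErgodicOperator C Ω P} {B : Ω → C.Hil →L[ℂ] C.Hil}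
    (hB : S.IsBddCovariant B) {A D : S.K2pre} (h : ∀ᵐ ω ∂P, ∀ f g : C.Hc,
      ⟪D.1 ω f, (g : C.Hil)⟫_ℂ = ⟪B ω f, ConfigSpace.dagger (A.1 ω) g⟫_ℂ) :
    S.rightMul B (S.toK2 A) = S.toK2 D := by
  rw [hB.rightMul_toK2]
  refine toK2_congr ?_
  filter_upwards [h, hB.inner_preDagger_preMul A] with ω h1 h2
  exact LinearMap.ext fun f => C.eq_of_inner_Hc fun g => (h2 f g).trans (h1 f g).symm

theorem IsBddCovariant.exists_rightMul_toK2 {S : ErgodicOperator C Ω P}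
    {B : Ω → C.Hil →L[ℂ] C.Hil} (hB : S.IsBddCovariant B) (A : S.K2pre) : ∃ D : S.K2pre,
    S.rightMul B (S.toK2 A) = S.toK2 D ∧ ∀ᵐ ω ∂P, ∀ f g : C.Hc,
      ⟪D.1 ω f, (g : C.Hil)⟫_ℂ = ⟪B ω f, ConfigSpace.dagger (A.1 ω) g⟫_ℂ :=
  ⟨_, hB.rightMul_toK2 A, hB.inner_preDagger_preMul A⟩

omit [MeasurableConstVAdd (Fin d → ℤ) Ω] [ErgodicVAdd (Fin d → ℤ) Ω P] in
theorem dagger_eq_adjoint {A : C.Hc →ₗ[ℂ] C.Hil} {T : C.Hil →L[ℂ] C.Hil} (hA : C.RowBdd A)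
    (hT : ∀ f : C.Hc, A f = T f) (g : C.Hc) : ConfigSpace.dagger A g = T.adjoint g :=
  C.eq_of_inner_Hc fun k => by
    rw [hA.inner_dagger, hT, ContinuousLinearMap.adjoint_inner_left]

/-- Left and right multiplications commute on operators that are bounded on the whole space. -/
theorem leftMul_rightMul_comm {S : ErgodicOperator C Ω P} {B B' : Ω → C.Hil →L[ℂ] C.Hil}
    (hB : S.IsBddCovariant B) (hB' : S.IsBddCovariant B') {A : S.K2pre}
    (hA : ∀ᵐ ω ∂P, ∃ T : C.Hil →L[ℂ] C.Hil, ∀ f : C.Hc, A.1 ω f = T f) :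
    S.leftMul B (S.rightMul B' (S.toK2 A)) = S.rightMul B' (S.leftMul B (S.toK2 A)) := by
  obtain ⟨D, hD1, hD2⟩ := hB'.exists_rightMul_toK2 A
  have h : S.rightMul B' (S.toK2 (hB.preMul A)) = S.toK2 (hB.preMul D) := by
    refine hB'.rightMul_toK2_of_ae ?_
    filter_upwards [hA, hD2, K2pre.rowBdd A, K2pre.rowBdd (hB.preMul A)] with ω hω h1 h3 h4 f g
    obtain ⟨T, hT⟩ := hω
    -- When A extends to a bounded `T`, the product A‡*B' is the ordinary product TB', and the claim
    -- is associativity.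
    have h5 : D.1 ω f = T (B' ω f) := C.eq_of_inner_Hc fun k => by
      rw [h1, dagger_eq_adjoint h3 hT, ContinuousLinearMap.adjoint_inner_right]
    have h6 : ∀ k : C.Hc, (hB.preMul A).1 ω k = (B ω).comp T k := fun k => by
      rw [hB.preMul_apply, hT, ContinuousLinearMap.comp_apply]
    rw [hB.preMul_apply, h5, dagger_eq_adjoint h4 h6, ContinuousLinearMap.adjoint_inner_right,
      ContinuousLinearMap.comp_apply]
  rw [hD1, hB.leftMul_toK2 D, hB.leftMul_toK2 A, h]

end ErgodicOperator

namespace ErgodicOperator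

/-! ## Covariant operators from their column at the origin -/

section Block

variable {d : ℕ} {C : ConfigSpace d} {Ω : Type*} [MeasurableSpace Ω] [AddAction (Fin d → ℤ) Ω]
  {P : Measure Ω} (S : ErgodicOperator C Ω P)

/-- The representation is only projective, so U(0) is a scalar that need not be 1. It cancels
wherever `U` acts by conjugation. -/
theorem exists_U_zero : ∃ c : ℂ, c ≠ 0 ∧ ∀ f, S.U 0 f = c • f := by
  obtain ⟨c, hc, h⟩ := S.U_add 0 0
  have hc0 : c ≠ 0 := fun e => by simp [e] at hc
  refine ⟨c⁻¹, inv_ne_zero hc0, fun f => ?_⟩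
  have h1 := h f
  rw [add_zero, ← map_smul, (S.U 0).injective.eq_iff] at h1
  conv_rhs => rw [h1, smul_smul, inv_mul_cancel₀ hc0, one_smul]

theorem exists_U_add_symm (c a : Fin d → ℤ) : ∃ p : ℂ, p ≠ 0 ∧
    (∀ f, S.U (a + c) f = p • S.U c (S.U a f)) ∧
      ∀ f, (S.U (a + c)).symm (S.U c f) = p⁻¹ • (S.U a).symm f := by
  obtain ⟨p, hp, h⟩ := S.U_add c a
  have hp0 : p ≠ 0 := fun e => by simp [e] at hp
  rw [add_comm] at h
  refine ⟨p, hp0, h, fun f => ?_⟩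
  rw [LinearIsometryEquiv.symm_apply_eq, map_smul, h, LinearIsometryEquiv.apply_symm_apply,
    smul_smul, inv_mul_cancel₀ hp0, one_smul]

/-- The restriction of `U a` to the functions of compact support. -/
def UHc (a : Fin d → ℤ) : C.Hc →ₗ[ℂ] C.Hc :=
  (S.U a).toLinearMap.restrict fun _ hf => S.U_mem a hf

/-- The columns of a covariant operator, from its column at the origin. -/
def blockCol (T : Ω → C.Hil →L[ℂ] C.Hil) (ω : Ω) (a : Fin d → ℤ) : C.Hil →ₗ[ℂ] C.Hil :=
  (S.U a).toLinearMap ∘ₗ (T (-a +ᵥ ω)).toLinearMap ∘ₗ (S.U a).symm.toLinearMap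

theorem blockCol_apply (T : Ω → C.Hil →L[ℂ] C.Hil) (ω : Ω) (a : Fin d → ℤ) (f : C.Hil) :
    S.blockCol T ω a f = S.U a (T (-a +ᵥ ω) ((S.U a).symm f)) := rfl

omit S [MeasurableSpace Ω] [AddAction (Fin d → ℤ) Ω] P in
theorem hasFiniteSupport_chi (F : (Fin d → ℤ) → C.Hil →ₗ[ℂ] C.Hil) (f : C.Hc) :
    Function.HasFiniteSupport fun a => F a (C.chi a f) := by
  obtain ⟨s, hs⟩ := C.exists_finset_of_mem_Hc f.2
  refine s.finite_toSet.subset fun a ha => ?_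
  by_contra h
  exact ha (by simp only [hs a h, map_zero])

/-- The covariant operator with a given column at the origin. -/
def blockOp (T : Ω → C.Hil →L[ℂ] C.Hil) (ω : Ω) : C.Hc →ₗ[ℂ] C.Hil where
  toFun f := ∑ᶠ a, S.blockCol T ω a (C.chi a f)
  map_add' f g := by
    rw [← finsum_add_distrib (hasFiniteSupport_chi _ f) (hasFiniteSupport_chi _ g)]
    simp
  map_smul' c f := by
    rw [RingHom.id_apply, smul_finsum' c (hasFiniteSupport_chi _ f)]
    simp

theorem blockOp_eq_sum (T : Ω → C.Hil →L[ℂ] C.Hil) (ω : Ω) {f : C.Hc} {s : Finset (Fin d → ℤ)}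
    (hs : ∀ a ∉ s, C.chi a f = 0) : S.blockOp T ω f = ∑ a ∈ s, S.blockCol T ω a (C.chi a f) := by
  refine finsum_eq_sum_of_support_subset _ fun a ha => ?_
  by_contra h
  exact ha (by simp only [hs a h, map_zero])

theorem blockOp_chiHc (T : Ω → C.Hil →L[ℂ] C.Hil) (ω : Ω) (a : Fin d → ℤ) (f : C.Hil) :
    S.blockOp T ω (C.chiHc a f) = S.blockCol T ω a (C.chi a f) := by
  rw [S.blockOp_eq_sum T ω (s := {a}) fun b hb => C.chi_chi_of_ne (by simpa using hb) f,
    Finset.sum_singleton, C.coe_chiHc, C.chi_chi_self]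

theorem blockOp_chiHc_zero (T : Ω → C.Hil →L[ℂ] C.Hil) (ω : Ω) (f : C.Hil) :
    S.blockOp T ω (C.chiHc 0 f) = T ω (C.chi 0 f) := by
  obtain ⟨c, hc, h⟩ := S.exists_U_zero
  have h2 : (S.U 0).symm (C.chi 0 f) = c⁻¹ • C.chi 0 f := by
    rw [LinearIsometryEquiv.symm_apply_eq, h, smul_smul, mul_inv_cancel₀ hc, one_smul]
  rw [S.blockOp_chiHc, S.blockCol_apply, h2, h, map_smul, smul_smul, mul_inv_cancel₀ hc, one_smul,
    neg_zero, zero_vadd]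

/-- Checked column by column; the phase of U(a+c) cancels against its inverse. -/
theorem isCovariantOp_blockOp (T : Ω → C.Hil →L[ℂ] C.Hil) : S.IsCovariantOp (S.blockOp T) := by
  refine fun c => Eventually.of_forall fun ω => ?_
  have key : (S.blockOp T (c +ᵥ ω)).comp (S.UHc c) = (S.U c).toLinearMap.comp (S.blockOp T ω) := by
    refine C.linearMap_ext_chiHc fun a f => ?_
    have h1 : S.UHc c (C.chiHc a f) = C.chiHc (a + c) (S.U c f) := Subtype.ext (S.U_chi c a f)
    obtain ⟨p, hp0, h2, h3⟩ := S.exists_U_add_symm c a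
    rw [LinearMap.comp_apply, LinearMap.comp_apply, h1, S.blockOp_chiHc, S.blockOp_chiHc,
      S.blockCol_apply, S.blockCol_apply, ← S.U_chi, h3, h2, vadd_vadd,
      show -(a + c) + c = -a by abel, map_smul, map_smul, map_smul, smul_smul, mul_inv_cancel₀ hp0,
      one_smul]
    rfl
  intro f g hfg
  rw [show g = S.UHc c f from Subtype.ext hfg]
  exact LinearMap.congr_fun key f

theorem colBdd_blockOp (T : Ω → C.Hil →L[ℂ] C.Hil) (ω : Ω) : C.ColBdd (S.blockOp T ω) := by
  refine fun a => ⟨‖T (-a +ᵥ ω)‖, fun f => ?_⟩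
  rw [S.blockOp_chiHc, S.blockCol_apply, LinearIsometryEquiv.norm_map]
  refine ((T _).le_opNorm _).trans (mul_le_mul_of_nonneg_left ?_ (norm_nonneg _))
  rw [LinearIsometryEquiv.norm_map]
  exact C.norm_chi_le a f

theorem hsNormSq_blockOp (T : Ω → C.Hil →L[ℂ] C.Hil) : S.hsNormSq (S.blockOp T) =
    ∫⁻ ω, ∑' i, ‖T ω (C.chi 0 (C.basis i))‖ₑ ^ 2 ∂P := by
  simp only [hsNormSq, S.blockOp_chiHc_zero]

variable [MeasurableConstVAdd (Fin d → ℤ) Ω] [ErgodicVAdd (Fin d → ℤ) Ω P]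

theorem isMeasurableOp_blockOp {T : Ω → C.Hil →L[ℂ] C.Hil}
    (hT : ∀ f, AEStronglyMeasurable (fun ω => T ω f) P) : S.IsMeasurableOp (S.blockOp T) := by
  intro f
  obtain ⟨s, hs⟩ := C.exists_finset_of_mem_Hc f.2
  simp only [S.blockOp_eq_sum T _ hs, S.blockCol_apply, inner_sum]
  refine Finset.aemeasurable_fun_sum s fun a _ => ?_
  refine (aestronglyMeasurable_const.inner ((S.U a).continuous.comp_aestronglyMeasurable ?_)).aemeasurable
  exact (hT _).comp_quasiMeasurePreserving (measurePreserving_vadd (-a) P).quasiMeasurePreserving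

theorem blockOp_mem_K2pre {T : Ω → C.Hil →L[ℂ] C.Hil}
    (hT : ∀ f, AEStronglyMeasurable (fun ω => T ω f) P)
    (hf : ∫⁻ ω, ∑' i, ‖T ω (C.chi 0 (C.basis i))‖ₑ ^ 2 ∂P < ∞) : S.blockOp T ∈ S.K2pre :=
  mem_K2pre (S.isMeasurableOp_blockOp hT) (S.isCovariantOp_blockOp T)
    (Eventually.of_forall (S.colBdd_blockOp T)) (by rwa [S.hsNormSq_blockOp])

end Block

variable {d : ℕ} {C : ConfigSpace d} {Ω : Type*} [MeasurableSpace Ω] [AddAction (Fin d → ℤ) Ω]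
  {P : Measure Ω} (S : ErgodicOperator C Ω P)

/-! ### Completeness -/

theorem aestronglyMeasurable_col (A : S.K2pre) (f : C.Hil) :
    AEStronglyMeasurable (fun ω => C.col (A.1 ω) 0 f) P := by
  refine (A.2.1.aestronglyMeasurable (C.chiHc 0 f)).congr ?_
  filter_upwards [K2pre.colBdd A] with ω h
  rw [h.col_apply]

/-- If the N-th increment is at most 4⁻ᴺ in 𝒦₂, the squared increments weighted by 4ᴺ have summable
expectation. So almost surely the increments of the columns are O(2⁻ᴺ) in operator norm. -/
theorem ae_tendsto_col {u : ℕ → S.K2pre}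
    (hu : ∀ N, ‖u (N + 1) - u N‖ₑ ≤ ENNReal.ofReal ((1 / 4) ^ N)) :
    ∀ᵐ ω ∂P, ∃ T : C.Hil →L[ℂ] C.Hil, Tendsto (fun n => C.col ((u n).1 ω) 0) atTop (𝓝 T) := by
  have hm : ∀ A : S.K2pre, AEMeasurable
      (fun ω => ∑' i, ‖A.1 ω (C.chiHc 0 (C.basis i))‖ₑ ^ 2) P := fun A =>
    AEMeasurable.tsum fun i => (A.2.1.aestronglyMeasurable _).enorm.pow_const 2
  have hfin : ∫⁻ ω, ∑' N : ℕ, ENNReal.ofReal (4 ^ N) *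
      ∑' i, ‖(u (N + 1) - u N).1 ω (C.chiHc 0 (C.basis i))‖ₑ ^ 2 ∂P < ∞ := by
    rw [lintegral_tsum fun N => (hm _).const_mul _]
    refine lt_of_le_of_lt (ENNReal.tsum_le_tsum (g := fun N => ENNReal.ofReal ((1 / 4) ^ N))
      fun N => ?_) ?_
    · rw [lintegral_const_mul' _ _ ENNReal.ofReal_ne_top]
      have h1 : S.hsNormSq (u (N + 1) - u N).1 ≤ ENNReal.ofReal ((1 / 4) ^ N) ^ 2 := by
        rw [← K2pre.enorm_sq]
        exact pow_le_pow_left' (hu N) 2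
      refine (mul_le_mul_right h1 _).trans ?_
      rw [← ENNReal.ofReal_pow (by positivity), ← ENNReal.ofReal_mul (by positivity)]
      refine ENNReal.ofReal_le_ofReal (le_of_eq ?_)
      rw [← pow_mul, mul_comm N 2, pow_mul, ← mul_pow]
      norm_num
    · rw [← ENNReal.ofReal_tsum_of_nonneg (fun _ => by positivity)
        (summable_geometric_of_lt_one (by norm_num) (by norm_num))]
      exact ENNReal.ofReal_lt_top
  filter_upwards [ae_lt_top' (AEMeasurable.tsum fun N => (hm _).const_mul _) hfin.ne,
    ae_all_iff.2 fun n => K2pre.colBdd (u n)] with ω h1 h2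
  set s := ∑' N : ℕ, ENNReal.ofReal (4 ^ N) *
      ∑' i, ‖(u (N + 1) - u N).1 ω (C.chiHc 0 (C.basis i))‖ₑ ^ 2
  refine cauchySeq_tendsto_of_complete (cauchySeq_of_le_geometric (1 / 2) (√s.toReal) (by norm_num)
    fun N => ?_)
  rw [dist_comm, dist_eq_norm]
  refine ContinuousLinearMap.opNorm_le_bound _ (by positivity) fun x => ?_
  have hcol : C.ColBdd ((u (N + 1) - u N).1 ω) := (h2 (N + 1)).sub (h2 N)
  have e : (C.col ((u (N + 1)).1 ω) 0 - C.col ((u N).1 ω) 0) x =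
      C.col ((u (N + 1) - u N).1 ω) 0 x := by
    rw [sub_apply, (h2 _).col_apply, (h2 _).col_apply, hcol.col_apply]
    rfl
  rw [e]
  have h3 := enorm_apply_sq_le_hsSq C.basis (C.col ((u (N + 1) - u N).1 ω) 0) x
  rw [hcol.hsSq_col] at h3
  have h4 : ENNReal.ofReal (4 ^ N) * ‖C.col ((u (N + 1) - u N).1 ω) 0 x‖ₑ ^ 2 ≤ s * ‖x‖ₑ ^ 2 := by
    refine (mul_le_mul_right h3 _).trans ?_
    rw [← mul_assoc]
    exact mul_le_mul_left (ENNReal.le_tsum N) _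
  have h5 := ENNReal.toReal_mono (ENNReal.mul_ne_top h1.ne (by simp)) h4
  simp only [ENNReal.toReal_mul, ENNReal.toReal_pow, toReal_enorm] at h5
  rw [ENNReal.toReal_ofReal (by positivity)] at h5
  refine abs_le_of_sq_le_sq' ?_ (by positivity) |>.2
  have h6 : (2 : ℝ) ^ N * 2 ^ N = 4 ^ N := by rw [← mul_pow]; norm_num
  have h7 : (1 / 2 : ℝ) ^ N * 2 ^ N = 1 := by rw [← mul_pow]; norm_num
  rw [mul_pow, mul_pow, Real.sq_sqrt ENNReal.toReal_nonneg]
  have h8 : (0 : ℝ) ≤ ((1 / 2) ^ N) ^ 2 := by positivity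
  have h9 := mul_le_mul_of_nonneg_left h5 h8
  calc _ = ((1 / 2 : ℝ) ^ N * 2 ^ N) ^ 2 * ‖C.col ((u (N + 1) - u N).1 ω) 0 x‖ ^ 2 := by
        rw [h7]; ring
    _ = ((1 / 2) ^ N) ^ 2 * (4 ^ N * ‖C.col ((u (N + 1) - u N).1 ω) 0 x‖ ^ 2) := by rw [← h6]; ring
    _ ≤ _ := h9
    _ = _ := by ring

/-- Fatou's lemma for the Hilbert-Schmidt norm. -/
theorem lintegral_hs_sub_le {u : ℕ → S.K2pre} {T : Ω → C.Hil →L[ℂ] C.Hil}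
    (hT : ∀ᵐ ω ∂P, Tendsto (fun n => C.col ((u n).1 ω) 0) atTop (𝓝 (T ω))) (A : S.K2pre)
    {c : ℝ≥0∞} (hc : ∀ᶠ n in atTop, ‖A - u n‖ₑ ≤ c) :
    ∫⁻ ω, ∑' i, ‖A.1 ω (C.chiHc 0 (C.basis i)) - T ω (C.chi 0 (C.basis i))‖ₑ ^ 2 ∂P ≤ c ^ 2 := by
  have hmA := fun i => A.2.1.aestronglyMeasurable (C.chiHc 0 (C.basis i))
  have hlim : ∀ᵐ ω ∂P, ∀ f, Tendsto (fun n => (u n).1 ω (C.chiHc 0 f)) atTop (𝓝 (T ω (C.chi 0 f))) := by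
    filter_upwards [hT, ae_all_iff.2 fun n => K2pre.colBdd (u n)] with ω h1 h2 f
    have h3 := ((ContinuousLinearMap.apply ℂ C.Hil (C.chi 0 f)).continuous.tendsto _).comp h1
    refine h3.congr fun n => ?_
    rw [Function.comp_apply, ContinuousLinearMap.apply_apply, (h2 n).col_apply, C.chiHc_chi_self]
  have hmT : ∀ i, AEStronglyMeasurable (fun ω => T ω (C.chi 0 (C.basis i))) P := fun i => by
    refine aestronglyMeasurable_of_tendsto_ae atTop
      (fun n => (u n).2.1.aestronglyMeasurable (C.chiHc 0 (C.basis i))) ?_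
    filter_upwards [hlim] with ω h
    exact h _
  have hmd : ∀ i, AEMeasurable (fun ω =>
      ‖A.1 ω (C.chiHc 0 (C.basis i)) - T ω (C.chi 0 (C.basis i))‖ₑ ^ 2) P := fun i =>
    ((hmA i).sub (hmT i)).enorm.pow_const 2
  -- The columns converge in operator norm, not in Hilbert-Schmidt norm, so Fatou is applied to
  -- finite partial sums over the basis.
  rw [lintegral_tsum hmd, ENNReal.tsum_eq_iSup_sum]
  refine iSup_le fun s => ?_
  rw [← lintegral_finsetSum' s fun i _ => hmd i]
  have h1 : ∫⁻ ω, ∑ i ∈ s, ‖A.1 ω (C.chiHc 0 (C.basis i)) - T ω (C.chi 0 (C.basis i))‖ₑ ^ 2 ∂P =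
      ∫⁻ ω, liminf (fun n => ∑ i ∈ s, ‖(A - u n).1 ω (C.chiHc 0 (C.basis i))‖ₑ ^ 2) atTop ∂P := by
    refine lintegral_congr_ae ?_
    filter_upwards [hlim] with ω h
    refine (Tendsto.liminf_eq (tendsto_finsetSum s fun i _ => ?_)).symm
    exact ((ENNReal.continuous_pow 2).tendsto _).comp ((continuous_enorm.tendsto _).comp
      (tendsto_const_nhds.sub (h (C.basis i))))
  rw [h1]
  refine (lintegral_liminf_le' fun n => Finset.aemeasurable_fun_sum s fun i _ =>
    ((A - u n).2.1.aestronglyMeasurable _).enorm.pow_const 2).trans ?_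
  refine liminf_le_of_frequently_le' (hc.mono fun n hn => ?_).frequently
  refine le_trans ?_ (pow_le_pow_left' hn 2)
  rw [K2pre.enorm_sq]
  exact lintegral_mono fun ω => ENNReal.sum_le_tsum s

variable [MeasurableConstVAdd (Fin d → ℤ) Ω] [ErgodicVAdd (Fin d → ℤ) Ω P]

/-- Along a fast Cauchy sequence the columns at the origin converge almost surely, and `blockOp` of
the limit column is the limit operator. Only this one column enters the norm, so Fatou gives
convergence. -/
instance completeSpace_K2pre : CompleteSpace S.K2pre := by
  refine Metric.complete_of_convergent_controlled_sequences (fun N => (1 / 4) ^ N)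
    (fun _ => by positivity) fun u hu => ?_
  have hu' : ∀ N n, N ≤ n → ‖u N - u n‖ₑ ≤ ENNReal.ofReal ((1 / 4) ^ N) := fun N n h => by
    rw [← ofReal_norm, ← dist_eq_norm]
    exact ENNReal.ofReal_le_ofReal (hu N N n le_rfl h).le
  have hex := S.ae_tendsto_col (u := u) fun N => by
    rw [← enorm_neg, neg_sub]
    exact hu' N (N + 1) N.le_succ
  let T : Ω → C.Hil →L[ℂ] C.Hil := fun ω => limUnder atTop fun n => C.col ((u n).1 ω) 0
  have hT : ∀ᵐ ω ∂P, Tendsto (fun n => C.col ((u n).1 ω) 0) atTop (𝓝 (T ω)) := by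
    filter_upwards [hex] with ω h
    exact tendsto_nhds_limUnder h
  have hmT : ∀ f, AEStronglyMeasurable (fun ω => T ω f) P := fun f => by
    refine aestronglyMeasurable_of_tendsto_ae atTop (fun n => S.aestronglyMeasurable_col (u n) f) ?_
    filter_upwards [hT] with ω h
    exact ((ContinuousLinearMap.apply ℂ C.Hil f).continuous.tendsto _).comp h
  have hle : ∀ N, ∫⁻ ω, ∑' i, ‖(u N).1 ω (C.chiHc 0 (C.basis i)) - T ω (C.chi 0 (C.basis i))‖ₑ ^ 2 ∂P ≤
      ENNReal.ofReal ((1 / 4) ^ N) ^ 2 := fun N =>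
    S.lintegral_hs_sub_le hT (u N) (eventually_atTop.2 ⟨N, hu' N⟩)
  have hfin : ∫⁻ ω, ∑' i, ‖T ω (C.chi 0 (C.basis i))‖ₑ ^ 2 ∂P < ∞ := by
    have := lintegral_add_lt_top (P := P)
      (f := fun ω i => (u 0).1 ω (C.chiHc 0 (C.basis i)))
      (g := fun ω i => T ω (C.chi 0 (C.basis i)) - (u 0).1 ω (C.chiHc 0 (C.basis i)))
      (fun i => (u 0).2.1.aestronglyMeasurable _) (u 0).2.2.2.2 ?_
    · simpa using this
    · refine lt_of_le_of_lt ?_ ((hle 0).trans_lt (ENNReal.pow_lt_top ENNReal.ofReal_lt_top))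
      exact lintegral_mono fun ω => ENNReal.tsum_le_tsum fun i => by rw [← enorm_neg, neg_sub]
  let D : S.K2pre := ⟨S.blockOp T, S.blockOp_mem_K2pre hmT hfin⟩
  refine ⟨D, tendsto_iff_norm_sub_tendsto_zero.2 ?_⟩
  refine squeeze_zero (fun _ => norm_nonneg _) (fun N => ?_)
    (tendsto_pow_atTop_nhds_zero_of_lt_one (r := (1 / 4 : ℝ)) (by norm_num) (by norm_num))
  have h1 : ‖u N - D‖ₑ ^ 2 ≤ ENNReal.ofReal ((1 / 4) ^ N) ^ 2 := by
    rw [K2pre.enorm_sq]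
    refine le_trans (le_of_eq ?_) (hle N)
    refine lintegral_congr fun ω => tsum_congr fun i => ?_
    rw [← S.blockOp_chiHc_zero]
    rfl
  have h2 := (ENNReal.pow_le_pow_left_iff two_ne_zero).1 h1
  have h3 := ENNReal.toReal_mono ENNReal.ofReal_ne_top h2
  rwa [toReal_enorm, ENNReal.toReal_ofReal (by positivity)] at h3

instance completeSpace_K2 : CompleteSpace S.K2 := inferInstance

end ErgodicOperator

/-- Two operators commute if they do so on a set whose orthogonal complement is trivial. -/
theorem commute_of_orthogonal {K : Type*} [NormedAddCommGroup K] [InnerProductSpace ℂ K]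
    [CompleteSpace K] {L R : K →L[ℂ] K}
    (h : ∀ x, (∀ y, L (R y) = R (L y) → ⟪y, x⟫_ℂ = 0) → x = 0) : Commute L R := by
  let W : Submodule ℂ K := LinearMap.ker (L.comp R - R.comp L).toLinearMap
  have hW : Wᗮ = ⊥ := by
    rw [Submodule.eq_bot_iff]
    intro x hx
    refine h x fun y hy => (Submodule.mem_orthogonal _ _).1 hx y ?_
    change L (R y) - R (L y) = 0
    rw [hy, sub_self]
  have hcl : IsClosed (W : Set K) := ContinuousLinearMap.isClosed_ker _
  have : CompleteSpace W := hcl.completeSpace_coe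
  have htop : W = ⊤ := (Submodule.orthogonal_eq_bot_iff).1 hW
  refine ContinuousLinearMap.ext fun x => ?_
  have hx : x ∈ W := by rw [htop]; trivial
  exact sub_eq_zero.1 (show L (R x) - R (L x) = 0 from hx)

namespace ErgodicOperator

/-! ## Commutation of left and right multiplications -/

variable {d : ℕ} {C : ConfigSpace d} {Ω : Type*} [MeasurableSpace Ω] [AddAction (Fin d → ℤ) Ω]
  {P : Measure Ω} (S : ErgodicOperator C Ω P)

/-- An operator with a single bounded diagonal of blocks is bounded. -/
theorem exists_clm_blockOp {T : Ω → C.Hil →L[ℂ] C.Hil} {c : Fin d → ℤ} {M : ℝ} (hM : 0 ≤ M)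
    (hTM : ∀ ω f, ‖T ω f‖ ≤ M * ‖f‖) (hTc : ∀ ω b f, b ≠ c → C.chi b (T ω f) = 0) (ω : Ω) :
    ∃ V : C.Hil →L[ℂ] C.Hil, ∀ f : C.Hc, S.blockOp T ω f = V f := by
  -- Row b receives input only from cube b - c, so squared norms add up over cubes without
  -- interference.
  have h1 : ∀ b, ∀ f : C.Hc, C.chi b (S.blockOp T ω f) =
      C.chi b (S.blockOp T ω (C.chiHc (b - c) f)) := by
    intro b f
    have key : (C.chi b).comp (S.blockOp T ω) =
        ((C.chi b).comp (S.blockOp T ω)).comp ((C.chiHc (b - c)).comp C.Hc.subtype) := by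
      refine C.linearMap_ext_chiHc fun a g => ?_
      simp only [LinearMap.comp_apply, Submodule.subtype_apply, C.coe_chiHc]
      by_cases ha : b - c = a
      · rw [ha, C.chiHc_chi_self]
      · rw [C.chiHc_chi_of_ne ha, map_zero, map_zero, S.blockOp_chiHc, S.blockCol_apply, S.chi_U, hTc,
          map_zero]
        exact fun e => ha (by rw [← e]; abel)
    exact LinearMap.congr_fun key f
  have h2 : ∀ f : C.Hc, ‖S.blockOp T ω f‖ₑ ^ 2 ≤ (‖M‖ₑ * ‖(f : C.Hil)‖ₑ) ^ 2 := by
    intro f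
    rw [← C.tsum_enorm_chi_sq, mul_pow, ← C.tsum_enorm_chi_sq f, ← ENNReal.tsum_mul_left,
      ← (Equiv.subRight c).tsum_eq (fun a => ‖M‖ₑ ^ 2 * ‖C.chi a f‖ₑ ^ 2)]
    refine ENNReal.tsum_le_tsum fun b => ?_
    rw [← mul_pow, h1, Equiv.subRight_apply]
    refine pow_le_pow_left' ((C.enorm_chi_le _ _).trans ?_) 2
    rw [← enorm_norm (C.chi (b - c) f), ← enorm_mul, enorm_le_iff_norm_le,
      Real.norm_of_nonneg (mul_nonneg hM (norm_nonneg _)), S.blockOp_chiHc, S.blockCol_apply,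
      LinearIsometryEquiv.norm_map]
    refine (hTM _ _).trans_eq ?_
    rw [LinearIsometryEquiv.norm_map]
  have h3 : ∀ f : C.Hc, ‖S.blockOp T ω f‖ ≤ M * ‖f‖ := fun f => by
    have h4 := (ENNReal.pow_le_pow_left_iff two_ne_zero).1 (h2 f)
    have h5 := ENNReal.toReal_mono (ENNReal.mul_ne_top (by simp) (by simp)) h4
    simpa [abs_of_nonneg hM] using h5
  let V₀ : C.Hc →L[ℂ] C.Hil := (S.blockOp T ω).mkContinuous M h3
  refine ⟨V₀.extend C.Hc.subtypeL, fun f => ?_⟩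
  exact (ContinuousLinearMap.extend_eq (e := C.Hc.subtypeL) V₀ C.dense_hc.denseRange_val
    isUniformEmbedding_subtype_val.isUniformInducing f).symm

variable [MeasurableConstVAdd (Fin d → ℤ) Ω] [ErgodicVAdd (Fin d → ℤ) Ω P]

/-- The bounded operators are total in `𝒦₂`. -/
theorem eq_zero_of_inner_bounded (A : S.K2pre) (hA : ∀ D : S.K2pre,
    (∀ᵐ ω ∂P, ∃ T : C.Hil →L[ℂ] C.Hil, ∀ f : C.Hc, D.1 ω f = T f) →
      ⟪S.toK2 D, S.toK2 A⟫_ℂ = 0) : S.toK2 A = 0 := by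
  -- The test operators are built from one block of `A`, truncated to the event where its
  -- Hilbert-Schmidt norm is at most n, and propagated by covariance along one diagonal. They are
  -- bounded.
  let G : (Fin d → ℤ) → ℕ → Set Ω := fun c n =>
    {ω | hsSq C.basis ((C.chiL c).comp (C.col (A.1 ω) 0)) ≤ (n : ℝ≥0∞) ^ 2}
  have hG : ∀ c n, NullMeasurableSet (G c n) P := fun c n =>
    nullMeasurableSet_le (IsMeasurableOp.aemeasurable_hsSq A.2.1 (K2pre.colBdd A) c 0)
      aemeasurable_const
  have key : ∀ c (n : ℕ), ∀ᵐ ω ∂P, ω ∈ G c n → ∀ f, C.chi c (A.1 ω (C.chiHc 0 f)) = 0 := by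
    intro c n
    let T : Ω → C.Hil →L[ℂ] C.Hil := (G c n).indicator fun ω => (C.chiL c).comp (C.col (A.1 ω) 0)
    have hTA : ∀ᵐ ω ∂P, ∀ f, T ω f =
        (G c n).indicator (fun ω => C.chi c (A.1 ω (C.chiHc 0 f))) ω := by
      filter_upwards [K2pre.colBdd A] with ω h f
      by_cases hω : ω ∈ G c n
      · simp only [T, Set.indicator_of_mem hω]
        rw [ContinuousLinearMap.comp_apply, h.col_apply, C.chiL_apply]
      · simp only [T, Set.indicator_of_notMem hω]
        rfl
    have hTm : ∀ f, AEStronglyMeasurable (fun ω => T ω f) P := fun f => by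
      have h1 : AEStronglyMeasurable
          ((G c n).indicator fun ω => C.chiL c (A.1 ω (C.chiHc 0 f))) P :=
        ((C.chiL c).continuous.comp_aestronglyMeasurable
          (A.2.1.aestronglyMeasurable _)).indicator₀ (hG c n)
      refine h1.congr ?_
      filter_upwards [hTA] with ω h
      rw [h f]
      rfl
    have hTle : ∀ᵐ ω ∂P, ∀ f, ‖T ω (C.chi 0 f)‖ₑ ≤ ‖A.1 ω (C.chiHc 0 f)‖ₑ := by
      filter_upwards [hTA] with ω h f
      rw [h, C.chiHc_chi_self]
      by_cases hω : ω ∈ G c n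
      · rw [Set.indicator_of_mem hω]
        exact C.enorm_chi_le _ _
      · rw [Set.indicator_of_notMem hω, enorm_zero]
        exact zero_le
    have hfin : ∫⁻ ω, ∑' i, ‖T ω (C.chi 0 (C.basis i))‖ₑ ^ 2 ∂P < ∞ := by
      refine lt_of_le_of_lt (lintegral_mono_ae ?_) A.2.2.2.2
      filter_upwards [hTle] with ω h
      exact ENNReal.tsum_le_tsum fun i => pow_le_pow_left' (h _) 2
    let D : S.K2pre := ⟨S.blockOp T, S.blockOp_mem_K2pre hTm hfin⟩
    have hTM : ∀ ω f, ‖T ω f‖ ≤ n * ‖f‖ := by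
      intro ω f
      by_cases hω : ω ∈ G c n
      · simp only [T, Set.indicator_of_mem hω]
        have h1 := (enorm_apply_sq_le_hsSq C.basis ((C.chiL c).comp (C.col (A.1 ω) 0)) f).trans
          (mul_le_mul_left (show _ ≤ (n : ℝ≥0∞) ^ 2 from hω) _)
        rw [← mul_pow] at h1
        have h2 := (ENNReal.pow_le_pow_left_iff two_ne_zero).1 h1
        have h3 := ENNReal.toReal_mono (ENNReal.mul_ne_top (by simp) (by simp)) h2
        simpa using h3
      · simp only [T, Set.indicator_of_notMem hω]
        rw [zero_apply, norm_zero]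
        positivity
    have hTc : ∀ ω b f, b ≠ c → C.chi b (T ω f) = 0 := by
      intro ω b f hb
      by_cases hω : ω ∈ G c n
      · simp only [T, Set.indicator_of_mem hω]
        exact C.chi_chi_of_ne hb _
      · simp only [T, Set.indicator_of_notMem hω]
        exact map_zero _
    have hD := hA D (Eventually.of_forall
      (S.exists_clm_blockOp (Nat.cast_nonneg n) hTM hTc))
    -- `D` is `A` compressed to a block and an event, so its product with `A` equals its product
    -- with itself.
    have hDD : ⟪S.toK2 D, S.toK2 D⟫_ℂ = 0 := by
      rw [← hD, inner_toK2, inner_toK2]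
      refine integral_congr_ae ?_
      filter_upwards [hTA] with ω h
      refine tsum_congr fun i => ?_
      have h1 : D.1 ω (C.chiHc 0 (C.basis i)) = T ω (C.chi 0 (C.basis i)) :=
        S.blockOp_chiHc_zero T ω _
      rw [h1, h, C.chiHc_chi_self]
      by_cases hω : ω ∈ G c n
      · rw [Set.indicator_of_mem hω, ← C.inner_chi, C.chi_chi_self]
      · rw [Set.indicator_of_notMem hω, inner_zero_left, inner_zero_left]
    rw [inner_self_eq_zero, toK2_eq_zero_iff] at hDD
    filter_upwards [K2pre.ae_eq_zero D hDD, hTA] with ω h1 h2 hω f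
    have h3 : T ω (C.chi 0 f) = 0 := by
      rw [← S.blockOp_chiHc_zero]
      exact LinearMap.congr_fun h1 _
    rw [h2, Set.indicator_of_mem hω, C.chiHc_chi_self] at h3
    exact h3
  rw [toK2_eq_zero_iff, hsNormSq]
  refine (lintegral_congr_ae ?_).trans lintegral_zero
  filter_upwards [ae_all_iff.2 fun c => ae_all_iff.2 (key c), K2pre.ae_summable A,
    K2pre.colBdd A] with ω h1 h2 h3
  rw [← h3.hsSq_col] at h2
  have h4 : ∀ f, A.1 ω (C.chiHc 0 f) = 0 := fun f => by
    refine C.ext_chi fun c => ?_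
    rw [map_zero]
    obtain ⟨n, hn⟩ := ENNReal.exists_nat_gt h2.ne
    refine h1 c (n + 1) ?_ f
    have h5 : hsSq C.basis ((C.chiL c).comp (C.col (A.1 ω) 0)) ≤ hsSq C.basis (C.col (A.1 ω) 0) :=
      hsSq_mono _ fun x => C.norm_chi_le _ _
    refine h5.trans (hn.le.trans ?_)
    have h6 : n ≤ (n + 1) ^ 2 := by nlinarith
    exact_mod_cast h6
  simp [h4]

/-- Associativity is clear only on bounded operators; their totality extends commutation to all of
𝒦₂. -/
theorem commute_leftPVM_rightPVM {B D : Set ℝ} (hB : MeasurableSet B) (hD : MeasurableSet D) :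
    Commute (S.leftPVM.proj B) (S.rightPVM.proj D) := by
  have hBb : IsBddMeas (B.indicator (1 : ℝ → ℂ)) := IsBddMeas.indicator_one hB
  have hDb : IsBddMeas (D.indicator (1 : ℝ → ℂ)) := IsBddMeas.indicator_one hD
  rw [S.leftPVM_proj hB, ← PVM.integral_indicator _ hD, ← S.rightMul_fun_H hDb]
  refine commute_of_orthogonal fun x hx => ?_
  obtain ⟨A, rfl⟩ := SeparationQuotient.surjective_mk x
  exact S.eq_zero_of_inner_bounded A fun D hD => hx _
    (leftMul_rightMul_comm (S.isBddCovariant_fun_H hBb) (S.isBddCovariant_fun_H hDb) hD)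

/-! ## The joint spectral measure of left and right multiplication -/

theorem exists_jointPVM : ∃ G : PVM (ℝ × ℝ) S.K2,
    G.map Prod.fst measurable_fst = S.leftPVM ∧ G.map Prod.snd measurable_snd = S.rightPVM :=
  exists_joint_pvm _ _ fun _ _ hB hD => S.commute_leftPVM_rightPVM hB hD

end ErgodicOperator

/-! ## The Fermi commutator -/

theorem PVM.proj_compl {α K : Type*} [MeasurableSpace α] [NormedAddCommGroup K]
    [InnerProductSpace ℂ K] [CompleteSpace K] (E : PVM α K) {B : Set α} (hB : MeasurableSet B)
    (x : K) : E.proj Bᶜ x = x - E.proj B x := by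
  have h := E.integral_add (IsBddMeas.indicator_one hB) (IsBddMeas.indicator_one hB.compl)
  rw [Set.indicator_self_add_compl, E.integral_one, E.integral_indicator hB,
    E.integral_indicator hB.compl] at h
  have h2 := congrArg (fun T : K →L[ℂ] K => T x) h
  exact (eq_sub_of_add_eq' h2.symm)

theorem PVM.proj_proj_self {α K : Type*} [MeasurableSpace α] [NormedAddCommGroup K]
    [InnerProductSpace ℂ K] (E : PVM α K) {B : Set α} (hB : MeasurableSet B) (x : K) :
    E.proj B (E.proj B x) = E.proj B x := by
  have h1 := E.inter B B hB hB
  rw [Set.inter_self] at h1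
  exact (congrArg (fun T : K →L[ℂ] K => T x) h1).symm

/-- Multiplication by a real function is symmetric. -/
theorem ConfigSpace.inner_mul_real {d : ℕ} (C : ConfigSpace d) {φ : C.Pt → ℝ} {u v xu xv : C.Hil}
    (hu : xu =ᵐ[C.vol] fun x => (φ x : ℂ) * u x) (hv : xv =ᵐ[C.vol] fun x => (φ x : ℂ) * v x) :
    ⟪xu, v⟫_ℂ = ⟪u, xv⟫_ℂ := by
  rw [L2.inner_def, L2.inner_def]
  refine integral_congr_ae ?_
  filter_upwards [hu, hv] with x h1 h2
  rw [h1, h2]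
  simp only [RCLike.inner_apply, map_mul, Complex.conj_ofReal]
  ring

namespace ErgodicOperator

variable {d : ℕ} [NeZero d] {C : ConfigSpace d} {Ω : Type*} [MeasurableSpace Ω]
  [AddAction (Fin d → ℤ) Ω] {P : Measure Ω} (S : ErgodicOperator C Ω P)

/-- The commutator `Y = i [X₁, P]` is symmetric, and it maps the range of `P` to its complement and
conversely: if `⟪D f, k⟫ = ⟪P f, Y k⟫` then `P D = 0`, and if `⟪D f, k⟫ = ⟪(1 - P) f, Y k⟫` then
`(1 - P) D = 0`. -/
theorem IsFermiCommutator.spec {S : ErgodicOperator C Ω P} {e : ℝ} {Y : Ω → C.Hc →ₗ[ℂ] C.Hil}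
    (hY : S.IsFermiCommutator e Y) : ∀ᵐ ω ∂P,
      (∀ f k : C.Hc, ⟪Y ω f, (k : C.Hil)⟫_ℂ = ⟪(f : C.Hil), Y ω k⟫_ℂ) ∧
      (∀ (f : C.Hc) (v : C.Hil), (∀ k : C.Hc, ⟪v, (k : C.Hil)⟫_ℂ =
        ⟪(spectralMeasure (S.H ω)).proj (Set.Iic e) f, Y ω k⟫_ℂ) →
          (spectralMeasure (S.H ω)).proj (Set.Iic e) v = 0) ∧
      ∀ (f : C.Hc) (v : C.Hil), (∀ k : C.Hc, ⟪v, (k : C.Hil)⟫_ℂ =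
        ⟪(spectralMeasure (S.H ω)).proj (Set.Ioi e) f, Y ω k⟫_ℂ) →
          (spectralMeasure (S.H ω)).proj (Set.Ioi e) v = 0 := by
  filter_upwards [hY] with ω hω
  set E := spectralMeasure (S.H ω) with hE
  choose g h hg hh hYf using hω
  have hp : S.fermiProj e ω = E.proj (Set.Iic e) := rfl
  rw [hp] at hg hYf
  set p := E.proj (Set.Iic e) with hpp
  -- `g f` and `h f` play the roles of X₁Pf and X₁f. The symmetry of X₁ is used only between vectors
  -- on which these products are known to be square integrable.
  have s1 : ∀ f k : C.Hc, ⟪g f, p k⟫_ℂ = ⟪p f, g k⟫_ℂ := fun f k => C.inner_mul_real (hg f) (hg k)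
  have s3 : ∀ f k : C.Hc, ⟪h f, p k⟫_ℂ = ⟪(f : C.Hil), g k⟫_ℂ := fun f k =>
    C.inner_mul_real (hh f) (hg k)
  have s4 : ∀ f k : C.Hc, ⟪g f, (k : C.Hil)⟫_ℂ = ⟪p f, h k⟫_ℂ := fun f k =>
    C.inner_mul_real (hg f) (hh k)
  have hsymm : ∀ x y, ⟪p x, y⟫_ℂ = ⟪x, p y⟫_ℂ := E.symm _
  have hpp' : ∀ x, p (p x) = p x := E.proj_proj_self measurableSet_Iic
  have hq : ∀ x, E.proj (Set.Ioi e) x = x - p x := fun x => by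
    rw [← Set.compl_Iic, E.proj_compl measurableSet_Iic]
  refine ⟨fun f k => ?_, fun f v hv => ?_, fun f v hv => ?_⟩
  · rw [hYf, hYf, inner_smul_left, inner_smul_right, inner_sub_left, inner_sub_right, hsymm, s3, s4,
      ← hsymm, Complex.conj_I]
    ring
  -- Weakly, v is YPf, which equals i(1-P)X₁Pf.
  · have h1 : v = Complex.I • (g f - p (g f)) := C.eq_of_inner_Hc fun k => by
      have t1 : ⟪p f, g k⟫_ℂ = ⟪p (g f), (k : C.Hil)⟫_ℂ := by rw [← s1, hsymm]
      have t2 : ⟪p f, p (h k)⟫_ℂ = ⟪g f, (k : C.Hil)⟫_ℂ := by rw [← hsymm, hpp', s4]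
      rw [hv, hYf, inner_smul_left, inner_smul_right, inner_sub_left, inner_sub_right, t1, t2,
        Complex.conj_I]
      ring
    rw [h1, map_smul, map_sub, hpp', sub_self, smul_zero]
  -- Weakly, v is Y(1-P)f, which equals -iPX₁(1-P)f.
  · have h1 : v = -Complex.I • p (h f - g f) := C.eq_of_inner_Hc fun k => by
      have t1 : ⟪(f : C.Hil) - p f, p (h k)⟫_ℂ = 0 := by
        rw [inner_sub_left, hsymm _ (p (h k)), hpp', sub_self]
      rw [hv, hYf, hq, inner_smul_left, inner_smul_right, inner_sub_right, t1, sub_zero, hsymm _ (k : C.Hil),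
        inner_sub_left, inner_sub_left, s3, s1, map_neg, Complex.conj_I, neg_neg]
    rw [h1, hq, map_smul, hpp', sub_self]

variable [MeasurableConstVAdd (Fin d → ℤ) Ω] [ErgodicVAdd (Fin d → ℤ) Ω P]

omit [NeZero d] in
-- This is χ_B(H) Y χ_B(H) = 0. Since χ_B(H)f need not have compact support, the product Y χ_B(H)f
-- is known only through its pairings; symmetry of Y identifies Y‡ with Y in them.
theorem leftPVM_rightPVM_toK2_eq_zero {y : S.K2pre} {B : Set ℝ} (hB : MeasurableSet B)
    (hsymm : ∀ᵐ ω ∂P, ∀ f k : C.Hc, ⟪y.1 ω f, (k : C.Hil)⟫_ℂ = ⟪(f : C.Hil), y.1 ω k⟫_ℂ)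
    (h : ∀ᵐ ω ∂P, ∀ (f : C.Hc) (v : C.Hil), (∀ k : C.Hc, ⟪v, (k : C.Hil)⟫_ℂ =
        ⟪(spectralMeasure (S.H ω)).proj B f, y.1 ω k⟫_ℂ) →
          (spectralMeasure (S.H ω)).proj B v = 0) :
    S.leftPVM.proj B (S.rightPVM.proj B (S.toK2 y)) = 0 := by
  have hBb : IsBddMeas (B.indicator (1 : ℝ → ℂ)) := IsBddMeas.indicator_one hB
  have hc := S.isBddCovariant_fun_H hBb
  obtain ⟨D, hD1, hD2⟩ := hc.exists_rightMul_toK2 y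
  rw [← PVM.integral_indicator S.rightPVM hB, ← S.rightMul_fun_H hBb, hD1, S.leftPVM_proj hB]
  rw [S.leftFun_toK2_of_ae (D := hc.preMul D) hBb fun _ _ => rfl, toK2_eq_zero_iff,
    hsNormSq_congr (B := 0)]
  · simp [hsNormSq]
  · filter_upwards [hD2, hsymm, h, K2pre.rowBdd y] with ω h1 h2 h3 h4
    refine LinearMap.ext fun f => ?_
    rw [hc.preMul_apply, S.fun_H_indicator hB]
    refine h3 f _ fun k => ?_
    rw [h1, h4.dagger_eq h2, S.fun_H_indicator hB]

variable {S} in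
theorem measure_oppositeSides_compl {G : PVM (ℝ × ℝ) S.K2}
    (hG1 : G.map Prod.fst measurable_fst = S.leftPVM)
    (hG2 : G.map Prod.snd measurable_snd = S.rightPVM) {e : ℝ} {y : S.K2pre}
    (hy : S.IsFermiCommutator e y.1) : G.measure (S.toK2 y) (oppositeSides e)ᶜ = 0 := by
  have h := hy.spec
  have hs : ∀ᵐ ω ∂P, ∀ f k : C.Hc, ⟪y.1 ω f, (k : C.Hil)⟫_ℂ = ⟪(f : C.Hil), y.1 ω k⟫_ℂ := by
    filter_upwards [h] with ω hω using hω.1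
  refine G.measure_oppositeSides_compl ?_ ?_
  · rw [G.proj_prod measurableSet_Iic measurableSet_Iic, hG1, hG2]
    refine S.leftPVM_rightPVM_toK2_eq_zero measurableSet_Iic hs ?_
    filter_upwards [h] with ω hω using hω.2.1
  · rw [G.proj_prod measurableSet_Ioi measurableSet_Ioi, hG1, hG2]
    refine S.leftPVM_rightPVM_toK2_eq_zero measurableSet_Ioi hs ?_
    filter_upwards [h] with ω hω using hω.2.2

omit [NeZero d] in
/-- The joint spectral measure of left and right multiplication diagonalizes `ℋ_L`, `ℋ_R`, `ℒ`. -/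
theorem spectral_data {G : PVM (ℝ × ℝ) S.K2} (hG1 : G.map Prod.fst measurable_fst = S.leftPVM)
    (hG2 : G.map Prod.snd measurable_snd = S.rightPVM) :
    S.correlationMeasure = G.measure ∧ (∀ e, S.fermiDiff e = G.integral (fermiSign e)) ∧
      IsSpectralMeasure (G.map (fun p : ℝ × ℝ => p.1 - p.2) (by fun_prop)) S.liouvillian := by
  have hL := S.isSpectralMeasure_HL
  have hR := S.isSpectralMeasure_HR
  refine ⟨?_, fun e => ?_, ?_⟩
  · funext A
    rw [correlationMeasure, jointSpectralMeasure_eq (G := G) (by rwa [hG1]) (by rwa [hG2])]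
  · rw [fermiDiff, hL.spectralMeasure_eq, hR.spectralMeasure_eq, ← hG1, ← hG2,
      G.proj_sub_proj_eq_integral]
  · have h : (fun t => (S.evolutionL t).comp (S.evolutionR (-t))) =
        (G.map (fun p : ℝ × ℝ => p.1 - p.2) (by fun_prop)).unitary := by
      funext t
      rw [S.evolutionL_eq, S.evolutionR_eq, ← hG1, ← hG2, G.unitary_comp_unitary]
    rw [liouvillian, h]
    exact PVM.isSpectralMeasure_stoneGenerator _

end ErgodicOperator

end MagneticKubo

end

/-! ### The spectral formula for the conductivity measure -/

theorem mainTheorem5 {d : ℕ} [NeZero d] {Ω : Type*} [MeasurableSpace Ω] (P : Measure Ω)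
    [IsProbabilityMeasure P] [AddAction (Fin d → ℤ) Ω] [MeasurableConstVAdd (Fin d → ℤ) Ω]
    [ErgodicVAdd (Fin d → ℤ) Ω P] (C : MagneticKubo.ConfigSpace d)
    (S : MagneticKubo.ErgodicOperator C Ω P)
    (hS : MagneticKubo.ErgodicOperator.IsMagneticSchrodinger C S)
    (E : ℝ) (y : S.K2pre) (hy : S.IsFermiCommutator E y) :
    (∀ B : Set ℝ, MeasurableSet B →
      S.conductivityMeasure E (S.toK2 y) B =
        ENNReal.ofReal Real.pi * ∫⁻ p, ENNReal.ofReal |p.1 - p.2| * B.indicator 1 (p.1 - p.2)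
          ∂(S.correlationMeasure (S.toK2 y))) ∧
    (∀ h : S.fermiDiff E (S.toK2 y) ∈ S.liouvillian.domain,
      Integrable (fun p : ℝ × ℝ => |p.1 - p.2|) (S.correlationMeasure (S.toK2 y)) ∧
      ∀ B : Set ℝ, MeasurableSet B →
        Real.pi * ⟪S.toK2 y, (MagneticKubo.spectralMeasure S.liouvillian).proj B
            (-S.liouvillian ⟨S.fermiDiff E (S.toK2 y), h⟩)⟫_ℂ =
          ((Real.pi * ∫ p, |p.1 - p.2| * B.indicator 1 (p.1 - p.2)
            ∂(S.correlationMeasure (S.toK2 y)) : ℝ) : ℂ)) ∧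
    S.correlationMeasure (S.toK2 y) (MagneticKubo.oppositeSides E)ᶜ = 0 := by
  obtain ⟨G, hG1, hG2⟩ := S.exists_jointPVM
  obtain ⟨hcorr, hfermi, hT⟩ := S.spectral_data hG1 hG2
  have hY := S.measure_oppositeSides_compl hG1 hG2 hy
  have hD : S.fermiDiff E (S.toK2 y) = G.integral (MagneticKubo.fermiSign E) (S.toK2 y) :=
    congrArg (fun T => T (S.toK2 y)) (hfermi E)
  refine ⟨fun B hB => ?_, ?_, ?_⟩
  · rw [MagneticKubo.ErgodicOperator.conductivityMeasure, hcorr, hD]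
    exact G.iSup_cutoff hT hY hB
  · exact G.integrable_and_inner_proj_generator hT hY hD (congrFun hcorr _)
  · rw [hcorr]
    exact hY
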